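/- **Setting.** A formal hypersurface $M$ through $p\in\mathbb C^2$ is given by a formal power series $\rho(Z,\bar Z)$ in $Z-p$, $\overline{Z-p}$ that vanishes at $p$, satisfies the reality condition $\rho_{I\bar J}=\overline{\rho_{J\bar I}}$ and has $d\rho(p)\ne0$. Formal coordinates $(z,w)$ vanishing at $p$ (that is, $Z=H(z,w)$ with an invertible formal holomorphic map $H\colon(\mathbb C^2,0)\to(\mathbb C^2,p)$) are *normal* for $M$ if $M$ is given in them by $\operatorname{Im}w=\varphi(z,\bar z,\operatorname{Re}w)$ with a real formal power series $\varphi(z,\chi,s)$ such that $\varphi(z,0,s)=\varphi(0,\chi,s)=0$. In such coordinates $M$ is also given by $w=Q(z,\bar z,\bar w)$ with a formal power series $Q(z,\chi,\tau)$, $Q(0)=0$. Write $$\varphi=\sum_{\alpha\ge1,\,\mu\ge0}\varphi_{\alpha,\mu}(\chi)z^\alpha s^\mu,\qquad Q=\tau+\sum_{\alpha\ge1,\,\mu\ge0}q_{\alpha,\mu}(\chi)z^\alpha\tau^\mu .$$ On $\mathbb N^2$ let $(\alpha,\mu)\preceq(\beta,\nu)$ mean $\alpha+\mu\le\beta+\nu$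 and $\mu\le\nu$, and let $\prec$ mean $\preceq$ and $\ne$. An *invariant pair* of $M$ is a pair $(\alpha,\mu)$ with $\varphi_{\alpha,\mu}\not\equiv0$ and $\varphi_{\beta,\nu}\equiv0$ for all $(\beta,\nu)\prec(\alpha,\mu)$; $n(\alpha,\mu)$ is the order of vanishing of $\varphi_{\alpha,\mu}(\chi)$ at $\chi=0$. The set $Q_M$ of invariant pairs and the numbers $n(\alpha,\mu)$ do not depend on the choice of the normal coordinates. Suppose that $Q_M$ contains two points $(\alpha,\mu)\ne(\tilde\alpha,\tilde\mu)$ such that $n:=n(\alpha,\mu)\ne\alpha$, and put $\tilde n:=n(\tilde\alpha,\tilde\mu)$. For $k\ge1$ let $$D_k=\det\begin{pmatrix}\alpha+n&\frac{\mu}{k+1}-1\\ \tilde\alpha+\tilde n&\frac{\tilde\mu}{k+1}-1\end{pmatrix},\qquad K=\{k\in\mathbb Z:\ k\ge1,\ D_k=0\},$$ let, when $\alpha+n\ne\tilde\alpha+\tilde n$, $$\lambda=\frac{(\tilde\alpha+\tilde n)\mu-(\alpha+n)\tilde\mu}{(\tilde\alpha+\tilde n)-(\alpha+n)}-1,$$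 and for integers $a,b,m$ let $C(a,b,m)=\{(\gamma,r)\in(\mathbb C\setminus\{0\})\times(\mathbb R\setminus\{0\}):\ \gamma^{a}\bar\gamma^{\,b}r^{m-1}=1\}$. *The constants $c$ and $\varepsilon$.* Consider normal coordinates of $M$ in which $$q_{\alpha,\mu}(\chi)=2i\chi^n,\qquad q_{\tilde\alpha,\tilde\mu}(\chi)=ic\,\varepsilon\,\chi^{\tilde n}+O(\chi^{\tilde n+1}),\qquad c>0,\ |\varepsilon|=1, \tag{1}$$ where we require $c=2$ unless $\tilde\mu(\alpha+n)-\mu(\tilde\alpha+\tilde n)=(\alpha+n)-(\tilde\alpha+\tilde n)$. Among the values of $(c,\varepsilon)$ that occur in this way there is exactly one for which the argument of $\varepsilon$ in $[0,2\pi)$ is the smallest possible for the given $c$; from now on $c$ and $\varepsilon$ denote these values. At least one of $\alpha,\tilde\alpha$ is $>1$; let $(\alpha',n',\mu')$ be one of $(\alpha,n,\mu)$, $(\tilde\alpha,\tilde n,\tilde\mu)$ with $\alpha'>1$. We say that $Q$ is in *normal form* if (1) holds with these $c,\varepsilon$ and $$q_{\alpha,\mu+k}(\chi)\ \text{is a polynomial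 of degree at most } n-1\ \text{ for } k\ge1, \tag{2}$$ $$q^{(n')}_{\alpha'-1,\mu'+k}(0)=0\ \text{ for } k\ge1, \tag{3}$$ $$\operatorname{Im}\bigl(\varepsilon^{-1}q^{(\tilde n)}_{\tilde\alpha,\tilde\mu+k}(0)\bigr)=0\ \text{ for } k\ge1,\ k\notin K. \tag{4}$$ **Theorem (normal form).** Let $M\subset\mathbb C^2$ be a formal hypersurface such that $Q_M$ contains at least two points $(\alpha,\mu)\ne(\tilde\alpha,\tilde\mu)$, where $n(\alpha,\mu)\ne\alpha$. Then there are normal coordinates $(z,w)$ for $M$ in which $Q$ is in normal form. Furthermore, if $(z,w)$ are such coordinates, then any other such coordinates $(z',w')$ are related to them by an invertible formal map $z=F(z',w')$, $w=G(z',w')$; one has $(F_z(0),G_w(0))\in C(\alpha,n,\mu)\cap C(\tilde\alpha,\tilde n,\tilde\mu)$ (in particular, $G_w(0)$ is real), and, for fixed $(z,w)$, the map $(F,G)$ is uniquely determined by $F_z(0)$, $G_w(0)$ and the numbers $\operatorname{Re}G_{w^{k+1}}(0)$, $k\in K$. The set $K$ has at most one point, and it is empty if and only if $\alpha+n=\tilde\alpha+\tilde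 n$ or $\lambda$ is not an integer $\ge1$. -/

import Mathlib

namespace FormalHypersurface

noncomputable section

/-- The multi-index with exponents `e 0, e 1, …`. -/
def mon {k : ℕ} (e : Fin k → ℕ) : Fin k →₀ ℕ := Finsupp.equivFunOnFinite.symm e

/-- The power series whose coefficients are the complex conjugates of those of `f`. -/
def conj {k : ℕ} (f : MvPowerSeries (Fin k) ℂ) : MvPowerSeries (Fin k) ℂ :=
  MvPowerSeries.map (starRingEnd ℂ) f

/-- `ρ(Z, Z̄)`, a formal power series in `Z₁, Z₂, Z̄₁, Z̄₂` (in this order, centred at the base point),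
defines a formal hypersurface in `ℂ²`: it vanishes at the base point, it satisfies the reality
condition, and `dρ ≠ 0` there. -/
structure IsFormalHypersurface (ρ : MvPowerSeries (Fin 4) ℂ) : Prop where
  zero : MvPowerSeries.constantCoeff ρ = 0
  real : ∀ a b c d : ℕ, MvPowerSeries.coeff (mon ![a, b, c, d]) ρ =
    starRingEnd ℂ (MvPowerSeries.coeff (mon ![c, d, a, b]) ρ)
  nondeg : ∃ i : Fin 4, MvPowerSeries.coeff (Finsupp.single i 1) ρ ≠ 0

/-- The Jacobian matrix at the origin of a pair of power series in two variables. -/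
def jac (H : Fin 2 → MvPowerSeries (Fin 2) ℂ) : Matrix (Fin 2) (Fin 2) ℂ :=
  Matrix.of fun i j => MvPowerSeries.coeff (Finsupp.single j 1) (H i)

/-- Invertible formal holomorphic maps `(ℂ², 0) → (ℂ², 0)`. -/
def IsFormalBihol (H : Fin 2 → MvPowerSeries (Fin 2) ℂ) : Prop :=
  (∀ i, MvPowerSeries.constantCoeff (H i) = 0) ∧ (jac H).det ≠ 0

/-- The composition `H ∘ T` of formal maps of `(ℂ², 0)`. -/
def comp (H T : Fin 2 → MvPowerSeries (Fin 2) ℂ) : Fin 2 → MvPowerSeries (Fin 2) ℂ :=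
  fun i => MvPowerSeries.subst T (H i)

/-- `ρ(H(z, w), H̄(χ, τ))`, a power series in the variables `z, w, χ, τ` (in this order). -/
def pullback (ρ : MvPowerSeries (Fin 4) ℂ) (H : Fin 2 → MvPowerSeries (Fin 2) ℂ) :
    MvPowerSeries (Fin 4) ℂ :=
  let zw : Fin 2 → MvPowerSeries (Fin 4) ℂ := ![MvPowerSeries.X 0, MvPowerSeries.X 1]
  let χτ : Fin 2 → MvPowerSeries (Fin 4) ℂ := ![MvPowerSeries.X 2, MvPowerSeries.X 3]
  MvPowerSeries.subst
    ![MvPowerSeries.subst zw (H 0), MvPowerSeries.subst zw (H 1),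
      MvPowerSeries.subst χτ (conj (H 0)), MvPowerSeries.subst χτ (conj (H 1))] ρ

/-- The series `Im w - φ(z, z̄, Re w)` with `(z̄, w̄)` replaced by `(χ, τ)`, that is,
`(w - τ) / (2i) - φ(z, χ, (w + τ) / 2)`, in the variables `z, w, χ, τ`. -/
def realDefining (φ : MvPowerSeries (Fin 3) ℂ) : MvPowerSeries (Fin 4) ℂ :=
  MvPowerSeries.C (1 / (2 * Complex.I)) * (MvPowerSeries.X 1 - MvPowerSeries.X 3) -
    MvPowerSeries.subst
      (![MvPowerSeries.X 0, MvPowerSeries.X 2,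
        MvPowerSeries.C (1 / 2) * (MvPowerSeries.X 1 + MvPowerSeries.X 3)] :
        Fin 3 → MvPowerSeries (Fin 4) ℂ) φ

/-- The series `w - Q(z, χ, τ)` in the variables `z, w, χ, τ`. -/
def complexDefining (Q : MvPowerSeries (Fin 3) ℂ) : MvPowerSeries (Fin 4) ℂ :=
  MvPowerSeries.X 1 -
    MvPowerSeries.subst
      (![MvPowerSeries.X 0, MvPowerSeries.X 2, MvPowerSeries.X 3] :
        Fin 3 → MvPowerSeries (Fin 4) ℂ) Q

/-- The formal coordinates `(z, w)` given by `Z = H(z, w)` are normal for the hypersurface defined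
by `ρ`, which has there the equation `Im w = φ(z, z̄, Re w)`; here `φ = φ(z, χ, s)` is real and
`φ(z, 0, s) = φ(0, χ, s) = 0`. -/
structure IsRealEquation (ρ : MvPowerSeries (Fin 4) ℂ) (H : Fin 2 → MvPowerSeries (Fin 2) ℂ)
    (φ : MvPowerSeries (Fin 3) ℂ) : Prop where
  bihol : IsFormalBihol H
  real : ∀ a b m : ℕ, MvPowerSeries.coeff (mon ![a, b, m]) φ =
    starRingEnd ℂ (MvPowerSeries.coeff (mon ![b, a, m]) φ)
  normal_left : ∀ a m : ℕ, MvPowerSeries.coeff (mon ![a, 0, m]) φ = 0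
  normal_right : ∀ b m : ℕ, MvPowerSeries.coeff (mon ![0, b, m]) φ = 0
  eqn : ∃ a : MvPowerSeries (Fin 4) ℂ, pullback ρ H = a * realDefining φ

/-- `Z = H(z, w)` defines normal coordinates `(z, w)` for the hypersurface defined by `ρ`. -/
def IsNormalCoordinates (ρ : MvPowerSeries (Fin 4) ℂ)
    (H : Fin 2 → MvPowerSeries (Fin 2) ℂ) : Prop :=
  ∃ φ, IsRealEquation ρ H φ

/-- In the coordinates `(z, w)`, `Z = H(z, w)`, the hypersurface defined by `ρ` has the complex
equation `w = Q(z, z̄, w̄)`, where `Q = Q(z, χ, τ)`, `Q(0) = 0`. -/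
def IsComplexEquation (ρ : MvPowerSeries (Fin 4) ℂ) (H : Fin 2 → MvPowerSeries (Fin 2) ℂ)
    (Q : MvPowerSeries (Fin 3) ℂ) : Prop :=
  MvPowerSeries.constantCoeff Q = 0 ∧
    ∃ a : MvPowerSeries (Fin 4) ℂ, pullback ρ H = a * complexDefining Q

/-- The coefficient `f_{α,μ}(χ)` of `z^α s^μ` in a power series `f(z, χ, s)`. For `α ≥ 1` the
coefficients of `Q(z, χ, τ)` and of `Q(z, χ, τ) - τ` are the same. -/
def cf (f : MvPowerSeries (Fin 3) ℂ) (α μ : ℕ) : PowerSeries ℂ :=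
  PowerSeries.mk fun j => MvPowerSeries.coeff (mon ![α, j, μ]) f

/-- The partial order `(α, μ) ≺ (β, ν)` on `ℕ²`. -/
def Prec (p q : ℕ × ℕ) : Prop :=
  p.1 + p.2 ≤ q.1 + q.2 ∧ p.2 ≤ q.2 ∧ p ≠ q

/-- `(α, μ)` is an invariant pair of `Im w = φ(z, z̄, Re w)`. -/
def IsInvariantPair (φ : MvPowerSeries (Fin 3) ℂ) (α μ : ℕ) : Prop :=
  cf φ α μ ≠ 0 ∧ ∀ β ν : ℕ, Prec (β, ν) (α, μ) → cf φ β ν = 0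

/-- The set `Λ_M` of triples `(α, n, μ)` where `(α, μ)` is an invariant pair of the hypersurface `M`
defined by `ρ` and `n = n(α, μ)` is the vanishing order of `φ_{α,μ}(χ)`, computed in normal
coordinates. -/
def Lam (ρ : MvPowerSeries (Fin 4) ℂ) : Set (ℕ × ℕ × ℕ) :=
  {t | ∃ H φ, IsRealEquation ρ H φ ∧ IsInvariantPair φ t.1 t.2.2 ∧
    IsLeast {j : ℕ | PowerSeries.coeff j (cf φ t.1 t.2.2) ≠ 0} t.2.1}

/-- The set `C(α, n, μ)`. -/
def CSet (α n μ : ℕ) : Set (ℂ × ℝ) :=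
  {p | p.1 ≠ 0 ∧ p.2 ≠ 0 ∧
    p.1 ^ α * (starRingEnd ℂ p.1) ^ n * (p.2 : ℂ) ^ ((μ : ℤ) - 1) = 1}

/-- The determinant `D_k`; `(α₁, n₁, μ₁)` is the second triple. -/
def D (α n μ α₁ n₁ μ₁ k : ℕ) : ℚ :=
  Matrix.det !![(α : ℚ) + n, (μ : ℚ) / (k + 1) - 1; (α₁ : ℚ) + n₁, (μ₁ : ℚ) / (k + 1) - 1]

/-- The set `K` of integers `k ≥ 1` with `D_k = 0`. -/
def K (α n μ α₁ n₁ μ₁ : ℕ) : Set ℕ :=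
  {k | 1 ≤ k ∧ D α n μ α₁ n₁ μ₁ k = 0}

/-- The number `λ`, meaningful for `α + n ≠ α₁ + n₁`. -/
def lam (α n μ α₁ n₁ μ₁ : ℕ) : ℚ :=
  (((α₁ : ℚ) + n₁) * μ - ((α : ℚ) + n) * μ₁) / (((α₁ : ℚ) + n₁) - ((α : ℚ) + n)) - 1

/-- `q_{α,μ}(χ) = 2i χ^n` and `q_{α₁,μ₁}(χ) = i c ε χ^{n₁} + O(χ^{n₁+1})`. -/
def IsPrelimNormalized (Q : MvPowerSeries (Fin 3) ℂ) (α n μ α₁ n₁ μ₁ : ℕ) (c : ℝ) (ε : ℂ) : Prop :=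
  cf Q α μ = PowerSeries.monomial n (2 * Complex.I) ∧
  (∀ j < n₁, PowerSeries.coeff j (cf Q α₁ μ₁) = 0) ∧
  PowerSeries.coeff n₁ (cf Q α₁ μ₁) = Complex.I * c * ε

/-- The hypersurface defined by `ρ` has normal coordinates in which its complex equation satisfies
the preliminary normalization with the constants `c` and `ε`. -/
def IsAttained (ρ : MvPowerSeries (Fin 4) ℂ) (α n μ α₁ n₁ μ₁ : ℕ) (c : ℝ) (ε : ℂ) : Prop :=
  ∃ H Q, IsNormalCoordinates ρ H ∧ IsComplexEquation ρ H Q ∧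
    IsPrelimNormalized Q α n μ α₁ n₁ μ₁ c ε

/-- The case in which `c` is an invariant (Case A). -/
def CaseA (α n μ α₁ n₁ μ₁ : ℕ) : Prop :=
  (μ₁ : ℤ) * (α + n) - μ * (α₁ + n₁) = ((α : ℤ) + n) - (α₁ + n₁)

/-- `c` and `ε` are the constants of the preliminary normalization of the hypersurface defined by
`ρ`: `c > 0` is the modulus that occurs, and is normalized to be `2` outside Case A; `|ε| = 1`, and
`ε` has the least possible argument in `[0, 2π)`. -/
def IsPrelimConstants (ρ : MvPowerSeries (Fin 4) ℂ) (α n μ α₁ n₁ μ₁ : ℕ) (c : ℝ) (ε : ℂ) : Prop :=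
  0 < c ∧ (¬ CaseA α n μ α₁ n₁ μ₁ → c = 2) ∧
  ∃ θ : ℝ, ε = Complex.exp (θ * Complex.I) ∧
    IsLeast {t : ℝ | 0 ≤ t ∧ t < 2 * Real.pi ∧
      IsAttained ρ α n μ α₁ n₁ μ₁ c (Complex.exp (t * Complex.I))} θ

/-- The normal form conditions on `Q`. The triple `(α', n', μ')` is the one of the two triples
that has been chosen so that `α' > 1`. Vanishing of derivatives at `0` (and of their imaginary
parts) is expressed by the corresponding Taylor coefficients. -/
structure IsNormalForm (Q : MvPowerSeries (Fin 3) ℂ) (α n μ α₁ n₁ μ₁ α' n' μ' : ℕ)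
    (c : ℝ) (ε : ℂ) : Prop where
  prelim : IsPrelimNormalized Q α n μ α₁ n₁ μ₁ c ε
  degree : ∀ k, 1 ≤ k → ∀ j, n ≤ j → PowerSeries.coeff j (cf Q α (μ + k)) = 0
  shifted : ∀ k, 1 ≤ k → PowerSeries.coeff n' (cf Q (α' - 1) (μ' + k)) = 0
  imag : ∀ k, 1 ≤ k → k ∉ K α n μ α₁ n₁ μ₁ →
    (ε⁻¹ * PowerSeries.coeff n₁ (cf Q α₁ (μ₁ + k))).im = 0

/-- `Z = H(z, w)` defines normal coordinates for the hypersurface defined by `ρ` in which its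
complex equation `w = Q(z, z̄, w̄)` is in normal form. -/
def IsNormalizing (ρ : MvPowerSeries (Fin 4) ℂ) (α n μ α₁ n₁ μ₁ α' n' μ' : ℕ) (c : ℝ) (ε : ℂ)
    (H : Fin 2 → MvPowerSeries (Fin 2) ℂ) : Prop :=
  IsNormalCoordinates ρ H ∧
    ∃ Q, IsComplexEquation ρ H Q ∧ IsNormalForm Q α n μ α₁ n₁ μ₁ α' n' μ' c ε

end

end FormalHypersurface

/-! Write `P = Q - τ`, and let `T = (F, G)` express old normal coordinates through new ones. The
series `P` and `P'` are tied by one identity, `G(z, τ + P') = Ḡ(χ, τ) + P(F(z, τ + P'), F̄(χ, τ),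
Ḡ(χ, τ))` (`IsTransform`). The maps that keep coordinates normal form a set with free parameters:
`F` is arbitrary with `F_z(0) ≠ 0`, and so is the real part `p(w)` of `G(0, w)`, with `p'(0) ≠ 0`;
the rest of `G` is forced (`exists_preservesNormal`). The normal form chooses equations that fix
these parameters one power `w^k` at a time.

Leading terms. In exponents of `z` and `τ`, an invariant pair `(α, μ)` is a corner of the support of
`P`. Modulo strictly higher exponents the identity becomes `r P' = (a z)^α (r τ)^μ P_{α,μ}(F̄(χ,
0))`, where `a = F_z(0)` and `r = G_w(0)` is real (`IsTransform.lead`). Hence corners and orders `n`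
are invariant, `F(z, 0)` can be chosen so that `P_{α,μ}` is a monomial, and `(a, r)` acts on the two
leading coefficients by explicit factors. Moduli satisfy a linear system in `log|a|`, `log|r|`,
singular exactly in Case A; the phase of `a` enters through `a^α ā^n` with `α ≠ n`, so for fixed `c`
only finitely many `ε` occur.

One step. Suppose `F = z + ∑ f_j z^j w^k` modulo `w^{k+1}` and `G(0, w) = w + g w^{k+1}` modulo
`w^{k+2}`. By `IsTransform.step`, the relevant coefficients change linearly. With `u` the leading
coefficient, that of `z^{α-1} χ^n τ^{μ+k}` changes by `u α f_0`. If `f_0 = 0`, then `g` is real and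
that of `z^α χ^b τ^{μ+k}`, for `b ≥ n`, changes by `u n conj(f_{b+1-n})`, plus `u (α f_1 + (μ - k -
1) g)` when `b = n`. All earlier conditions persist. So the pair with `α' > 1` determines `f_0`; the
terms `b > n` of the first pair determine `f_j`, `j ≥ 2`; and the term `b = n` gives `(α - n) Im
f_1` and `(α + n) Re f_1 + (μ - k - 1) g`. The imaginary part at the second pair gives `(α₁ + n₁) Re
f_1 + (μ₁ - k - 1) g`. The determinant of the last two expressions is, up to sign, `(k + 1) D_k`, so
`g` remains free exactly for `k ∈ K`.

Existence follows by composing these steps, which converge coefficientwise (`exists_limit`). For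
uniqueness, a map between two normal forms with the same `F_z(0)`, `G_w(0)` differs from another
such map by one tangent to the identity along the relevant directions. It satisfies `F̄(χ, 0)^n =
χ^n`, so `F(z, 0) = z`, and then the homogeneous equations remove one layer after another until only
the identity is left. -/

namespace FormalHypersurface
open MvPowerSeries

noncomputable section

/-! ### Supports of power series under algebra and substitution -/

section Support

variable {σ τ : Type*}

/-- All exponents of monomials of `f` satisfy `S`. -/
def Supp (S : (σ →₀ ℕ) → Prop) (f : MvPowerSeries σ ℂ) : Prop := ∀ d, coeff d f ≠ 0 → S d

variable {S T U : (σ →₀ ℕ) → Prop} {f g : MvPowerSeries σ ℂ}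

theorem Supp.mono (hf : Supp S f) (h : ∀ d, S d → T d) : Supp T f := fun d hd => h d (hf d hd)

theorem Supp.coeff_eq_zero (hf : Supp S f) {d : σ →₀ ℕ} (h : ¬ S d) : coeff d f = 0 := by
  by_contra h0
  exact h (hf d h0)

theorem Supp.and (hf : Supp S f) (hf' : Supp T f) : Supp (fun d => S d ∧ T d) f :=
  fun d hd => ⟨hf d hd, hf' d hd⟩

theorem Supp.zero : Supp S (0 : MvPowerSeries σ ℂ) := fun _ hd => absurd (map_zero _) hd

theorem Supp.add (hf : Supp S f) (hg : Supp S g) : Supp S (f + g) := by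
  intro d hd
  by_contra h
  exact hd (by rw [map_add, hf.coeff_eq_zero h, hg.coeff_eq_zero h, add_zero])

theorem Supp.neg (hf : Supp S f) : Supp S (-f) := by
  intro d hd
  exact hf d fun h => hd (by rw [map_neg, h, neg_zero])

theorem Supp.sub (hf : Supp S f) (hg : Supp S g) : Supp S (f - g) := by
  rw [sub_eq_add_neg]; exact hf.add hg.neg

theorem Supp.sum {ι : Type*} {s : Finset ι} {f : ι → MvPowerSeries σ ℂ}
    (h : ∀ i ∈ s, Supp S (f i)) : Supp S (∑ i ∈ s, f i) := by
  classical
  induction s using Finset.induction_on with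
  | empty => simpa using Supp.zero
  | insert i s hi ih =>
    rw [Finset.sum_insert hi]
    exact (h i (by simp)).add (ih fun j hj => h j (by simp [hj]))

theorem Supp.mul (hf : Supp S f) (hg : Supp T g) (h : ∀ d e, S d → T e → U (d + e)) :
    Supp U (f * g) := by
  classical
  intro d hd
  rw [coeff_mul] at hd
  obtain ⟨⟨a, b⟩, hab, hne⟩ := Finset.exists_ne_zero_of_sum_ne_zero hd
  rw [Finset.HasAntidiagonal.mem_antidiagonal] at hab
  subst hab
  exact h a b (hf a (left_ne_zero_of_mul hne)) (hg b (right_ne_zero_of_mul hne))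

theorem Supp.trivial : Supp (fun _ => True) f := fun _ _ => True.intro

theorem Supp.mul_left (hf : Supp S f) (h : ∀ d e, S d → S (d + e)) (g : MvPowerSeries σ ℂ) :
    Supp S (g * f) :=
  Supp.trivial.mul hf fun d e _ he => by rw [add_comm]; exact h e d he

theorem Supp.mul_right (hf : Supp S f) (h : ∀ d e, S d → S (d + e)) (g : MvPowerSeries σ ℂ) :
    Supp S (f * g) := by
  rw [mul_comm]; exact hf.mul_left h g

theorem Supp.C_mul (hf : Supp S f) (c : ℂ) : Supp S (C c * f) := by
  intro d hd
  rw [coeff_C_mul] at hd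
  exact hf d (right_ne_zero_of_mul hd)

theorem Supp.monomial {d : σ →₀ ℕ} (c : ℂ) (h : S d) : Supp S (monomial d c) := by
  classical
  intro e he
  rw [coeff_monomial] at he
  split_ifs at he with h1
  · rwa [h1]
  · exact absurd rfl he

theorem Supp.one (h : S 0) : Supp S (1 : MvPowerSeries σ ℂ) := by
  rw [← monomial_zero_one]; exact Supp.monomial _ h

theorem Supp.X {i : σ} (h : S (Finsupp.single i 1)) : Supp S (X i : MvPowerSeries σ ℂ) := by
  rw [X_def]; exact Supp.monomial _ h

theorem Supp.pow {S : (σ →₀ ℕ) → Prop} (hf : Supp S f) (T : ℕ → (σ →₀ ℕ) → Prop) (h0 : T 0 0)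
    (h : ∀ n d e, T n d → S e → T (n + 1) (d + e)) (n : ℕ) : Supp (T n) (f ^ n) := by
  induction n with
  | zero => rw [pow_zero]; exact Supp.one h0
  | succ n ih => rw [pow_succ]; exact ih.mul hf (h n)

/-- Each coefficient of a substitution is a finite sum over the monomials of `f`, so the images of
the single monomials decide the support. -/
theorem Supp.subst {a : σ → MvPowerSeries τ ℂ} (ha : HasSubst a) {T : (τ →₀ ℕ) → Prop}
    (h : ∀ d, coeff d f ≠ 0 → Supp T (d.prod fun s e => a s ^ e)) :
    Supp T (subst a f) := by
  intro e he
  by_contra hT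
  apply he
  rw [coeff_subst ha]
  apply finsum_eq_zero_of_forall_eq_zero
  intro d
  by_cases hd : coeff d f = 0
  · rw [hd, zero_smul]
  · rw [(h d hd).coeff_eq_zero hT, smul_zero]

theorem Supp.subst_sub {a b : σ → MvPowerSeries τ ℂ} (ha : HasSubst a) (hb : HasSubst b)
    {T : (τ →₀ ℕ) → Prop}
    (h : ∀ d, coeff d f ≠ 0 →
      Supp T ((d.prod fun s e => a s ^ e) - d.prod fun s e => b s ^ e)) :
    Supp T (MvPowerSeries.subst a f - MvPowerSeries.subst b f) := by
  intro e he
  by_contra hT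
  apply he
  rw [map_sub, coeff_subst ha, coeff_subst hb,
    ← finsum_sub_distrib (coeff_subst_finite ha f e) (coeff_subst_finite hb f e)]
  apply finsum_eq_zero_of_forall_eq_zero
  intro d
  by_cases hd : coeff d f = 0
  · rw [hd, zero_smul, zero_smul, sub_zero]
  · rw [← smul_sub, ← map_sub, (h d hd).coeff_eq_zero hT, smul_zero]

/-- By `hS` the series supported on `S` form an ideal. The factors are exchanged one at a time, and
`a i - b i` divides `a i ^ n i - b i ^ n i`. -/
theorem Supp.prod_sub {ι : Type*} {a b : ι → MvPowerSeries σ ℂ} (hS : ∀ d e, S d → S (d + e))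
    (h : ∀ i, Supp S (a i - b i)) (s : Finset ι) (n : ι → ℕ) :
    Supp S ((∏ i ∈ s, a i ^ n i) - ∏ i ∈ s, b i ^ n i) := by
  classical
  induction s using Finset.induction_on with
  | empty => simpa using Supp.zero
  | insert i s hi ih =>
    rw [Finset.prod_insert hi, Finset.prod_insert hi]
    have h1 : Supp S (a i ^ n i - b i ^ n i) := by
      obtain ⟨c, hc⟩ := sub_dvd_pow_sub_pow (a i) (b i) (n i)
      rw [hc]
      exact (h i).mul_right hS c
    have := (ih.mul_left hS (a i ^ n i)).add (h1.mul_right hS (∏ i ∈ s, b i ^ n i))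
    convert this using 1
    ring

/-- Substitution respects congruences modulo a monomial ideal; most arguments below drop terms in
this way. -/
theorem Supp.subst_sub_of_ideal {a b : σ → MvPowerSeries τ ℂ} (ha : HasSubst a) (hb : HasSubst b)
    {T : (τ →₀ ℕ) → Prop} (hT : ∀ d e, T d → T (d + e)) (h : ∀ i, Supp T (a i - b i))
    (f : MvPowerSeries σ ℂ) : Supp T (MvPowerSeries.subst a f - MvPowerSeries.subst b f) :=
  Supp.subst_sub ha hb fun d _ => Supp.prod_sub hT h d.support d

theorem eq_of_forall_supp (h : ∀ n : ℕ, Supp (fun d => n ≤ d.degree) (f - g)) : f = g := by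
  ext d
  rw [← sub_eq_zero, ← map_sub]
  exact (h (d.degree + 1)).coeff_eq_zero (by omega)

end Support

/-! ### Order of vanishing, limits and fixed points -/

section Order

variable {σ τ : Type*}

/-- All monomials of `f` have degree at least `N`. -/
abbrev Ord (N : ℕ) (f : MvPowerSeries σ ℂ) : Prop := Supp (fun d => N ≤ d.degree) f

theorem ord_upward (N : ℕ) (d e : σ →₀ ℕ) (h : N ≤ d.degree) : N ≤ (d + e).degree := by
  rw [map_add]; omega

theorem ord_one_iff {f : MvPowerSeries σ ℂ} : Ord 1 f ↔ constantCoeff f = 0 := by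
  constructor
  · intro h
    rw [← coeff_zero_eq_constantCoeff_apply]
    exact h.coeff_eq_zero (by simp)
  · intro h d hd
    by_contra h1
    have : d = 0 := by rw [← Finsupp.degree_eq_zero_iff]; omega
    exact hd (by rw [this, coeff_zero_eq_constantCoeff_apply, h])

theorem Ord.symm {N : ℕ} {f g : MvPowerSeries σ ℂ} (h : Ord N (f - g)) : Ord N (g - f) := by
  rw [← neg_sub]; exact h.neg

theorem Ord.trans {N : ℕ} {f g h : MvPowerSeries σ ℂ} (h1 : Ord N (f - g)) (h2 : Ord N (g - h)) :
    Ord N (f - h) := by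
  rw [← sub_add_sub_cancel f g h]; exact h1.add h2

/-- All components have vanishing constant term. -/
def Vanish {ι : Type*} (a : ι → MvPowerSeries τ ℂ) : Prop := ∀ i, constantCoeff (a i) = 0

theorem Vanish.hasSubst [Finite σ] {a : σ → MvPowerSeries τ ℂ} (h : Vanish a) : HasSubst a :=
  hasSubst_of_constantCoeff_zero h

theorem vanish_X : Vanish (X : σ → MvPowerSeries σ ℂ) := fun i => by simp

@[simp] theorem vanish₂ {a b : MvPowerSeries τ ℂ} :
    Vanish ![a, b] ↔ constantCoeff a = 0 ∧ constantCoeff b = 0 := by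
  simp [Vanish, Fin.forall_fin_succ]

@[simp] theorem vanish₃ {a b c : MvPowerSeries τ ℂ} :
    Vanish ![a, b, c] ↔ constantCoeff a = 0 ∧ constantCoeff b = 0 ∧ constantCoeff c = 0 := by
  simp [Vanish, Fin.forall_fin_succ]

@[simp] theorem vanish₄ {a b c d : MvPowerSeries τ ℂ} :
    Vanish ![a, b, c, d] ↔ constantCoeff a = 0 ∧ constantCoeff b = 0 ∧ constantCoeff c = 0 ∧
      constantCoeff d = 0 := by
  simp [Vanish, Fin.forall_fin_succ]

theorem constantCoeff_subst_vanish [Finite σ] {a : σ → MvPowerSeries τ ℂ} (ha : Vanish a)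
    (f : MvPowerSeries σ ℂ) : constantCoeff (subst a f) = constantCoeff f := by
  have h : f = C (constantCoeff f) + (f - C (constantCoeff f)) := by ring
  have h2 : constantCoeff (f - C (constantCoeff f)) = 0 := by simp
  conv_lhs => rw [h, subst_add ha.hasSubst, subst_C, map_add, constantCoeff_C,
    constantCoeff_subst_eq_zero ha.hasSubst ha h2, add_zero]

theorem ord_prod {ι : Type*} {a : ι → MvPowerSeries τ ℂ} (ha : Vanish a) (s : Finset ι)
    (n : ι → ℕ) : Ord (∑ i ∈ s, n i) (∏ i ∈ s, a i ^ n i) := by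
  classical
  induction s using Finset.induction_on with
  | empty => simpa using Supp.one (by simp)
  | insert i s hi ih =>
    rw [Finset.prod_insert hi, Finset.sum_insert hi]
    refine Supp.mul ((ord_one_iff.2 (ha i)).pow (fun n d => n ≤ d.degree) (by simp) ?_ (n i)) ih ?_
    · intro n d e h1 h2; rw [map_add]; omega
    · intro d e h1 h2; rw [map_add]; omega

/-- A difference of two monomials of degree `d` telescopes into terms with one factor `a i - b i` of
order `N` and `d - 1` factors of order one. The bound `N + d - 1` is written without subtraction,
and the first clause records that the difference is zero when `d = 0`. -/
theorem ord_prod_sub {ι : Type*} {a b : ι → MvPowerSeries τ ℂ} (ha : Vanish a) (hb : Vanish b)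
    {N : ℕ} (h : ∀ i, Ord N (a i - b i)) (s : Finset ι) (n : ι → ℕ) :
    Supp (fun e => 1 ≤ ∑ i ∈ s, n i ∧ N + ∑ i ∈ s, n i ≤ e.degree + 1)
      ((∏ i ∈ s, a i ^ n i) - ∏ i ∈ s, b i ^ n i) := by
  classical
  induction s using Finset.induction_on with
  | empty => simpa using Supp.zero
  | insert i s hi ih =>
    rw [Finset.prod_insert hi, Finset.prod_insert hi, Finset.sum_insert hi]
    have hp : ∀ (c : MvPowerSeries τ ℂ), constantCoeff c = 0 → ∀ n, Ord n (c ^ n) :=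
      fun c hc n => (ord_one_iff.2 hc).pow (fun n d => n ≤ d.degree) (by simp)
        (by intro n d e h1 h2; rw [map_add]; omega) n
    have h1 : Supp (fun e => 1 ≤ n i ∧ N + n i ≤ e.degree + 1) (a i ^ n i - b i ^ n i) := by
      rw [← (Commute.all (a i) (b i)).mul_geom_sum₂]
      refine Supp.mul (h i)
        (T := fun e => 1 ≤ n i ∧ n i ≤ e.degree + 1) (Supp.sum fun j hj => ?_) ?_
      · rw [Finset.mem_range] at hj
        refine Supp.mul (hp _ (ha i) j) (hp _ (hb i) _) ?_
        intro d e h1 h2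
        rw [map_add]; omega
      · intro d e h1 h2; rw [map_add]; omega
    have e : a i ^ n i * (∏ i ∈ s, a i ^ n i) - b i ^ n i * ∏ i ∈ s, b i ^ n i =
      a i ^ n i * ((∏ i ∈ s, a i ^ n i) - ∏ i ∈ s, b i ^ n i) +
        (a i ^ n i - b i ^ n i) * ∏ i ∈ s, b i ^ n i := by ring
    rw [e]
    refine Supp.add ((hp _ (ha i) _).mul ih ?_) (h1.mul (ord_prod hb s n) ?_)
    · intro d e h1 h2; rw [map_add]; omega
    · intro d e h1 h2; rw [map_add]; omega

theorem finsupp_prod_eq [Fintype σ] (a : σ → MvPowerSeries τ ℂ) (d : σ →₀ ℕ) :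
    (d.prod fun s e => a s ^ e) = ∏ i, a i ^ d i :=
  Finsupp.prod_fintype _ _ (by simp)

theorem degree_eq_sum' [Fintype σ] (d : σ →₀ ℕ) : d.degree = ∑ i, d i :=
  Finsupp.degree_eq_sum d

theorem Ord.subst [Fintype σ] {a : σ → MvPowerSeries τ ℂ} (ha : Vanish a) {N : ℕ}
    {f : MvPowerSeries σ ℂ} (hf : Ord N f) : Ord N (MvPowerSeries.subst a f) := by
  refine Supp.subst ha.hasSubst fun d hd => ?_
  rw [finsupp_prod_eq]
  refine (ord_prod ha _ _).mono fun e he => ?_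
  have := hf d hd
  simp only [degree_eq_sum' d] at this
  omega

/-- For `M = 2` the order improves by one, which makes nonlinear substitution a contraction. -/
theorem Ord.subst_sub [Fintype σ] {a b : σ → MvPowerSeries τ ℂ} (ha : Vanish a) (hb : Vanish b)
    {N M : ℕ} (h : ∀ i, Ord N (a i - b i)) {f : MvPowerSeries σ ℂ} (hf : Ord M f) :
    Ord (N + M - 1) (MvPowerSeries.subst a f - MvPowerSeries.subst b f) := by
  refine Supp.subst_sub ha.hasSubst hb.hasSubst fun d hd => ?_
  rw [finsupp_prod_eq, finsupp_prod_eq]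
  refine (ord_prod_sub ha hb h _ _).mono fun e he => ?_
  have := hf d hd
  simp only [degree_eq_sum' d] at this
  omega

theorem Ord.subst_congr [Fintype σ] {a b : σ → MvPowerSeries τ ℂ} (ha : Vanish a) (hb : Vanish b)
    {N : ℕ} (h : ∀ i, Ord N (a i - b i)) (f : MvPowerSeries σ ℂ) :
    Ord N (MvPowerSeries.subst a f - MvPowerSeries.subst b f) :=
  Supp.subst_sub_of_ideal ha.hasSubst hb.hasSubst (ord_upward N) h f

theorem coeff_single_eq_zero_of_ord_two {f : MvPowerSeries σ ℂ} (hf : Ord 2 f) (j : σ) :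
    coeff (Finsupp.single j 1) f = 0 := hf.coeff_eq_zero (by simp)

theorem ord_two_iff {f : MvPowerSeries σ ℂ} :
    Ord 2 f ↔ constantCoeff f = 0 ∧ ∀ i, coeff (Finsupp.single i 1) f = 0 := by
  constructor
  · intro h
    exact ⟨ord_one_iff.1 (h.mono fun d hd => by omega), coeff_single_eq_zero_of_ord_two h⟩
  · rintro ⟨h0, h1⟩ d hd
    have h2 := ord_one_iff.2 h0 d hd
    by_contra h3
    have hd1 : d.degree = 1 := by omega
    have hmem : d ∈ {d : σ →₀ ℕ | d.degree = 1} := hd1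
    rw [← Finsupp.range_single_one] at hmem
    obtain ⟨i, rfl⟩ := hmem
    exact hd (h1 i)

/-- Chain rule for the linear terms. -/
theorem coeff_single_subst [Fintype σ] {a : σ → MvPowerSeries τ ℂ} (ha : Vanish a)
    (f : MvPowerSeries σ ℂ) (j : τ) :
    coeff (Finsupp.single j 1) (subst a f) =
      ∑ i, coeff (Finsupp.single i 1) f * coeff (Finsupp.single j 1) (a i) := by
  classical
  set L : MvPowerSeries σ ℂ :=
    C (constantCoeff f) + ∑ i, C (coeff (Finsupp.single i 1) f) * X i with hL
  have h2 : Ord 2 (f - L) := by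
    rw [ord_two_iff]
    constructor
    · simp [hL]
    · intro i
      simp [hL, coeff_C, coeff_C_mul, coeff_index_single_X]
  have h3 := coeff_single_eq_zero_of_ord_two (h2.subst ha) j
  rw [subst_sub ha.hasSubst, map_sub, sub_eq_zero] at h3
  rw [h3, hL, subst_add ha.hasSubst, subst_C, map_add, coeff_C,
    if_neg (by simp), zero_add, ← coe_substAlgHom ha.hasSubst, map_sum, map_sum]
  refine Finset.sum_congr rfl fun i _ => ?_
  rw [map_mul, coe_substAlgHom ha.hasSubst, subst_C, subst_X ha.hasSubst, coeff_C_mul]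

theorem subst_subst {υ : Type*} [Finite σ] [Finite τ] {a : σ → MvPowerSeries τ ℂ}
    {b : τ → MvPowerSeries υ ℂ} (ha : Vanish a) (hb : Vanish b) (f : MvPowerSeries σ ℂ) :
    subst b (subst a f) = subst (fun i => subst b (a i)) f :=
  subst_comp_subst_apply ha.hasSubst hb.hasSubst f

/-- A coefficient of degree `d` no longer changes from stage `d + 1` on, and the limit collects
these stable values. -/
theorem exists_limit {κ : Type*} (t : ℕ → κ → MvPowerSeries σ ℂ)
    (h : ∀ n i, Ord n (t (n + 1) i - t n i)) :
    ∃ L : κ → MvPowerSeries σ ℂ, ∀ n i, Ord n (L i - t n i) := by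
  have h1 : ∀ n m i, Ord n (t (n + m) i - t n i) := by
    intro n m i
    induction m with
    | zero => simpa using Supp.zero
    | succ m ih =>
      exact Ord.trans ((h (n + m) i).mono fun d hd => by omega) ih
  let L : κ → MvPowerSeries σ ℂ := fun i d => coeff d (t (d.degree + 1) i)
  refine ⟨L, fun n i d hd => ?_⟩
  by_contra hn
  apply hd
  have hLc : coeff d (L i) = coeff d (t (d.degree + 1) i) := rfl
  rw [map_sub, hLc, sub_eq_zero]
  obtain ⟨m, hm⟩ : ∃ m, n = d.degree + 1 + m := ⟨n - (d.degree + 1), by omega⟩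
  rw [hm]
  have := (h1 (d.degree + 1) m i).coeff_eq_zero (d := d) (by omega)
  rw [map_sub, sub_eq_zero] at this
  exact this.symm

/-- Contraction principle for the adic topology: the iterates starting at `0` stabilise in each
degree, and `Φ` moves the limit by terms of arbitrarily high order. -/
theorem exists_fixed_point {κ : Type*} (Φ : (κ → MvPowerSeries σ ℂ) → κ → MvPowerSeries σ ℂ)
    (h0 : ∀ t, Vanish t → Vanish (Φ t))
    (h : ∀ N t t', Vanish t → Vanish t' → (∀ i, Ord N (t i - t' i)) →
      ∀ i, Ord (N + 1) (Φ t i - Φ t' i)) :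
    ∃ t, Vanish t ∧ Φ t = t := by
  set t : ℕ → κ → MvPowerSeries σ ℂ := fun n => Φ^[n] 0 with ht
  have hs : ∀ n, t (n + 1) = Φ (t n) := fun n => Function.iterate_succ_apply' Φ n 0
  have hv : ∀ n, Vanish (t n) := by
    intro n
    induction n with
    | zero => intro i; simp [ht]
    | succ n ih => rw [hs]; exact h0 _ ih
  have hd : ∀ n i, Ord n (t (n + 1) i - t n i) := by
    intro n
    induction n with
    | zero => intro i d _; exact Nat.zero_le _
    | succ n ih =>
      intro i
      rw [hs (n + 1), hs n]
      refine h n _ _ ?_ (hv n) ?_ i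
      · exact h0 _ (hv n)
      · rw [← hs n]; exact ih
  obtain ⟨L, hL⟩ := exists_limit t hd
  have hLv : Vanish L := by
    intro i
    have h1 := ord_one_iff.1 (hL 1 i)
    rw [map_sub, hv 1 i, sub_zero] at h1
    exact h1
  refine ⟨L, hLv, funext fun i => eq_of_forall_supp fun n => ?_⟩
  have h1 := h n _ _ hLv (hv n) (hL n) i
  rw [← hs n] at h1
  have h2 := (hL (n + 1) i).sub h1
  have h3 := (Ord.symm h2)
  refine (Supp.mono (f := Φ L i - L i) ?_ (fun d (hd : n + 1 ≤ d.degree) => by omega))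
  convert h2.neg using 1
  ring

end Order

end
end FormalHypersurface


namespace FormalHypersurface
open MvPowerSeries

noncomputable section

/-! ### Hadamard's lemma for formal power series -/

section Hadamard

variable {σ τ : Type*}

/-- In the universal case an extra variable `none` stands for the increment. The difference vanishes
when this variable does, hence is divisible by it; the general case follows by specialisation. -/
theorem exists_subst_sub_eq_mul [Fintype σ] [DecidableEq σ] {a b : σ → MvPowerSeries τ ℂ}
    (ha : Vanish a) (hb : Vanish b) (i : σ) (hab : ∀ j, j ≠ i → a j = b j)
    (f : MvPowerSeries σ ℂ) :
    ∃ u : MvPowerSeries τ ℂ, subst a f - subst b f = (a i - b i) * u ∧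
      constantCoeff u = coeff (Finsupp.single i 1) f := by
  set p : σ → MvPowerSeries (Option σ) ℂ :=
    fun j => X (some j) + if j = i then X none else 0 with hp
  set q : σ → MvPowerSeries (Option σ) ℂ := fun j => X (some j) with hq
  have hpv : Vanish p := by intro j; by_cases h : j = i <;> simp [hp, h]
  have hqv : Vanish q := by intro j; simp [hq]
  have hdvd : (X none : MvPowerSeries (Option σ) ℂ) ∣ subst p f - subst q f := by
    rw [X_dvd_iff]
    intro m hm
    have := Supp.subst_sub_of_ideal (T := fun d => 1 ≤ d none) hpv.hasSubst hqv.hasSubst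
      (by intro d e h; rw [Finsupp.add_apply]; omega)
      (by
        intro j
        by_cases h : j = i
        · simpa [hp, hq, h] using Supp.X (by simp)
        · simpa [hp, hq, h] using Supp.zero) f
    exact this.coeff_eq_zero (by simp [hm])
  obtain ⟨u, hu⟩ := hdvd
  set c : Option σ → MvPowerSeries τ ℂ := fun o => o.elim (a i - b i) b with hc
  have hcv : Vanish c := by
    intro o
    cases o with
    | none => simp [hc, ha i, hb i]
    | some j => simp [hc, hb j]
  refine ⟨subst c u, ?_, ?_⟩
  · have h1 := congrArg (subst c) hu
    rw [subst_sub hcv.hasSubst, subst_mul hcv.hasSubst, subst_subst hpv hcv, subst_subst hqv hcv,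
      subst_X hcv.hasSubst] at h1
    have hp' : (fun j => subst c (p j)) = a := by
      funext j
      by_cases h : j = i
      · simp only [hp, h, if_true]
        rw [subst_add hcv.hasSubst, subst_X hcv.hasSubst, subst_X hcv.hasSubst]
        simp [hc]
      · simp only [hp, h, if_false, add_zero]
        rw [subst_X hcv.hasSubst]
        simp [hc, hab j h]
    have hq' : (fun j => subst c (q j)) = b := by
      funext j
      simp only [hq]
      rw [subst_X hcv.hasSubst]
      simp [hc]
    rw [hp', hq'] at h1
    exact h1
  · rw [constantCoeff_subst_vanish hcv]
    have h1 := congrArg (coeff (Finsupp.single none 1)) hu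
    rw [map_sub, coeff_single_subst hpv, coeff_single_subst hqv, ← Finset.sum_sub_distrib] at h1
    have h2 : coeff (Finsupp.single none 1) (X none * u) = constantCoeff u := by
      have := coeff_add_monomial_mul (Finsupp.single (none : Option σ) 1) 0 u (1 : ℂ)
      rwa [add_zero, one_mul, coeff_zero_eq_constantCoeff_apply] at this
    rw [h2, Finset.sum_eq_single i] at h1
    · rw [← h1]
      simp [hp, hq, coeff_index_single_X]
    · intro j _ hj
      simp [hp, hq, hj]
    · simp

end Hadamard

/-! ### Formal inverse function theorem in two variables -/

section Inverse

theorem jac_comp {H T : Fin 2 → MvPowerSeries (Fin 2) ℂ} (hT : Vanish T) :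
    jac (comp H T) = jac H * jac T := by
  ext i j
  rw [Matrix.mul_apply]
  exact coeff_single_subst hT (H i) j

theorem vanish_comp {H T : Fin 2 → MvPowerSeries (Fin 2) ℂ} (hH : Vanish H) (hT : Vanish T) :
    Vanish (comp H T) := fun i => by
  rw [comp, constantCoeff_subst_vanish hT, hH i]

theorem comp_assoc {H T S : Fin 2 → MvPowerSeries (Fin 2) ℂ} (hT : Vanish T) (hS : Vanish S) :
    comp (comp H T) S = comp H (comp T S) :=
  funext fun i => subst_subst hT hS (H i)

theorem comp_X (H : Fin 2 → MvPowerSeries (Fin 2) ℂ) : comp H X = H :=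
  funext fun i => by rw [comp, subst_self]; rfl

theorem X_comp {H : Fin 2 → MvPowerSeries (Fin 2) ℂ} (hH : Vanish H) : comp X H = H :=
  funext fun i => subst_X hH.hasSubst i

theorem jac_X : jac X = 1 := by
  ext i j
  rw [jac, Matrix.of_apply, coeff_index_single_X, Matrix.one_apply]
  simp [eq_comm]

theorem IsFormalBihol.comp {H T : Fin 2 → MvPowerSeries (Fin 2) ℂ} (hH : IsFormalBihol H)
    (hT : IsFormalBihol T) : IsFormalBihol (comp H T) := by
  refine ⟨vanish_comp hH.1 hT.1, ?_⟩
  rw [jac_comp hT.1, Matrix.det_mul]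
  exact mul_ne_zero hH.2 hT.2

/-- With `A` the Jacobian matrix and `N = X - A⁻¹ H`, which has order two, the equation `H ∘ T = X`
is the fixed point equation `T = N(T) + A⁻¹ X`. -/
theorem exists_right_inverse {H : Fin 2 → MvPowerSeries (Fin 2) ℂ} (hH : IsFormalBihol H) :
    ∃ T, IsFormalBihol T ∧ comp H T = X := by
  set A := jac H with hA
  have hAu : IsUnit A.det := isUnit_iff_ne_zero.2 hH.2
  set N : Fin 2 → MvPowerSeries (Fin 2) ℂ := fun i => X i - ∑ j, C (A⁻¹ i j) * H j with hN
  have hlin : ∀ i l, ∑ j, A⁻¹ i j * coeff (Finsupp.single l 1) (H j) =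
      (1 : Matrix (Fin 2) (Fin 2) ℂ) i l := by
    intro i l
    rw [← Matrix.nonsing_inv_mul A hAu, Matrix.mul_apply]
    rfl
  have hN2 : ∀ i, Ord 2 (N i) := by
    intro i
    rw [ord_two_iff]
    constructor
    · simp [hN, hH.1]
    · intro l
      have := hlin i l
      simp only [hN, map_sub, map_sum, coeff_C_mul, coeff_index_single_X, this, Matrix.one_apply]
      simp [eq_comm]
  obtain ⟨T, hTv, hT⟩ := exists_fixed_point
    (fun (t : Fin 2 → MvPowerSeries (Fin 2) ℂ) i => subst t (N i) + ∑ j, C (A⁻¹ i j) * X j)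
    (by
      intro t ht i
      have h1 := ord_one_iff.1 ((hN2 i).mono fun d (hd : 2 ≤ d.degree) => (by omega : 1 ≤ d.degree))
      simp [constantCoeff_subst_vanish ht, h1])
    (by
      intro M t t' ht ht' h i
      rw [add_sub_add_right_eq_sub]
      exact (Ord.subst_sub ht ht' h (hN2 i)).mono fun d hd => by omega)
  have key : ∀ i, ∑ j, C (A⁻¹ i j) * (subst T (H j) - X j) = 0 := by
    intro i
    have h1 := congrFun hT i
    simp only [hN] at h1
    rw [subst_sub hTv.hasSubst, subst_X hTv.hasSubst, ← coe_substAlgHom hTv.hasSubst, map_sum] at h1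
    simp only [map_mul, coe_substAlgHom hTv.hasSubst, subst_C] at h1
    simp only [mul_sub, Finset.sum_sub_distrib]
    linear_combination -h1
  have hcomp : FormalHypersurface.comp H T = X := by
    funext l
    have h1 : ∑ i, C (A l i) * ∑ j, C (A⁻¹ i j) * (subst T (H j) - X j) =
        subst T (H l) - X l := by
      have : ∀ i, C (A l i) * ∑ j, C (A⁻¹ i j) * (subst T (H j) - X j) =
          ∑ j, C (A l i * A⁻¹ i j) * (subst T (H j) - X j) := by
        intro i
        rw [Finset.mul_sum]
        exact Finset.sum_congr rfl fun j _ => by rw [map_mul]; ring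
      simp only [this]
      rw [Finset.sum_comm]
      simp only [← Finset.sum_mul, ← map_sum, ← Matrix.mul_apply, Matrix.mul_nonsing_inv A hAu]
      simp [Matrix.one_apply]
    simp only [key, mul_zero, Finset.sum_const_zero] at h1
    exact (sub_eq_zero.1 h1.symm)
  refine ⟨T, ⟨hTv, ?_⟩, hcomp⟩
  intro h0
  have h1 := congrArg (fun M => (jac M).det) hcomp
  simp only [jac_comp hTv, Matrix.det_mul, h0, mul_zero, jac_X, Matrix.det_one] at h1
  exact zero_ne_one h1

/-- The right inverse has a right inverse itself, and associativity identifies the latter with `H`.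
-/
theorem exists_inverse {H : Fin 2 → MvPowerSeries (Fin 2) ℂ} (hH : IsFormalBihol H) :
    ∃ T, IsFormalBihol T ∧ comp H T = X ∧ comp T H = X := by
  obtain ⟨T, hT, h1⟩ := exists_right_inverse hH
  obtain ⟨S, hS, h2⟩ := exists_right_inverse hT
  refine ⟨T, hT, h1, ?_⟩
  have : S = H := by
    rw [← X_comp hS.1, ← h1, comp_assoc hT.1 hS.1, h2, comp_X]
  rw [← this, h2]

end Inverse

/-! ### Substitution into vectors and the implicit function theorem -/

section Implicit

theorem subst_zero_right {υ τ : Type*} [Finite τ] {b : τ → MvPowerSeries υ ℂ} (hb : Vanish b) :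
    subst b (0 : MvPowerSeries τ ℂ) = 0 := by
  rw [← coe_substAlgHom hb.hasSubst, map_zero]

theorem subst_vec₂ {υ τ : Type*} [Finite τ] {b : τ → MvPowerSeries υ ℂ} (hb : Vanish b)
    {p q : MvPowerSeries τ ℂ} (h : Vanish ![p, q]) (f : MvPowerSeries (Fin 2) ℂ) :
    subst b (subst ![p, q] f) = subst ![subst b p, subst b q] f := by
  rw [subst_subst h hb]
  congr 1
  funext i
  fin_cases i <;> rfl

theorem subst_vec₃ {υ τ : Type*} [Finite τ] {b : τ → MvPowerSeries υ ℂ} (hb : Vanish b)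
    {p q r : MvPowerSeries τ ℂ} (h : Vanish ![p, q, r]) (f : MvPowerSeries (Fin 3) ℂ) :
    subst b (subst ![p, q, r] f) = subst ![subst b p, subst b q, subst b r] f := by
  rw [subst_subst h hb]
  congr 1
  funext i
  fin_cases i <;> rfl

theorem subst_vec₄ {υ τ : Type*} [Finite τ] {b : τ → MvPowerSeries υ ℂ} (hb : Vanish b)
    {p q r s : MvPowerSeries τ ℂ} (h : Vanish ![p, q, r, s]) (f : MvPowerSeries (Fin 4) ℂ) :
    subst b (subst ![p, q, r, s] f) = subst ![subst b p, subst b q, subst b r, subst b s] f := by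
  rw [subst_subst h hb]
  congr 1
  funext i
  fin_cases i <;> rfl

theorem subst_X_vec₄ (f : MvPowerSeries (Fin 4) ℂ) :
    subst (![X 0, X 1, X 2, X 3] : Fin 4 → MvPowerSeries (Fin 4) ℂ) f = f := by
  have : (![X 0, X 1, X 2, X 3] : Fin 4 → MvPowerSeries (Fin 4) ℂ) = X := by
    funext i; fin_cases i <;> rfl
  rw [this, subst_self]; rfl

theorem subst_X_vec₃ (f : MvPowerSeries (Fin 3) ℂ) :
    subst (![X 0, X 1, X 2] : Fin 3 → MvPowerSeries (Fin 3) ℂ) f = f := by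
  have : (![X 0, X 1, X 2] : Fin 3 → MvPowerSeries (Fin 3) ℂ) = X := by
    funext i; fin_cases i <;> rfl
  rw [this, subst_self]; rfl

theorem subst_X_vec₂ (f : MvPowerSeries (Fin 2) ℂ) :
    subst (![X 0, X 1] : Fin 2 → MvPowerSeries (Fin 2) ℂ) f = f := by
  have : (![X 0, X 1] : Fin 2 → MvPowerSeries (Fin 2) ℂ) = X := by
    funext i; fin_cases i <;> rfl
  rw [this, subst_self]; rfl

/-- Formal implicit function theorem, solving for the last of four variables. -/
theorem exists_implicit {E : MvPowerSeries (Fin 4) ℂ} (h0 : constantCoeff E = 0)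
    (h3 : coeff (Finsupp.single 3 1) E ≠ 0) :
    ∃ (t : MvPowerSeries (Fin 3) ℂ) (A : MvPowerSeries (Fin 4) ℂ), constantCoeff t = 0 ∧
      constantCoeff A ≠ 0 ∧ E = A * (X 3 - subst ![X 0, X 1, X 2] t) ∧
      subst ![X 0, X 1, X 2, t] E = 0 := by
  set c := coeff (Finsupp.single 3 1) E with hc
  set M : MvPowerSeries (Fin 4) ℂ := X 3 - C c⁻¹ * E with hM
  have hM0 : constantCoeff M = 0 := by simp [hM, h0]
  have hM3 : coeff (Finsupp.single 3 1) M = 0 := by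
    simp [hM, coeff_C_mul, ← hc, h3]
  -- The solutions of `E(x, t) = 0` are the fixed points of `t ↦ M(x, t)`. Since `M` has no linear
  -- term in the last variable, its monomials containing that variable have degree at least two, and
  -- the map is a contraction.
  obtain ⟨t, htv, ht⟩ := exists_fixed_point
    (fun (t : Unit → MvPowerSeries (Fin 3) ℂ) _ => subst ![X 0, X 1, X 2, t ()] M)
    (by
      intro t ht i
      rw [constantCoeff_subst_vanish (by simp [ht ()]), hM0])
    (by
      intro N t t' ht ht' h i
      have hv : Vanish ![X 0, X 1, X 2, t ()] := by simp [ht ()]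
      have hv' : Vanish ![X 0, X 1, X 2, t' ()] := by simp [ht' ()]
      refine Supp.subst_sub hv.hasSubst hv'.hasSubst fun d hd => ?_
      rw [finsupp_prod_eq, finsupp_prod_eq]
      by_cases hd3 : d 3 = 0
      · simp only [Fin.prod_univ_four, hd3, pow_zero]
        simpa using Supp.zero
      · refine (ord_prod_sub hv hv' (N := N) ?_ _ _).mono fun e he => ?_
        · intro j
          fin_cases j
          · simpa using Supp.zero
          · simpa using Supp.zero
          · simpa using Supp.zero
          · simpa using h ()
        · have hne : d ≠ Finsupp.single 3 1 := by
            rintro rfl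
            exact hd hM3
          have h2 : 2 ≤ ∑ j, d j := by
            by_contra hlt
            apply hne
            rw [Fin.sum_univ_four] at hlt
            ext j
            fin_cases j <;> simp <;> omega
          omega)
  have hv : Vanish ![X 0, X 1, X 2, t ()] := by simp [htv ()]
  have hz : subst ![X 0, X 1, X 2, t ()] E = 0 := by
    have h1 := congrFun ht ()
    simp only [hM] at h1
    rw [subst_sub hv.hasSubst, subst_X hv.hasSubst, subst_mul hv.hasSubst, subst_C] at h1
    have h2 : C c⁻¹ * subst ![X 0, X 1, X 2, t ()] E = 0 := by
      simp only [Matrix.cons_val] at h1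
      linear_combination -h1
    have h3' : (C c⁻¹ : MvPowerSeries (Fin 3) ℂ) ≠ 0 := by
      rw [Ne, map_eq_zero_iff _ C_injective]
      exact inv_ne_zero h3
    exact (mul_eq_zero.1 h2).resolve_left h3'
  have hi : Vanish (![X 0, X 1, X 2] : Fin 3 → MvPowerSeries (Fin 4) ℂ) := by simp
  have hvb : Vanish ![X 0, X 1, X 2, subst (![X 0, X 1, X 2] : Fin 3 → MvPowerSeries (Fin 4) ℂ)
      (t ())] := by
    simp [constantCoeff_subst_vanish hi, htv ()]
  -- Hadamard's lemma in the last variable turns the vanishing of `E` on the graph of `t` into the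
  -- factorisation.
  obtain ⟨u, hu, hu0⟩ := exists_subst_sub_eq_mul vanish_X hvb 3
    (by intro j hj; fin_cases j <;> first | rfl | exact absurd rfl hj) E
  have hsub : subst ![X 0, X 1, X 2, subst (![X 0, X 1, X 2] : Fin 3 → MvPowerSeries (Fin 4) ℂ)
      (t ())] E = 0 := by
    have h1 := congrArg (subst (![X 0, X 1, X 2] : Fin 3 → MvPowerSeries (Fin 4) ℂ)) hz
    rw [subst_vec₄ hi hv, subst_X hi.hasSubst, subst_X hi.hasSubst, subst_X hi.hasSubst,
      ← coe_substAlgHom hi.hasSubst, map_zero, coe_substAlgHom] at h1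
    exact h1
  refine ⟨t (), u, htv (), by rw [hu0]; exact h3, ?_, hz⟩
  rw [hsub, subst_self, sub_zero] at hu
  rw [mul_comm]
  exact hu

end Implicit

end
end FormalHypersurface


namespace FormalHypersurface
open MvPowerSeries

noncomputable section

/-! ### Conjugation of coefficients -/

section Conj

variable {k m : ℕ}

@[simp] theorem coeff_conj (d : Fin k →₀ ℕ) (f : MvPowerSeries (Fin k) ℂ) :
    coeff d (conj f) = starRingEnd ℂ (coeff d f) := coeff_map _ _ _

@[simp] theorem constantCoeff_conj (f : MvPowerSeries (Fin k) ℂ) :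
    constantCoeff (conj f) = starRingEnd ℂ (constantCoeff f) := constantCoeff_map _ _

@[simp] theorem conj_conj (f : MvPowerSeries (Fin k) ℂ) : conj (conj f) = f := by
  ext d; simp

theorem conj_add (f g : MvPowerSeries (Fin k) ℂ) : conj (f + g) = conj f + conj g := map_add _ _ _
theorem conj_sub (f g : MvPowerSeries (Fin k) ℂ) : conj (f - g) = conj f - conj g := map_sub _ _ _
theorem conj_mul (f g : MvPowerSeries (Fin k) ℂ) : conj (f * g) = conj f * conj g := map_mul _ _ _
@[simp] theorem conj_C (c : ℂ) : conj (C c : MvPowerSeries (Fin k) ℂ) = C (starRingEnd ℂ c) :=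
  map_C _ _
@[simp] theorem conj_X (i : Fin k) : conj (X i) = X i := map_X _ _

theorem conj_subst {a : Fin k → MvPowerSeries (Fin m) ℂ} (ha : Vanish a)
    (f : MvPowerSeries (Fin k) ℂ) : conj (subst a f) = subst (fun i => conj (a i)) (conj f) :=
  map_subst ha.hasSubst f

theorem conj_subst₂ {p q : MvPowerSeries (Fin m) ℂ} (h : Vanish ![p, q])
    (f : MvPowerSeries (Fin 2) ℂ) :
    conj (subst ![p, q] f) = subst ![conj p, conj q] (conj f) := by
  rw [conj_subst h]
  congr 1
  funext i
  fin_cases i <;> rfl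

theorem conj_subst₃ {p q r : MvPowerSeries (Fin m) ℂ} (h : Vanish ![p, q, r])
    (f : MvPowerSeries (Fin 3) ℂ) :
    conj (subst ![p, q, r] f) = subst ![conj p, conj q, conj r] (conj f) := by
  rw [conj_subst h]
  congr 1
  funext i
  fin_cases i <;> rfl

theorem conj_subst₄ {p q r s : MvPowerSeries (Fin m) ℂ} (h : Vanish ![p, q, r, s])
    (f : MvPowerSeries (Fin 4) ℂ) :
    conj (subst ![p, q, r, s] f) = subst ![conj p, conj q, conj r, conj s] (conj f) := by
  rw [conj_subst h]
  congr 1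
  funext i
  fin_cases i <;> rfl

theorem Supp.conj {S : (Fin k →₀ ℕ) → Prop} {f : MvPowerSeries (Fin k) ℂ} (hf : Supp S f) :
    Supp S (conj f) := by
  intro d hd
  refine hf d fun h => hd ?_
  rw [coeff_conj, h, map_zero]

end Conj

/-! ### Exponents and permutations of variables -/

section Mon

theorem mon_apply {k : ℕ} (e : Fin k → ℕ) (i : Fin k) : mon e i = e i := rfl

theorem eq_mon₂ (d : Fin 2 →₀ ℕ) : d = mon ![d 0, d 1] := by
  ext i; fin_cases i <;> rfl

theorem eq_mon₃ (d : Fin 3 →₀ ℕ) : d = mon ![d 0, d 1, d 2] := by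
  ext i; fin_cases i <;> rfl

theorem eq_mon₄ (d : Fin 4 →₀ ℕ) : d = mon ![d 0, d 1, d 2, d 3] := by
  ext i; fin_cases i <;> rfl

theorem single_eq_mon₂_zero : (Finsupp.single 0 1 : Fin 2 →₀ ℕ) = mon ![1, 0] := by
  ext i; fin_cases i <;> simp [mon_apply]

theorem single_eq_mon₂_one : (Finsupp.single 1 1 : Fin 2 →₀ ℕ) = mon ![0, 1] := by
  ext i; fin_cases i <;> simp [mon_apply]

theorem coeff_subst_perm {k : ℕ} (e : Equiv.Perm (Fin k)) (f : MvPowerSeries (Fin k) ℂ)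
    (d : Fin k →₀ ℕ) :
    coeff d (subst (fun i => (X (e i) : MvPowerSeries (Fin k) ℂ)) f) =
      coeff (d.embDomain e.symm.toEmbedding) f := by
  have h := coeff_embDomain_rename (R := ℂ) e.toEmbedding f (d.embDomain e.symm.toEmbedding)
  rw [rename_eq_subst] at h
  rw [← h]
  have h2 : (d.embDomain e.symm.toEmbedding).embDomain e.toEmbedding = d := by
    ext i
    have h1 : i = e.toEmbedding (e.symm.toEmbedding i) := by simp
    conv_lhs => rw [h1, Finsupp.embDomain_apply_self, Finsupp.embDomain_apply_self]
  rw [h2]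
  rfl

theorem coeff_subst_swap₃ (f : MvPowerSeries (Fin 3) ℂ) (a b m : ℕ) :
    coeff (mon ![a, b, m]) (subst (![X 1, X 0, X 2] : Fin 3 → MvPowerSeries (Fin 3) ℂ) f) =
      coeff (mon ![b, a, m]) f := by
  have h := coeff_subst_perm (Equiv.swap (0 : Fin 3) 1) f (mon ![a, b, m])
  have h1 : (fun i => (X (Equiv.swap (0 : Fin 3) 1 i) : MvPowerSeries (Fin 3) ℂ)) =
      ![X 1, X 0, X 2] := by
    funext i; fin_cases i <;> rfl
  rw [h1] at h
  rw [h]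
  have hd : (mon ![a, b, m]).embDomain (Equiv.swap (0 : Fin 3) 1).symm.toEmbedding =
      mon ![b, a, m] := by
    ext i
    have h2 : i = (Equiv.swap (0 : Fin 3) 1).symm.toEmbedding (Equiv.swap (0 : Fin 3) 1 i) := by
      simp
    conv_lhs => rw [h2, Finsupp.embDomain_apply_self]
    fin_cases i <;> rfl
  rw [hd]

theorem coeff_subst_swap₄ (f : MvPowerSeries (Fin 4) ℂ) (a b c d : ℕ) :
    coeff (mon ![a, b, c, d])
      (subst (![X 2, X 3, X 0, X 1] : Fin 4 → MvPowerSeries (Fin 4) ℂ) f) =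
      coeff (mon ![c, d, a, b]) f := by
  set e : Equiv.Perm (Fin 4) := Equiv.swap 0 2 * Equiv.swap 1 3 with he
  have h := coeff_subst_perm e f (mon ![a, b, c, d])
  have h1 : (fun i => (X (e i) : MvPowerSeries (Fin 4) ℂ)) = ![X 2, X 3, X 0, X 1] := by
    funext i; fin_cases i <;> rfl
  rw [h1] at h
  rw [h]
  have hd : (mon ![a, b, c, d]).embDomain e.symm.toEmbedding = mon ![c, d, a, b] := by
    ext i
    have h2 : i = e.symm.toEmbedding (e i) := by simp
    conv_lhs => rw [h2, Finsupp.embDomain_apply_self]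
    fin_cases i <;> rfl
  rw [hd]

end Mon

/-! ### Evaluation of defining series at formal points -/

section Evaluation

variable {m : ℕ} {x₀ x₁ x₂ x₃ : MvPowerSeries (Fin m) ℂ}

theorem vanish_left (hx : Vanish ![x₀, x₁, x₂, x₃]) : Vanish ![x₀, x₁] := by
  simp only [vanish₂, vanish₄] at *; tauto

theorem vanish_right (hx : Vanish ![x₀, x₁, x₂, x₃]) : Vanish ![x₂, x₃] := by
  simp only [vanish₂, vanish₄] at *; tauto

/-- The point with coordinates `T(x₀, x₁)`, `T̄(x₂, x₃)`. -/
def push (T : Fin 2 → MvPowerSeries (Fin 2) ℂ) (x₀ x₁ x₂ x₃ : MvPowerSeries (Fin m) ℂ) :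
    Fin 4 → MvPowerSeries (Fin m) ℂ :=
  ![subst ![x₀, x₁] (T 0), subst ![x₀, x₁] (T 1), subst ![x₂, x₃] (conj (T 0)),
    subst ![x₂, x₃] (conj (T 1))]

theorem vanish_push {T : Fin 2 → MvPowerSeries (Fin 2) ℂ} (hT : Vanish T)
    (hx : Vanish ![x₀, x₁, x₂, x₃]) : Vanish (push T x₀ x₁ x₂ x₃) := by
  have h1 := vanish_left hx
  have h2 := vanish_right hx
  simp [push, constantCoeff_subst_vanish h1, constantCoeff_subst_vanish h2, hT 0, hT 1]

theorem eval_pullback (ρ : MvPowerSeries (Fin 4) ℂ) {H : Fin 2 → MvPowerSeries (Fin 2) ℂ}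
    (hH : Vanish H) (hx : Vanish ![x₀, x₁, x₂, x₃]) :
    subst ![x₀, x₁, x₂, x₃] (pullback ρ H) = subst (push H x₀ x₁ x₂ x₃) ρ := by
  have hb : Vanish (![X 0, X 1, X 2, X 3] : Fin 4 → MvPowerSeries (Fin 4) ℂ) := by simp
  have h1 := vanish_left hb
  have h2 := vanish_right hb
  have h3 : pullback ρ H = subst (push H (X 0) (X 1) (X 2) (X 3)) ρ := rfl
  rw [h3, push, subst_vec₄ hx (vanish_push hH hb), subst_vec₂ hx h1, subst_vec₂ hx h1,
    subst_vec₂ hx h2, subst_vec₂ hx h2]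
  simp only [subst_X hx.hasSubst]
  rfl

theorem push_comp {H T : Fin 2 → MvPowerSeries (Fin 2) ℂ} (hT : Vanish T)
    (hx : Vanish ![x₀, x₁, x₂, x₃]) :
    push (comp H T) x₀ x₁ x₂ x₃ = push H (push T x₀ x₁ x₂ x₃ 0) (push T x₀ x₁ x₂ x₃ 1)
      (push T x₀ x₁ x₂ x₃ 2) (push T x₀ x₁ x₂ x₃ 3) := by
  have h1 := vanish_left hx
  have h2 := vanish_right hx
  have hc : Vanish (fun i => conj (T i)) := fun i => by simp [hT i]
  have e1 : ∀ i, subst ![x₀, x₁] (comp H T i) =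
      subst ![subst ![x₀, x₁] (T 0), subst ![x₀, x₁] (T 1)] (H i) := by
    intro i
    rw [comp, subst_subst hT h1]
    congr 1
    funext j
    fin_cases j <;> rfl
  have e2 : ∀ i, subst ![x₂, x₃] (conj (comp H T i)) =
      subst ![subst ![x₂, x₃] (conj (T 0)), subst ![x₂, x₃] (conj (T 1))] (conj (H i)) := by
    intro i
    rw [comp, conj_subst hT, subst_subst hc h2]
    congr 1
    funext j
    fin_cases j <;> rfl
  simp only [push, e1, e2]
  rfl

theorem eta₄ {α : Type*} (v : Fin 4 → α) : ![v 0, v 1, v 2, v 3] = v := by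
  funext i; fin_cases i <;> rfl

/-- A change of coordinates acts on formal points by `(T, T̄)`. Together with `eval_eq_zero_iff`
this transports equations of the hypersurface between coordinate systems without expanding `ρ`. -/
theorem eval_pullback_comp (ρ : MvPowerSeries (Fin 4) ℂ)
    {H T : Fin 2 → MvPowerSeries (Fin 2) ℂ} (hH : Vanish H) (hT : Vanish T)
    (hx : Vanish ![x₀, x₁, x₂, x₃]) :
    subst ![x₀, x₁, x₂, x₃] (pullback ρ (comp H T)) =
      subst (push T x₀ x₁ x₂ x₃) (pullback ρ H) := by
  have h := vanish_push hT hx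
  rw [← eta₄ (push T x₀ x₁ x₂ x₃)] at h
  rw [eval_pullback ρ (vanish_comp hH hT) hx, push_comp hT hx, ← eval_pullback ρ hH h, eta₄]

theorem vanish_mid (hx : Vanish ![x₀, x₁, x₂, x₃]) :
    Vanish ![x₀, x₂, C (1 / 2) * (x₁ + x₃)] := by
  simp only [vanish₃, vanish₄] at *; simp [hx]

theorem vanish_tail (hx : Vanish ![x₀, x₁, x₂, x₃]) : Vanish ![x₀, x₂, x₃] := by
  simp only [vanish₃, vanish₄] at *; simp [hx]

theorem eval_realDefining (φ : MvPowerSeries (Fin 3) ℂ) (hx : Vanish ![x₀, x₁, x₂, x₃]) :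
    subst ![x₀, x₁, x₂, x₃] (realDefining φ) =
      C (1 / (2 * Complex.I)) * (x₁ - x₃) - subst ![x₀, x₂, C (1 / 2) * (x₁ + x₃)] φ := by
  have hb : Vanish (![X 0, X 1, X 2, X 3] : Fin 4 → MvPowerSeries (Fin 4) ℂ) := by simp
  rw [realDefining, subst_sub hx.hasSubst, subst_mul hx.hasSubst, subst_sub hx.hasSubst, subst_C,
    subst_vec₃ hx (vanish_mid hb), subst_mul hx.hasSubst, subst_add hx.hasSubst, subst_C]
  simp only [subst_X hx.hasSubst]
  rfl

theorem eval_complexDefining (Q : MvPowerSeries (Fin 3) ℂ) (hx : Vanish ![x₀, x₁, x₂, x₃]) :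
    subst ![x₀, x₁, x₂, x₃] (complexDefining Q) = x₁ - subst ![x₀, x₂, x₃] Q := by
  have hb : Vanish (![X 0, X 1, X 2, X 3] : Fin 4 → MvPowerSeries (Fin 4) ℂ) := by simp
  rw [complexDefining, subst_sub hx.hasSubst, subst_vec₃ hx (vanish_tail hb)]
  simp only [subst_X hx.hasSubst]
  rfl

end Evaluation

/-! ### Real and complex equations of a hypersurface -/

section Equations

variable {ρ : MvPowerSeries (Fin 4) ℂ} {H : Fin 2 → MvPowerSeries (Fin 2) ℂ}
  {φ Q : MvPowerSeries (Fin 3) ℂ}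

theorem constantCoeff_pullback (hρ : IsFormalHypersurface ρ) (hH : Vanish H) :
    constantCoeff (pullback ρ H) = 0 := by
  have hb : Vanish (![X 0, X 1, X 2, X 3] : Fin 4 → MvPowerSeries (Fin 4) ℂ) := by simp
  have h3 : pullback ρ H = subst (push H (X 0) (X 1) (X 2) (X 3)) ρ := rfl
  rw [h3, constantCoeff_subst_vanish (vanish_push hH hb), hρ.zero]

/-- The holomorphic and antiholomorphic halves of `dρ` are multiplied by the Jacobian matrix of `H`
and by its conjugate, both invertible. -/
theorem exists_linear_pullback (hρ : IsFormalHypersurface ρ) (hH : IsFormalBihol H) :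
    ∃ j, coeff (Finsupp.single j 1) (pullback ρ H) ≠ 0 := by
  by_contra! hc
  have hb : Vanish (![X 0, X 1, X 2, X 3] : Fin 4 → MvPowerSeries (Fin 4) ℂ) := by simp
  have h1 := vanish_left hb
  have h2 := vanish_right hb
  have h3 : pullback ρ H = subst (push H (X 0) (X 1) (X 2) (X 3)) ρ := rfl
  have hcj : ∀ j, ∑ i, coeff (Finsupp.single i 1) ρ *
      coeff (Finsupp.single j 1) (push H (X 0 : MvPowerSeries (Fin 4) ℂ) (X 1) (X 2) (X 3) i) = 0 :=
    fun j => by rw [← coeff_single_subst (vanish_push hH.1 hb), ← h3, hc j]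
  have hA : Matrix.vecMul ![coeff (Finsupp.single 0 1) ρ, coeff (Finsupp.single 1 1) ρ] (jac H)
      = 0 := by
    funext j
    have a0 := hcj 0
    have a1 := hcj 1
    simp [Fin.sum_univ_four, push, coeff_single_subst h1, coeff_single_subst h2,
      coeff_index_single_X] at a0 a1
    fin_cases j
    · simpa [Matrix.vecMul, dotProduct, jac] using a0
    · simpa [Matrix.vecMul, dotProduct, jac] using a1
  have hB : Matrix.vecMul ![coeff (Finsupp.single 2 1) ρ, coeff (Finsupp.single 3 1) ρ]
      ((jac H).map (starRingEnd ℂ)) = 0 := by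
    funext j
    have a0 := hcj 2
    have a1 := hcj 3
    simp [Fin.sum_univ_four, push, coeff_single_subst h1, coeff_single_subst h2,
      coeff_index_single_X] at a0 a1
    fin_cases j
    · simpa [Matrix.vecMul, dotProduct, jac] using a0
    · simpa [Matrix.vecMul, dotProduct, jac] using a1
  have hA' := Matrix.eq_zero_of_vecMul_eq_zero hH.2 hA
  have hdet : ((jac H).map (starRingEnd ℂ)).det ≠ 0 := by
    have := RingHom.map_det (starRingEnd ℂ) (jac H)
    rw [RingHom.mapMatrix_apply] at this
    rw [← this]
    simpa using hH.2
  have hB' := Matrix.eq_zero_of_vecMul_eq_zero hdet hB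
  obtain ⟨i, hi⟩ := hρ.nondeg
  apply hi
  fin_cases i
  · simpa using congrFun hA' 0
  · simpa using congrFun hA' 1
  · simpa using congrFun hB' 0
  · simpa using congrFun hB' 1

/-- Otherwise the product would have order two, although the pullback has a nonzero linear term. -/
theorem constantCoeff_factor_ne_zero (hρ : IsFormalHypersurface ρ) (hH : IsFormalBihol H)
    {a B : MvPowerSeries (Fin 4) ℂ} (h : pullback ρ H = a * B) (hB : constantCoeff B = 0) :
    constantCoeff a ≠ 0 := by
  intro ha
  obtain ⟨j, hj⟩ := exists_linear_pullback hρ hH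
  apply hj
  rw [h]
  refine coeff_single_eq_zero_of_ord_two ?_ j
  refine (ord_one_iff.2 ha).mul (ord_one_iff.2 hB) ?_
  intro d e h1 h2
  rw [map_add]; omega

/-- The factor `a` is a unit, so every defining series vanishes at the same formal points. Real and
complex equations are compared only through these points. -/
theorem eval_eq_zero_iff {m : ℕ} (hρ : IsFormalHypersurface ρ) (hH : IsFormalBihol H)
    {a B : MvPowerSeries (Fin 4) ℂ} (h : pullback ρ H = a * B) (hB : constantCoeff B = 0)
    {x : Fin 4 → MvPowerSeries (Fin m) ℂ} (hx : Vanish x) :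
    subst x (pullback ρ H) = 0 ↔ subst x B = 0 := by
  have ha := constantCoeff_factor_ne_zero hρ hH h hB
  rw [h, subst_mul hx.hasSubst]
  have h1 : subst x a ≠ 0 := by
    intro h0
    apply ha
    rw [← constantCoeff_subst_vanish hx, h0, map_zero]
  simp [h1]

theorem IsRealEquation.coeff_eq_zero (h : IsRealEquation ρ H φ) {d : Fin 3 →₀ ℕ}
    (hd : d 0 = 0 ∨ d 1 = 0) : coeff d φ = 0 := by
  rw [eq_mon₃ d]
  rcases hd with hd | hd <;> rw [hd]
  · exact h.normal_right _ _
  · exact h.normal_left _ _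

theorem IsRealEquation.supp (h : IsRealEquation ρ H φ) : Supp (fun d => 1 ≤ d 0 ∧ 1 ≤ d 1) φ := by
  intro d hd
  by_contra hc
  exact hd (h.coeff_eq_zero (by omega))

theorem IsRealEquation.ord_two (h : IsRealEquation ρ H φ) : Ord 2 φ := by
  refine h.supp.mono fun d hd => ?_
  rw [degree_eq_sum', Fin.sum_univ_three]
  omega

theorem IsRealEquation.constantCoeff_eq_zero (h : IsRealEquation ρ H φ) : constantCoeff φ = 0 :=
  (ord_two_iff.1 h.ord_two).1

theorem constantCoeff_realDefining (h : constantCoeff φ = 0) :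
    constantCoeff (realDefining φ) = 0 := by
  have hb : Vanish (![X 0, X 1, X 2, X 3] : Fin 4 → MvPowerSeries (Fin 4) ℂ) := by simp
  rw [realDefining, map_sub, constantCoeff_subst_vanish (vanish_mid hb), h]
  simp

theorem constantCoeff_complexDefining (h : constantCoeff Q = 0) :
    constantCoeff (complexDefining Q) = 0 := by
  have hb : Vanish (![X 0, X 1, X 2, X 3] : Fin 4 → MvPowerSeries (Fin 4) ℂ) := by simp
  rw [complexDefining, map_sub, constantCoeff_subst_vanish (vanish_tail hb), h]
  simp

theorem IsRealEquation.eval_eq_zero_iff {m : ℕ} {x₀ x₁ x₂ x₃ : MvPowerSeries (Fin m) ℂ}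
    (hρ : IsFormalHypersurface ρ) (h : IsRealEquation ρ H φ) (hx : Vanish ![x₀, x₁, x₂, x₃]) :
    subst ![x₀, x₁, x₂, x₃] (pullback ρ H) = 0 ↔
      C (1 / (2 * Complex.I)) * (x₁ - x₃) = subst ![x₀, x₂, C (1 / 2) * (x₁ + x₃)] φ := by
  obtain ⟨a, ha⟩ := h.eqn
  rw [FormalHypersurface.eval_eq_zero_iff hρ h.bihol ha
    (constantCoeff_realDefining h.constantCoeff_eq_zero) hx, eval_realDefining φ hx, sub_eq_zero]

theorem IsComplexEquation.eval_eq_zero_iff {m : ℕ} {x₀ x₁ x₂ x₃ : MvPowerSeries (Fin m) ℂ}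
    (hρ : IsFormalHypersurface ρ) (hH : IsFormalBihol H) (h : IsComplexEquation ρ H Q)
    (hx : Vanish ![x₀, x₁, x₂, x₃]) :
    subst ![x₀, x₁, x₂, x₃] (pullback ρ H) = 0 ↔ x₁ = subst ![x₀, x₂, x₃] Q := by
  obtain ⟨h0, a, ha⟩ := h
  rw [FormalHypersurface.eval_eq_zero_iff hρ hH ha
    (constantCoeff_complexDefining h0) hx, eval_complexDefining Q hx, sub_eq_zero]

theorem exists_complexEquation (hρ : IsFormalHypersurface ρ) (hH : Vanish H)
    (h1 : coeff (Finsupp.single 1 1) (pullback ρ H) ≠ 0) : ∃ Q, IsComplexEquation ρ H Q := by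
  -- The permutation `hp` moves `w` to the last place, where the implicit function theorem solves;
  -- `hq` undoes it.
  have hp : Vanish (![X 0, X 3, X 1, X 2] : Fin 4 → MvPowerSeries (Fin 4) ℂ) := by simp
  have hq : Vanish (![X 0, X 2, X 3, X 1] : Fin 4 → MvPowerSeries (Fin 4) ℂ) := by simp
  have hi : Vanish (![X 0, X 1, X 2] : Fin 3 → MvPowerSeries (Fin 4) ℂ) := by simp
  obtain ⟨t, A, ht, -, hE, -⟩ := exists_implicit
    (E := subst ![X 0, X 3, X 1, X 2] (pullback ρ H))
    (by rw [constantCoeff_subst_vanish hp, constantCoeff_pullback hρ hH])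
    (by
      rw [coeff_single_subst hp, Fin.sum_univ_four]
      simpa [coeff_index_single_X] using h1)
  refine ⟨t, ht, subst ![X 0, X 2, X 3, X 1] A, ?_⟩
  have h2 := congrArg (subst (![X 0, X 2, X 3, X 1] : Fin 4 → MvPowerSeries (Fin 4) ℂ)) hE
  rw [subst_vec₄ hq hp, subst_mul hq.hasSubst, subst_sub hq.hasSubst, subst_vec₃ hq hi] at h2
  simp only [subst_X hq.hasSubst, Matrix.cons_val, subst_X_vec₄] at h2
  exact h2

/-- Coefficients `w` and `τ` of the pullback in normal coordinates. -/
theorem IsRealEquation.coeff_single_pullback (h : IsRealEquation ρ H φ)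
    (hρ : IsFormalHypersurface ρ) :
    ∃ c : ℂ, c ≠ 0 ∧ coeff (Finsupp.single 0 1) (pullback ρ H) = 0 ∧
      coeff (Finsupp.single 1 1) (pullback ρ H) = c ∧
      coeff (Finsupp.single 2 1) (pullback ρ H) = 0 ∧
      coeff (Finsupp.single 3 1) (pullback ρ H) = -c := by
  obtain ⟨a, ha⟩ := h.eqn
  have hr := constantCoeff_realDefining h.constantCoeff_eq_zero
  have ha0 := constantCoeff_factor_ne_zero hρ h.bihol ha hr
  have hb : Vanish (![X 0, X 1, X 2, X 3] : Fin 4 → MvPowerSeries (Fin 4) ℂ) := by simp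
  have h2 := h.ord_two.subst (vanish_mid hb)
  have h3 : ∀ j, coeff (Finsupp.single j 1) (pullback ρ H) =
      constantCoeff a * coeff (Finsupp.single j 1) (realDefining φ) := by
    intro j
    rw [← sub_eq_zero, ← coeff_C_mul, ← map_sub]
    refine coeff_single_eq_zero_of_ord_two ?_ j
    rw [ha, ← sub_mul]
    refine (ord_one_iff.2 (by simp)).mul (ord_one_iff.2 hr) ?_
    intro d e h1 h2
    rw [map_add]; omega
  refine ⟨constantCoeff a * (1 / (2 * Complex.I)), by simp [ha0], ?_, ?_, ?_, ?_⟩ <;>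
  · rw [h3, realDefining, map_sub, coeff_single_eq_zero_of_ord_two h2, coeff_C_mul]
    simp [coeff_index_single_X]

theorem IsRealEquation.exists_complex (h : IsRealEquation ρ H φ) (hρ : IsFormalHypersurface ρ) :
    ∃ Q, IsComplexEquation ρ H Q := by
  obtain ⟨c, hc, -, h1, -⟩ := h.coeff_single_pullback hρ
  exact exists_complexEquation hρ h.bihol.1 (by rwa [h1])

end Equations

end
end FormalHypersurface


namespace FormalHypersurface
open MvPowerSeries

noncomputable section

/-! ### Changes between normal coordinates -/

section NormalEquations

variable {ρ : MvPowerSeries (Fin 4) ℂ} {H T : Fin 2 → MvPowerSeries (Fin 2) ℂ}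
  {φ Q Q' : MvPowerSeries (Fin 3) ℂ}

theorem supp_of_subst_eq_zero_mid {f : MvPowerSeries (Fin 3) ℂ}
    (h : subst (![X 0, 0, X 2] : Fin 3 → MvPowerSeries (Fin 3) ℂ) f = 0) :
    Supp (fun d => 1 ≤ d 1) f := by
  have hv : Vanish (![X 0, 0, X 2] : Fin 3 → MvPowerSeries (Fin 3) ℂ) := by simp
  have hw : Vanish (![X 0, X 1, X 2] : Fin 3 → MvPowerSeries (Fin 3) ℂ) := by simp
  have := Supp.subst_sub_of_ideal (T := fun d => 1 ≤ d 1) hw.hasSubst hv.hasSubst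
    (by intro d e h; rw [Finsupp.add_apply]; omega)
    (by
      intro i
      fin_cases i
      · simpa using Supp.zero
      · simpa using Supp.X (by simp)
      · simpa using Supp.zero) f
  rwa [h, sub_zero, subst_X_vec₃] at this

theorem supp_of_subst_eq_zero_left {f : MvPowerSeries (Fin 3) ℂ}
    (h : subst (![0, X 1, X 2] : Fin 3 → MvPowerSeries (Fin 3) ℂ) f = 0) :
    Supp (fun d => 1 ≤ d 0) f := by
  have hv : Vanish (![0, X 1, X 2] : Fin 3 → MvPowerSeries (Fin 3) ℂ) := by simp
  have hw : Vanish (![X 0, X 1, X 2] : Fin 3 → MvPowerSeries (Fin 3) ℂ) := by simp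
  have := Supp.subst_sub_of_ideal (T := fun d => 1 ≤ d 0) hw.hasSubst hv.hasSubst
    (by intro d e h; rw [Finsupp.add_apply]; omega)
    (by
      intro i
      fin_cases i
      · simpa using Supp.X (by simp)
      · simpa using Supp.zero
      · simpa using Supp.zero) f
  rwa [h, sub_zero, subst_X_vec₃] at this

theorem subst_eq_zero_of_supp_left {m : ℕ} {f : MvPowerSeries (Fin 3) ℂ}
    (hf : Supp (fun d => 1 ≤ d 0) f) {y z : MvPowerSeries (Fin m) ℂ} (hv : Vanish ![0, y, z]) :
    subst ![0, y, z] f = 0 := by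
  have : Supp (fun _ => False) (subst ![0, y, z] f) := by
    refine Supp.subst hv.hasSubst fun d hd => ?_
    have h1 := hf d hd
    have h2 : ∏ i, (![0, y, z] : Fin 3 → MvPowerSeries (Fin m) ℂ) i ^ d i = 0 := by
      rw [Fin.prod_univ_three]
      simp [zero_pow (show d 0 ≠ 0 by omega)]
    rw [finsupp_prod_eq, h2]
    exact Supp.zero
  ext e
  exact this.coeff_eq_zero (by simp)

theorem subst_eq_zero_of_supp_mid {m : ℕ} {f : MvPowerSeries (Fin 3) ℂ}
    (hf : Supp (fun d => 1 ≤ d 1) f) {y z : MvPowerSeries (Fin m) ℂ} (hv : Vanish ![y, 0, z]) :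
    subst ![y, 0, z] f = 0 := by
  have : Supp (fun _ => False) (subst ![y, 0, z] f) := by
    refine Supp.subst hv.hasSubst fun d hd => ?_
    have h1 := hf d hd
    have h2 : ∏ i, (![y, 0, z] : Fin 3 → MvPowerSeries (Fin m) ℂ) i ^ d i = 0 := by
      rw [Fin.prod_univ_three]
      simp [zero_pow (show d 1 ≠ 0 by omega)]
    rw [finsupp_prod_eq, h2]
    exact Supp.zero
  ext e
  exact this.coeff_eq_zero (by simp)

theorem half_add_half {k : ℕ} (x : MvPowerSeries (Fin k) ℂ) : C (1 / 2) * (x + x) = x := by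
  have : (C (1 / 2) * (x + x) : MvPowerSeries (Fin k) ℂ) = C (1 / 2 + 1 / 2) * x := by
    rw [map_add]; ring
  rw [this]
  norm_num

/-- Normality in geometric terms: the points `(z, w, 0, w)`, and by the next lemma `(0, w, χ, w)`,
lie on the complexified hypersurface. -/
theorem IsRealEquation.eval_mid (h : IsRealEquation ρ H φ) (hρ : IsFormalHypersurface ρ) {m : ℕ}
    {y z : MvPowerSeries (Fin m) ℂ} (hv : Vanish ![y, z]) :
    subst ![y, z, 0, z] (pullback ρ H) = 0 := by
  simp only [vanish₂] at hv
  rw [h.eval_eq_zero_iff hρ (by simp [hv]), sub_self, mul_zero, half_add_half,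
    subst_eq_zero_of_supp_mid (h.supp.mono fun d hd => hd.2) (by simp [hv])]

theorem IsRealEquation.eval_left (h : IsRealEquation ρ H φ) (hρ : IsFormalHypersurface ρ) {m : ℕ}
    {y z : MvPowerSeries (Fin m) ℂ} (hv : Vanish ![y, z]) :
    subst ![0, z, y, z] (pullback ρ H) = 0 := by
  simp only [vanish₂] at hv
  rw [h.eval_eq_zero_iff hρ (by simp [hv]), sub_self, mul_zero, half_add_half,
    subst_eq_zero_of_supp_left (h.supp.mono fun d hd => hd.1) (by simp [hv])]

theorem subst_sub_X {m : ℕ} {x y z : MvPowerSeries (Fin m) ℂ} (hv : Vanish ![x, y, z])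
    (Q : MvPowerSeries (Fin 3) ℂ) :
    subst ![x, y, z] Q = z + subst ![x, y, z] (Q - X 2) := by
  rw [subst_sub hv.hasSubst, subst_X hv.hasSubst]
  simp

theorem IsComplexEquation.supp (hC : IsComplexEquation ρ H Q) (h : IsRealEquation ρ H φ)
    (hρ : IsFormalHypersurface ρ) : Supp (fun d => 1 ≤ d 0 ∧ 1 ≤ d 1) (Q - X 2) := by
  have hv : Vanish (![X 0, 0, X 2] : Fin 3 → MvPowerSeries (Fin 3) ℂ) := by simp
  have hw : Vanish (![0, X 1, X 2] : Fin 3 → MvPowerSeries (Fin 3) ℂ) := by simp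
  refine Supp.and (supp_of_subst_eq_zero_left ?_) (supp_of_subst_eq_zero_mid ?_)
  · have h1 := h.eval_left hρ (y := (X 1 : MvPowerSeries (Fin 3) ℂ)) (z := X 2) (by simp)
    rw [hC.eval_eq_zero_iff hρ h.bihol (by simp), subst_sub_X hw] at h1
    simpa using h1
  · have h1 := h.eval_mid hρ (y := (X 0 : MvPowerSeries (Fin 3) ℂ)) (z := X 2) (by simp)
    rw [hC.eval_eq_zero_iff hρ h.bihol (by simp), subst_sub_X hv] at h1
    simpa using h1

theorem IsComplexEquation.eval_self (hC : IsComplexEquation ρ H Q) (hH : IsFormalBihol H)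
    (hρ : IsFormalHypersurface ρ) : subst ![X 0, Q, X 1, X 2] (pullback ρ H) = 0 := by
  rw [hC.eval_eq_zero_iff hρ hH (by simp [hC.1]), subst_X_vec₃]

theorem IsComplexEquation.real_relation (hC : IsComplexEquation ρ H Q) (h : IsRealEquation ρ H φ)
    (hρ : IsFormalHypersurface ρ) :
    C (1 / (2 * Complex.I)) * (Q - X 2) = subst ![X 0, X 1, C (1 / 2) * (Q + X 2)] φ :=
  (h.eval_eq_zero_iff hρ (by simp [hC.1])).1 (hC.eval_self h.bihol hρ)

/-- The condition on `T = (F, G)` for `H ∘ T` to be normal coordinates, where `H` are. -/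
def PreservesNormal (Q : MvPowerSeries (Fin 3) ℂ) (T : Fin 2 → MvPowerSeries (Fin 2) ℂ) : Prop :=
  T 1 = subst ![T 0, subst ![0, X 1] (conj (T 0)), subst ![0, X 1] (conj (T 1))] Q

theorem vanish_zero_X : Vanish (![0, X 1] : Fin 2 → MvPowerSeries (Fin 2) ℂ) := by simp

/-- The condition says that the images under `(T, T̄)` of the points `(z, w, 0, w)` satisfy the
complex equation. -/
theorem preservesNormal_of_real (hρ : IsFormalHypersurface ρ) (hH : IsFormalBihol H)
    (hC : IsComplexEquation ρ H Q) (hT : IsFormalBihol T) {φ' : MvPowerSeries (Fin 3) ℂ}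
    (h' : IsRealEquation ρ (comp H T) φ') : PreservesNormal Q T := by
  have h1 := h'.eval_mid hρ (y := (X 0 : MvPowerSeries (Fin 2) ℂ)) (z := X 1) (by simp)
  have hv : Vanish (![X 0, X 1, 0, X 1] : Fin 4 → MvPowerSeries (Fin 2) ℂ) := by simp
  rw [eval_pullback_comp ρ hH.1 hT.1 hv, push, hC.eval_eq_zero_iff hρ hH (vanish_push hT.1 hv),
    subst_X_vec₂, subst_X_vec₂] at h1
  exact h1

theorem PreservesNormal.vanish (hT : Vanish T) :
    Vanish ![T 0, subst ![0, X 1] (conj (T 0)), subst ![0, X 1] (conj (T 1))] := by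
  simp [constantCoeff_subst_vanish vanish_zero_X, hT 0, hT 1]

theorem ord_two_of_supp {P : MvPowerSeries (Fin 3) ℂ}
    (hP : Supp (fun d => 1 ≤ d 0 ∧ 1 ≤ d 1) P) : Ord 2 P := by
  refine hP.mono fun d hd => ?_
  rw [degree_eq_sum', Fin.sum_univ_three]
  omega

/-- Since `Q - τ` has order two, `G` has the same linear part as `Ḡ(0, w)`: it contains no `z`, and
its coefficient of `w` is real. Invertibility of `T` then makes both diagonal entries nonzero. -/
theorem PreservesNormal.linear (h : PreservesNormal Q T) (hT : IsFormalBihol T)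
    (hP : Supp (fun d => 1 ≤ d 0 ∧ 1 ≤ d 1) (Q - X 2)) :
    coeff (mon ![1, 0]) (T 1) = 0 ∧
      starRingEnd ℂ (coeff (mon ![0, 1]) (T 1)) = coeff (mon ![0, 1]) (T 1) ∧
      coeff (mon ![1, 0]) (T 0) ≠ 0 ∧ coeff (mon ![0, 1]) (T 1) ≠ 0 := by
  have hv := PreservesNormal.vanish hT.1
  have h2 := (ord_two_of_supp hP).subst hv
  rw [PreservesNormal, subst_sub_X hv] at h
  have h3 : ∀ j, coeff (Finsupp.single j 1) (T 1) =
      coeff (Finsupp.single j 1) (subst ![0, X 1] (conj (T 1))) := by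
    intro j
    conv_lhs => rw [h, map_add, coeff_single_eq_zero_of_ord_two h2, add_zero]
  have h0 := h3 0
  have h1 := h3 1
  simp [coeff_single_subst vanish_zero_X, coeff_index_single_X] at h0 h1
  rw [single_eq_mon₂_zero] at h0
  rw [single_eq_mon₂_one] at h1
  have hd := hT.2
  rw [Matrix.det_fin_two] at hd
  simp only [jac, Matrix.of_apply, single_eq_mon₂_zero, single_eq_mon₂_one, h0, mul_zero,
    sub_zero] at hd
  exact ⟨h0, h1.symm, left_ne_zero_of_mul hd, right_ne_zero_of_mul hd⟩

/-- The reality condition on `ρ` is a symmetry under conjugation combined with exchanging `(z, w)`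
and `(χ, τ)`, and substitution of `(H, H̄)` preserves it. -/
theorem pullback_symm (hρ : IsFormalHypersurface ρ) (hH : Vanish H) :
    subst ![X 2, X 3, X 0, X 1] (conj (pullback ρ H)) = pullback ρ H := by
  have hb : Vanish (![X 0, X 1, X 2, X 3] : Fin 4 → MvPowerSeries (Fin 4) ℂ) := by simp
  have hs : Vanish (![X 2, X 3, X 0, X 1] : Fin 4 → MvPowerSeries (Fin 4) ℂ) := by simp
  have h1 := vanish_left hb
  have h2 := vanish_right hb
  have hp := vanish_push hH hb
  have hsym : subst (![X 2, X 3, X 0, X 1] : Fin 4 → MvPowerSeries (Fin 4) ℂ) (conj ρ) = ρ := by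
    ext d
    rw [eq_mon₄ d, coeff_subst_swap₄, coeff_conj, ← hρ.real]
  have h3 : pullback ρ H = subst (push H (X 0) (X 1) (X 2) (X 3)) ρ := rfl
  have h4 : pullback ρ H = subst (push H (X 0) (X 1) (X 2) (X 3))
      (subst (![X 2, X 3, X 0, X 1] : Fin 4 → MvPowerSeries (Fin 4) ℂ) (conj ρ)) := by
    rw [hsym, h3]
  have hc : Vanish (fun i => conj (push H (X 0 : MvPowerSeries (Fin 4) ℂ) (X 1) (X 2) (X 3) i)) :=
    fun i => by simp [hp i]
  have hL : subst ![X 2, X 3, X 0, X 1] (conj (pullback ρ H)) =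
      subst (fun i => subst (![X 2, X 3, X 0, X 1] : Fin 4 → MvPowerSeries (Fin 4) ℂ)
        (conj (push H (X 0 : MvPowerSeries (Fin 4) ℂ) (X 1) (X 2) (X 3) i))) (conj ρ) := by
    rw [h3, conj_subst hp, subst_subst hc hs]
  rw [hL]
  conv_rhs => rw [h4, subst_vec₄ hp hs]
  congr 1
  funext i
  have hl := fun (f : MvPowerSeries (Fin 2) ℂ) => conj_subst₂ h1 f
  have hr := fun (f : MvPowerSeries (Fin 2) ℂ) => conj_subst₂ h2 f
  simp only [conj_X] at hl hr
  have hX := fun j => subst_X (R := ℂ) hp.hasSubst j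
  simp only [push] at hX
  fin_cases i <;>
  simp [push, hl, hr, subst_vec₂ hs h1, subst_vec₂ hs h2, subst_X hs.hasSubst, hX]

theorem subst_swap₃ {m : ℕ} {x y z : MvPowerSeries (Fin m) ℂ} (hv : Vanish ![x, y, z])
    (f : MvPowerSeries (Fin 3) ℂ) :
    subst ![x, y, z] (subst (![X 1, X 0, X 2] : Fin 3 → MvPowerSeries (Fin 3) ℂ) f) =
      subst ![y, x, z] f := by
  rw [subst_vec₃ hv (by simp)]
  simp [subst_X hv.hasSubst]

theorem IsRealEquation.symm (h : IsRealEquation ρ H φ) :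
    subst ![X 1, X 0, X 2] (conj φ) = φ := by
  ext d
  rw [eq_mon₃ d, coeff_subst_swap₃, coeff_conj, ← h.real]

theorem IsRealEquation.conj_eval (h : IsRealEquation ρ H φ) {m : ℕ}
    {x y z : MvPowerSeries (Fin m) ℂ} (hv : Vanish ![x, y, z]) :
    conj (subst ![x, y, z] φ) = subst ![conj y, conj x, conj z] φ := by
  have hv' : Vanish ![conj y, conj x, conj z] := by
    simp only [vanish₃] at hv
    simp [hv]
  conv_rhs => rw [← h.symm]
  rw [subst_swap₃ hv', conj_subst₃ hv]

/-- The new equation is solved for `Im w` by the implicit function theorem. Uniqueness of the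
solution and the symmetry of the pullback make it real; the condition on `T` gives its vanishing for
`χ = 0`, and reality gives it for `z = 0`. -/
theorem isNormalCoordinates_of_preservesNormal (hρ : IsFormalHypersurface ρ)
    (h : IsRealEquation ρ H φ) (hC : IsComplexEquation ρ H Q) (hT : IsFormalBihol T)
    (hE : PreservesNormal Q T) : IsNormalCoordinates ρ (comp H T) := by
  obtain ⟨hl0, hlr, hF, hG⟩ := hE.linear hT (hC.supp h hρ)
  have hHT := h.bihol.comp hT
  set B := pullback ρ (comp H T) with hB
  have hb : Vanish (![X 0, X 1, X 2, X 3] : Fin 4 → MvPowerSeries (Fin 4) ℂ) := by simp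
  have hI : (C Complex.I * C (1 / (2 * Complex.I)) : MvPowerSeries (Fin 4) ℂ) = C (1 / 2) := by
    rw [← map_mul]
    congr 1
    field_simp
  have hh : (C (1 / 2) + C (1 / 2) : MvPowerSeries (Fin 4) ℂ) = 1 := by
    rw [← map_add]; norm_num
  obtain ⟨c, hc, c0, c1, c2, c3⟩ := h.coeff_single_pullback hρ
  have hBp : B = subst (push T (X 0) (X 1) (X 2) (X 3)) (pullback ρ H) := by
    rw [hB, ← eval_pullback_comp ρ h.bihol.1 hT.1 hb, subst_X_vec₄]
  have hB1 : ∀ j, coeff (Finsupp.single j 1) B =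
      c * (coeff (Finsupp.single j 1) (subst ![(X 0 : MvPowerSeries (Fin 4) ℂ), X 1] (T 1)) -
      coeff (Finsupp.single j 1)
        (subst ![(X 2 : MvPowerSeries (Fin 4) ℂ), X 3] (conj (T 1)))) := by
    intro j
    rw [hBp, coeff_single_subst (vanish_push hT.1 hb), Fin.sum_univ_four, c0, c1, c2, c3]
    simp only [push, Matrix.cons_val]
    ring
  have hv1 := vanish_left hb
  have hv2 := vanish_right hb
  have b1 := hB1 1
  have b3 := hB1 3
  simp [coeff_single_subst hv1, coeff_single_subst hv2, coeff_index_single_X,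
    single_eq_mon₂_one, hlr] at b1 b3
  -- Here `w = s + i t` and `τ = s - i t`; the inverse substitution is `hq`. The variable to be
  -- solved for is `t`.
  have hp : Vanish (![X 0, X 2 + C Complex.I * X 3, X 1, X 2 - C Complex.I * X 3] :
    Fin 4 → MvPowerSeries (Fin 4) ℂ) := by simp
  have hq : Vanish (![X 0, X 2, C (1 / 2) * (X 1 + X 3), C (1 / (2 * Complex.I)) * (X 1 - X 3)] :
    Fin 4 → MvPowerSeries (Fin 4) ℂ) := by simp
  have hi : Vanish (![X 0, X 1, X 2] : Fin 3 → MvPowerSeries (Fin 4) ℂ) := by simp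
  obtain ⟨ψ, A, hψ, hA, hBA, hz⟩ := exists_implicit
    (E := subst ![X 0, X 2 + C Complex.I * X 3, X 1, X 2 - C Complex.I * X 3] B)
    (by rw [constantCoeff_subst_vanish hp, hB, constantCoeff_pullback hρ hHT.1])
    (by
      rw [coeff_single_subst hp, Fin.sum_univ_four, b1, b3]
      simp [coeff_index_single_X, coeff_C_mul]
      exact ⟨hc, hG⟩)
  have hfac : B = subst (![X 0, X 2, C (1 / 2) * (X 1 + X 3),
      C (1 / (2 * Complex.I)) * (X 1 - X 3)] : Fin 4 → MvPowerSeries (Fin 4) ℂ) A *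
        realDefining ψ := by
    have h2 := congrArg (subst (![X 0, X 2, C (1 / 2) * (X 1 + X 3),
      C (1 / (2 * Complex.I)) * (X 1 - X 3)] : Fin 4 → MvPowerSeries (Fin 4) ℂ)) hBA
    rw [subst_vec₄ hq hp] at h2
    simp only [subst_mul hq.hasSubst, subst_sub hq.hasSubst, subst_vec₃ hq hi,
      subst_add hq.hasSubst, subst_C, subst_X hq.hasSubst, Matrix.cons_val] at h2
    have e1 : (C (1 / 2) * (X 1 + X 3) + C Complex.I * (C (1 / (2 * Complex.I)) * (X 1 - X 3)) :
        MvPowerSeries (Fin 4) ℂ) = X 1 := by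
      linear_combination (X 1 - X 3) * hI + X 1 * hh
    have e2 : (C (1 / 2) * (X 1 + X 3) - C Complex.I * (C (1 / (2 * Complex.I)) * (X 1 - X 3)) :
        MvPowerSeries (Fin 4) ℂ) = X 3 := by
      linear_combination -(X 1 - X 3) * hI + X 3 * hh
    rw [e1, e2, subst_X_vec₄] at h2
    exact h2
  have hrd := constantCoeff_realDefining hψ
  have hunique : ∀ ψ' : MvPowerSeries (Fin 3) ℂ, constantCoeff ψ' = 0 →
      subst ![X 0, X 2 + C Complex.I * ψ', X 1, X 2 - C Complex.I * ψ'] B = 0 → ψ' = ψ := by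
    intro ψ' h0 h1
    have hv : Vanish ![X 0, X 2 + C Complex.I * ψ', X 1, X 2 - C Complex.I * ψ'] := by simp [h0]
    rw [eval_eq_zero_iff hρ hHT hfac hrd hv, eval_realDefining ψ hv] at h1
    have e1 : C (1 / 2) * (X 2 + C Complex.I * ψ' + (X 2 - C Complex.I * ψ')) = X 2 := by
      have : X 2 + C Complex.I * ψ' + (X 2 - C Complex.I * ψ') = X 2 + X 2 := by ring
      rw [this, half_add_half]
    have e2 : C (1 / (2 * Complex.I)) * (X 2 + C Complex.I * ψ' - (X 2 - C Complex.I * ψ')) =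
        ψ' := by
      have : C (1 / (2 * Complex.I)) * (X 2 + C Complex.I * ψ' - (X 2 - C Complex.I * ψ')) =
        C (1 / (2 * Complex.I) * (2 * Complex.I)) * ψ' := by
        rw [map_mul, map_mul, map_ofNat]; ring
      rw [this, one_div, inv_mul_cancel₀ (by simp), map_one, one_mul]
    rw [e1, e2, subst_X_vec₃] at h1
    exact sub_eq_zero.1 h1
  have hsw : Vanish (![X 1, X 0, X 2] : Fin 3 → MvPowerSeries (Fin 3) ℂ) := by simp
  -- The conjugated and swapped solution `ψs` solves the same equation by `pullback_symm`, so it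
  -- coincides with `ψ`.
  have hstar : subst (![X 1, X 0, X 2] : Fin 3 → MvPowerSeries (Fin 3) ℂ) (conj ψ) = ψ := by
    set ψs := subst (![X 1, X 0, X 2] : Fin 3 → MvPowerSeries (Fin 3) ℂ) (conj ψ) with hψs
    have hψs0 : constantCoeff ψs = 0 := by simp [hψs, constantCoeff_subst_vanish hsw, hψ]
    refine hunique _ hψs0 ?_
    have hv : Vanish (![X 0, X 1, X 2, ψ] : Fin 4 → MvPowerSeries (Fin 3) ℂ) := by simp [hψ]
    have hv' : Vanish ![X 0, X 2 + C Complex.I * ψ, X 1, X 2 - C Complex.I * ψ] := by simp [hψ]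
    rw [subst_vec₄ hv hp, subst_add hv.hasSubst, subst_sub hv.hasSubst, subst_mul hv.hasSubst,
      subst_C] at hz
    simp only [subst_X hv.hasSubst, Matrix.cons_val] at hz
    have h1 := congrArg conj hz
    rw [conj_subst₄ hv'] at h1
    have h2 := congrArg (subst (![X 1, X 0, X 2] : Fin 3 → MvPowerSeries (Fin 3) ℂ)) h1
    have hz0 : conj (0 : MvPowerSeries (Fin 3) ℂ) = 0 := map_zero _
    rw [hz0, subst_zero_right hsw, subst_vec₄ hsw (by simp [hψ])] at h2
    simp only [conj_add, conj_sub, conj_mul, conj_X, conj_C, Complex.conj_I,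
      subst_add hsw.hasSubst, subst_sub hsw.hasSubst, subst_mul hsw.hasSubst, subst_C,
      subst_X hsw.hasSubst, Matrix.cons_val] at h2
    rw [← hψs, map_neg, neg_mul] at h2
    have hb4 : Vanish ![X 0, X 2 + C Complex.I * ψs, X 1, X 2 - C Complex.I * ψs] := by
      simp [hψs0]
    rw [hB, ← pullback_symm hρ hHT.1, subst_vec₄ hb4 (by simp)]
    simp only [subst_X hb4.hasSubst, Matrix.cons_val]
    rw [sub_eq_add_neg, ← sub_neg_eq_add (X 2) (C Complex.I * ψs)]
    exact h2
  have hreal : ∀ a b m : ℕ, coeff (mon ![a, b, m]) ψ =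
      starRingEnd ℂ (coeff (mon ![b, a, m]) ψ) := by
    intro a b m
    conv_lhs => rw [← hstar, coeff_subst_swap₃, coeff_conj]
  have hmid : subst (![X 0, 0, X 2] : Fin 3 → MvPowerSeries (Fin 3) ℂ) ψ = 0 := by
    have hv : Vanish (![X 0, X 2, 0, X 2] : Fin 4 → MvPowerSeries (Fin 3) ℂ) := by simp
    have hw : Vanish (![X 0, X 2] : Fin 2 → MvPowerSeries (Fin 3) ℂ) := by simp
    have h1 : subst (![X 0, X 2, 0, X 2] : Fin 4 → MvPowerSeries (Fin 3) ℂ) B = 0 := by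
      rw [hB, eval_pullback_comp ρ h.bihol.1 hT.1 hv, push,
        hC.eval_eq_zero_iff hρ h.bihol (vanish_push hT.1 hv)]
      have h2 := congrArg (subst (![X 0, X 2] : Fin 2 → MvPowerSeries (Fin 3) ℂ)) hE
      rw [subst_vec₃ hw (PreservesNormal.vanish hT.1), subst_vec₂ hw vanish_zero_X,
        subst_vec₂ hw vanish_zero_X, subst_zero_right hw, subst_X hw.hasSubst] at h2
      exact h2
    rw [eval_eq_zero_iff hρ hHT hfac hrd hv, eval_realDefining ψ hv, sub_self, mul_zero,
      half_add_half, zero_sub, neg_eq_zero] at h1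
    exact h1
  have hleft : ∀ a m : ℕ, coeff (mon ![a, 0, m]) ψ = 0 := fun a m =>
    (supp_of_subst_eq_zero_mid hmid).coeff_eq_zero (by simp [mon_apply])
  exact ⟨ψ, hHT, hreal, hleft, fun b m => by rw [hreal, hleft, map_zero], _, hfac⟩

/-- Parametrisation of the admissible maps by `F` and a real series `p(w)`. The point `(F(0, w),
G(0, w))` must lie on the hypersurface with real part `p`, which fixes `G(0, w) = p + i φ`; the
condition `PreservesNormal` then reads off `G(z, w)`. -/
theorem exists_preservesNormal (hρ : IsFormalHypersurface ρ) (h : IsRealEquation ρ H φ)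
    (hC : IsComplexEquation ρ H Q) {F p : MvPowerSeries (Fin 2) ℂ} (hF : constantCoeff F = 0)
    (hF1 : coeff (mon ![1, 0]) F ≠ 0) (hp0 : constantCoeff p = 0)
    (hp : subst (![0, X 1] : Fin 2 → MvPowerSeries (Fin 2) ℂ) p = p) (hpr : conj p = p) (hp1 : coeff (mon ![0, 1]) p ≠ 0) :
    ∃ G, IsFormalBihol ![F, G] ∧ PreservesNormal Q ![F, G] ∧
      subst (![0, X 1] : Fin 2 → MvPowerSeries (Fin 2) ℂ) G = p + C Complex.I *
        subst ![subst (![0, X 1] : Fin 2 → MvPowerSeries (Fin 2) ℂ) F, subst (![0, X 1] : Fin 2 → MvPowerSeries (Fin 2) ℂ) (conj F), p] φ := by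
  set f := subst (![0, X 1] : Fin 2 → MvPowerSeries (Fin 2) ℂ) F with hf
  have hf0 : constantCoeff f = 0 := by rw [hf, constantCoeff_subst_vanish vanish_zero_X, hF]
  have hcz : conj (0 : MvPowerSeries (Fin 2) ℂ) = 0 := map_zero _
  have hfc : subst (![0, X 1] : Fin 2 → MvPowerSeries (Fin 2) ℂ) (conj F) = conj f := by
    rw [hf, conj_subst₂ vanish_zero_X, hcz, conj_X]
  rw [hfc]
  have hfp : Vanish ![f, conj f, p] := by simp [hf0, hp0]
  set k := subst ![f, conj f, p] φ with hk
  have hk0 : constantCoeff k = 0 := by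
    rw [hk, constantCoeff_subst_vanish hfp, h.constantCoeff_eq_zero]
  have hk2 : Ord 2 k := h.ord_two.subst hfp
  have hkr : conj k = k := by
    rw [hk, h.conj_eval hfp, conj_conj, hpr]
  set g := p + C Complex.I * k with hg
  set gb := p - C Complex.I * k with hgb
  have hg0 : constantCoeff g = 0 := by simp [hg, hp0, hk0]
  have hgb0 : constantCoeff gb = 0 := by simp [hgb, hp0, hk0]
  have hgc : conj g = gb := by
    rw [hg, hgb, conj_add, conj_mul, hpr, hkr, conj_C, Complex.conj_I, map_neg]; ring
  have hFv : Vanish ![F, conj f, gb] := by simp [hF, hf0, hgb0]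
  -- The point `(f, g)` satisfies the real equation, hence the complex one; so the `G` defined
  -- through `Q` restricts to `g` on the axis `z = 0`.
  have hQg : g = subst ![f, conj f, gb] Q := by
    have hv : Vanish ![f, g, conj f, gb] := by simp [hf0, hg0, hgb0]
    rw [← hC.eval_eq_zero_iff hρ h.bihol hv, h.eval_eq_zero_iff hρ hv]
    have e1 : C (1 / 2) * (g + gb) = p := by
      have : g + gb = p + p := by rw [hg, hgb]; ring
      rw [this, half_add_half]
    have e2 : C (1 / (2 * Complex.I)) * (g - gb) = k := by
      have : C (1 / (2 * Complex.I)) * (g - gb) = C (1 / (2 * Complex.I) * (2 * Complex.I)) * k := by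
        rw [map_mul, map_mul, map_ofNat, hg, hgb]; ring
      rw [this, one_div, inv_mul_cancel₀ (by simp), map_one, one_mul]
    rw [e1, e2]
  have hff : subst (![0, X 1] : Fin 2 → MvPowerSeries (Fin 2) ℂ) f = f := by
    rw [hf, subst_vec₂ vanish_zero_X vanish_zero_X, subst_zero_right vanish_zero_X,
      subst_X vanish_zero_X.hasSubst]
    rfl
  have hfcf : subst (![0, X 1] : Fin 2 → MvPowerSeries (Fin 2) ℂ) (conj f) = conj f := by
    conv_rhs => rw [← hff, conj_subst₂ vanish_zero_X, hcz, conj_X]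
  have hgg : subst (![0, X 1] : Fin 2 → MvPowerSeries (Fin 2) ℂ) gb = gb := by
    rw [hgb, subst_sub vanish_zero_X.hasSubst, subst_mul vanish_zero_X.hasSubst, hp, subst_C, hk,
      subst_vec₃ vanish_zero_X hfp, hff, hfcf, hp]
  set G := subst ![F, conj f, gb] Q with hG
  have hG0 : constantCoeff G = 0 := by rw [hG, constantCoeff_subst_vanish hFv, hC.1]
  have hGg : subst (![0, X 1] : Fin 2 → MvPowerSeries (Fin 2) ℂ) G = g := by
    rw [hG, subst_vec₃ vanish_zero_X hFv, hgg, hfcf, ← hf, ← hQg]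
  have hGc : subst (![0, X 1] : Fin 2 → MvPowerSeries (Fin 2) ℂ) (conj G) = gb := by
    rw [← hgc, ← hGg, conj_subst₂ vanish_zero_X, hcz, conj_X]
  refine ⟨G, ⟨?_, ?_⟩, ?_, hGg⟩
  · intro i; fin_cases i
    · exact hF
    · exact hG0
  · have h2 := (ord_two_of_supp (hC.supp h hρ)).subst hFv
    have hlin : ∀ j, coeff (Finsupp.single j 1) G = coeff (Finsupp.single j 1) p := by
      intro j
      rw [hG, subst_sub_X hFv, map_add, coeff_single_eq_zero_of_ord_two h2, add_zero, hgb, map_sub,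
        coeff_C_mul, coeff_single_eq_zero_of_ord_two hk2, mul_zero, sub_zero]
    have hpz : coeff (Finsupp.single 0 1) p = 0 := by
      rw [← hp, coeff_single_subst vanish_zero_X]
      simp [coeff_index_single_X]
    rw [Matrix.det_fin_two]
    simp only [jac, Matrix.of_apply, Matrix.cons_val, hlin, hpz, mul_zero, sub_zero]
    rw [single_eq_mon₂_zero, single_eq_mon₂_one]
    exact mul_ne_zero hF1 hp1
  · simp only [PreservesNormal, Matrix.cons_val]
    rw [hfc, hGc]

/-- The relation between complex equations in two systems of normal coordinates. -/
structure IsTransform (T : Fin 2 → MvPowerSeries (Fin 2) ℂ) (P P' : MvPowerSeries (Fin 3) ℂ) :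
    Prop where
  bihol : IsFormalBihol T
  supp : Supp (fun d => 1 ≤ d 0 ∧ 1 ≤ d 1) P
  supp' : Supp (fun d => 1 ≤ d 0 ∧ 1 ≤ d 1) P'
  linear : coeff (mon ![1, 0]) (T 1) = 0 ∧
      starRingEnd ℂ (coeff (mon ![0, 1]) (T 1)) = coeff (mon ![0, 1]) (T 1) ∧
      coeff (mon ![1, 0]) (T 0) ≠ 0 ∧ coeff (mon ![0, 1]) (T 1) ≠ 0
  eqn : subst ![X 0, X 2 + P'] (T 1) = subst ![X 1, X 2] (conj (T 1)) +
    subst ![subst ![X 0, X 2 + P'] (T 0), subst ![X 1, X 2] (conj (T 0)),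
      subst ![X 1, X 2] (conj (T 1))] P

theorem isTransform (hρ : IsFormalHypersurface ρ) (h : IsRealEquation ρ H φ)
    (hC : IsComplexEquation ρ H Q) (hT : IsFormalBihol T) {φ' : MvPowerSeries (Fin 3) ℂ}
    (h' : IsRealEquation ρ (comp H T) φ') (hC' : IsComplexEquation ρ (comp H T) Q') :
    IsTransform T (Q - X 2) (Q' - X 2) := by
  refine ⟨hT, hC.supp h hρ, hC'.supp h' hρ,
    (preservesNormal_of_real hρ h.bihol hC hT h').linear hT (hC.supp h hρ), ?_⟩
  have h1 := hC'.eval_self h'.bihol hρ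
  have hv : Vanish ![X 0, Q', X 1, X 2] := by simp [hC'.1]
  rw [eval_pullback_comp ρ h.bihol.1 hT.1 hv, push,
    hC.eval_eq_zero_iff hρ h.bihol (vanish_push hT.1 hv),
    subst_sub_X (vanish_tail (vanish_push hT.1 hv))] at h1
  rw [add_sub_cancel]
  exact h1

end NormalEquations

end
end FormalHypersurface


namespace FormalHypersurface
open MvPowerSeries

noncomputable section

/-! ### Supports in the three variables `z`, `χ`, `τ` -/

section Sup

/-- `Supp` for three variables, with the condition on the three exponents. -/
abbrev Sup (S : ℕ → ℕ → ℕ → Prop) (f : MvPowerSeries (Fin 3) ℂ) : Prop :=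
  Supp (fun d => S (d 0) (d 1) (d 2)) f

variable {S T U V : ℕ → ℕ → ℕ → Prop} {f g l : MvPowerSeries (Fin 3) ℂ}

theorem Sup.imp (hf : Sup S f) (h : ∀ a b c, S a b c → T a b c) : Sup T f :=
  Supp.mono hf fun _ hd => h _ _ _ hd

theorem Sup.trivial (f : MvPowerSeries (Fin 3) ℂ) : Sup (fun _ _ _ => True) f :=
  fun _ _ => True.intro

theorem Sup.add (hf : Sup S f) (hg : Sup S g) : Sup S (f + g) := Supp.add hf hg
theorem Sup.sub (hf : Sup S f) (hg : Sup S g) : Sup S (f - g) := Supp.sub hf hg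
theorem Sup.zero : Sup S 0 := Supp.zero
theorem Sup.C_mul (hf : Sup S f) (c : ℂ) : Sup S (C c * f) := Supp.C_mul hf c

theorem Sup.mul (hf : Sup S f) (hg : Sup T g)
    (h : ∀ a b c a' b' c', S a b c → T a' b' c' → U (a + a') (b + b') (c + c')) :
    Sup U (f * g) :=
  Supp.mul hf hg fun _ _ hd he => h _ _ _ _ _ _ hd he

theorem Sup.mul₃ (hf : Sup S f) (hg : Sup T g) (hl : Sup V l)
    (h : ∀ a b c a' b' c' a'' b'' c'', S a b c → T a' b' c' → V a'' b'' c'' →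
      U (a + a' + a'') (b + b' + b'') (c + c' + c'')) : Sup U (f * g * l) := by
  refine Sup.mul (S := fun x y z => ∃ a b c a' b' c', S a b c ∧ T a' b' c' ∧ x = a + a' ∧
    y = b + b' ∧ z = c + c') (Sup.mul hf hg ?_) hl ?_
  · intro a b c a' b' c' h1 h2
    exact ⟨a, b, c, a', b', c', h1, h2, rfl, rfl, rfl⟩
  · rintro x y z a'' b'' c'' ⟨a, b, c, a', b', c', h1, h2, rfl, rfl, rfl⟩ h3
    exact h _ _ _ _ _ _ _ _ _ h1 h2 h3

theorem Sup.pow (hf : Sup S f) (T : ℕ → ℕ → ℕ → ℕ → Prop) (h0 : T 0 0 0 0)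
    (h : ∀ n a b c a' b' c', T n a b c → S a' b' c' → T (n + 1) (a + a') (b + b') (c + c'))
    (n : ℕ) : Sup (T n) (f ^ n) :=
  Supp.pow hf (fun n d => T n (d 0) (d 1) (d 2)) h0 (fun _ _ _ hd he => h _ _ _ _ _ _ _ hd he) n

theorem sup_X_zero (h : S 1 0 0) : Sup S (X 0) := Supp.X (by simpa using h)
theorem sup_X_one (h : S 0 1 0) : Sup S (X 1) := Supp.X (by simpa using h)
theorem sup_X_two (h : S 0 0 1) : Sup S (X 2) := Supp.X (by simpa using h)

theorem sup_X_zero_pow (n : ℕ) (h : S n 0 0) : Sup S (X 0 ^ n) := by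
  rw [X_pow_eq]; exact Supp.monomial _ (by simpa using h)
theorem sup_X_one_pow (n : ℕ) (h : S 0 n 0) : Sup S (X 1 ^ n) := by
  rw [X_pow_eq]; exact Supp.monomial _ (by simpa using h)
theorem sup_X_two_pow (n : ℕ) (h : S 0 0 n) : Sup S (X 2 ^ n) := by
  rw [X_pow_eq]; exact Supp.monomial _ (by simpa using h)

theorem Sup.subst₃ {A B D : MvPowerSeries (Fin 3) ℂ} (hv : Vanish ![A, B, D]) (hf : Sup S f)
    (h : ∀ a b c, S a b c → Sup U (A ^ a * B ^ b * D ^ c)) : Sup U (subst ![A, B, D] f) := by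
  refine Supp.subst hv.hasSubst fun d hd => ?_
  rw [finsupp_prod_eq, Fin.prod_univ_three]
  exact h _ _ _ (hf d hd)

theorem Sup.subst_sub₃ {A B D A' B' D' : MvPowerSeries (Fin 3) ℂ} (hv : Vanish ![A, B, D])
    (hv' : Vanish ![A', B', D']) (hf : Sup S f)
    (h : ∀ a b c, S a b c → Sup U (A ^ a * B ^ b * D ^ c - A' ^ a * B' ^ b * D' ^ c)) :
    Sup U (subst ![A, B, D] f - subst ![A', B', D'] f) := by
  refine Supp.subst_sub hv.hasSubst hv'.hasSubst fun d hd => ?_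
  rw [finsupp_prod_eq, finsupp_prod_eq, Fin.prod_univ_three, Fin.prod_univ_three]
  exact h _ _ _ (hf d hd)

theorem Sup.subst₂ {R : ℕ → ℕ → Prop} {F : MvPowerSeries (Fin 2) ℂ}
    {A B : MvPowerSeries (Fin 3) ℂ} (hv : Vanish ![A, B])
    (hF : Supp (fun d => R (d 0) (d 1)) F) (h : ∀ a b, R a b → Sup U (A ^ a * B ^ b)) :
    Sup U (subst ![A, B] F) := by
  refine Supp.subst hv.hasSubst fun d hd => ?_
  rw [finsupp_prod_eq, Fin.prod_univ_two]
  exact h _ _ (hF d hd)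

theorem Sup.subst_sub₂ {R : ℕ → ℕ → Prop} {F : MvPowerSeries (Fin 2) ℂ}
    {A B A' B' : MvPowerSeries (Fin 3) ℂ} (hv : Vanish ![A, B]) (hv' : Vanish ![A', B'])
    (hF : Supp (fun d => R (d 0) (d 1)) F)
    (h : ∀ a b, R a b → Sup U (A ^ a * B ^ b - A' ^ a * B' ^ b)) :
    Sup U (subst ![A, B] F - subst ![A', B'] F) := by
  refine Supp.subst_sub hv.hasSubst hv'.hasSubst fun d hd => ?_
  rw [finsupp_prod_eq, finsupp_prod_eq, Fin.prod_univ_two, Fin.prod_univ_two]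
  exact h _ _ (hF d hd)

theorem Sup.subst_zero₂ {R : ℕ → ℕ → Prop} {F : MvPowerSeries (Fin 2) ℂ}
    {B : MvPowerSeries (Fin 3) ℂ} (hB : constantCoeff B = 0)
    (hF : Supp (fun d => R (d 0) (d 1)) F) (h : ∀ b, R 0 b → Sup U (B ^ b)) :
    Sup U (subst ![0, B] F) := by
  refine Sup.subst₂ (by simp [hB]) hF fun a b hab => ?_
  rcases Nat.eq_zero_or_pos a with rfl | ha
  · simpa using h b hab
  · rw [zero_pow ha.ne', zero_mul]; exact Supp.zero

theorem sub_pow_split {R : Type*} [CommRing R] (a b c a' b' c' : R) :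
    a * b * c - a' * b' * c' = (a - a') * b * c + a' * (b - b') * c + a' * b' * (c - c') := by
  ring

/-- `A ^ n - A' ^ n` is `A - A'` times a sum of products of `n - 1` factors `A`, `A'`; `S'` bounds
these products, and `n = 0` gives zero. -/
theorem Sup.pow_sub {A A' : MvPowerSeries (Fin 3) ℂ} {S' : ℕ → ℕ → ℕ → ℕ → Prop}
    (hd : Sup S (A - A'))
    (hs : ∀ i j, Sup (S' (i + j)) (A ^ i * A' ^ j)) (n : ℕ)
    (h : ∀ m a b c a' b' c', n = m + 1 → S a b c → S' m a' b' c' →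
      U (a + a') (b + b') (c + c')) : Sup U (A ^ n - A' ^ n) := by
  rcases n with _ | n
  · simpa using Supp.zero
  · rw [← (Commute.all A A').mul_geom_sum₂]
    refine Sup.mul (T := S' n) hd (Supp.sum fun j hj => ?_) fun a b c a' b' c' => h n _ _ _ _ _ _ rfl
    rw [Finset.mem_range] at hj
    have := hs j (n + 1 - 1 - j)
    rwa [show j + (n + 1 - 1 - j) = n by omega] at this

theorem Sup.subst_sub_of_ideal {A B D A' B' D' : MvPowerSeries (Fin 3) ℂ}
    (hv : Vanish ![A, B, D]) (hv' : Vanish ![A', B', D'])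
    (hU : ∀ a b c a' b' c', U a b c → U (a + a') (b + b') (c + c'))
    (h0 : Sup U (A - A')) (h1 : Sup U (B - B')) (h2 : Sup U (D - D'))
    (f : MvPowerSeries (Fin 3) ℂ) : Sup U (subst ![A, B, D] f - subst ![A', B', D'] f) := by
  refine Supp.subst_sub_of_ideal hv.hasSubst hv'.hasSubst (fun d e hd => hU _ _ _ _ _ _ hd) ?_ f
  intro i
  fin_cases i
  · exact h0
  · exact h1
  · exact h2

end Sup

/-! ### Coefficients of series in two of the three variables -/

section Coefficients

theorem coeff_mon_X_pow_mul (i j k a b c : ℕ) (f : MvPowerSeries (Fin 3) ℂ) :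
    coeff (mon ![i + a, j + b, k + c]) (X 0 ^ i * X 1 ^ j * X 2 ^ k * f) =
      coeff (mon ![a, b, c]) f := by
  have h : (X 0 ^ i * X 1 ^ j * X 2 ^ k : MvPowerSeries (Fin 3) ℂ) = monomial (mon ![i, j, k]) 1 := by
    have hexp : Finsupp.single 0 i + Finsupp.single 1 j + Finsupp.single 2 k = mon ![i, j, k] := by
      ext l; fin_cases l <;> simp [mon_apply]
    rw [X_pow_eq, X_pow_eq, X_pow_eq, monomial_mul_monomial, monomial_mul_monomial, one_mul,
      one_mul, hexp]
  have h2 : mon ![i + a, j + b, k + c] = mon ![i, j, k] + mon ![a, b, c] := by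
    ext l; fin_cases l <;> simp [mon_apply]
  rw [h, h2, coeff_add_monomial_mul, one_mul]

theorem subst_vec_eq_rename (e : Fin 2 ↪ Fin 3) (f : MvPowerSeries (Fin 2) ℂ) :
    subst ![X (e 0), X (e 1)] f = rename e f := by
  rw [rename_eq_subst]
  congr 1
  funext i
  fin_cases i <;> rfl

theorem coeff_subst_tail (f : MvPowerSeries (Fin 2) ℂ) (j k : ℕ) :
    coeff (mon ![0, j, k]) (subst (![X 1, X 2] : Fin 2 → MvPowerSeries (Fin 3) ℂ) f) =
      coeff (mon ![j, k]) f := by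
  have h := subst_vec_eq_rename (Fin.succEmb 2) f
  have h1 : (Fin.succEmb 2) 0 = 1 := rfl
  have h2 : (Fin.succEmb 2) 1 = 2 := rfl
  rw [h1, h2] at h
  rw [h, ← coeff_embDomain_rename (Fin.succEmb 2) f]
  have h3 : Finsupp.embDomain (Fin.succEmb 2) (mon ![j, k]) = mon ![0, j, k] := by
    ext i
    fin_cases i
    · exact Finsupp.embDomain_of_notMem_range _ _ _ (by simp)
    · exact Finsupp.embDomain_apply_self _ _ 0
    · exact Finsupp.embDomain_apply_self _ _ 1
  rw [h3]

theorem coeff_subst_outer (f : MvPowerSeries (Fin 2) ℂ) (j k : ℕ) :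
    coeff (mon ![j, 0, k]) (subst (![X 0, X 2] : Fin 2 → MvPowerSeries (Fin 3) ℂ) f) =
      coeff (mon ![j, k]) f := by
  have h := subst_vec_eq_rename (Fin.succAboveEmb 1) f
  have h1 : (Fin.succAboveEmb 1) (0 : Fin 2) = (0 : Fin 3) := rfl
  have h2 : (Fin.succAboveEmb 1) (1 : Fin 2) = (2 : Fin 3) := rfl
  rw [h1, h2] at h
  rw [h, ← coeff_embDomain_rename (Fin.succAboveEmb (1 : Fin 3)) f]
  have h3 : Finsupp.embDomain (Fin.succAboveEmb (1 : Fin 3)) (mon ![j, k]) = mon ![j, 0, k] := by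
    ext i
    fin_cases i
    · exact Finsupp.embDomain_apply_self _ _ 0
    · exact Finsupp.embDomain_of_notMem_range _ _ _ (by simp)
    · exact Finsupp.embDomain_apply_self _ _ 1
  rw [h3]

theorem supp_subst_outer (f : MvPowerSeries (Fin 2) ℂ) :
    Sup (fun _ b _ => b = 0) (subst ![X 0, X 2] f) := by
  refine Sup.subst₂ (by simp) (R := fun _ _ => True) (fun _ _ => True.intro) fun a b _ => ?_
  exact Sup.mul (sup_X_zero_pow (S := fun _ b _ => b = 0) a rfl)
    (sup_X_two_pow (S := fun _ b _ => b = 0) b rfl) (by intros; omega)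

end Coefficients

/-! ### Leading terms of the real and of the complex equation -/

section RealToComplex

variable {ρ : MvPowerSeries (Fin 4) ℂ} {H : Fin 2 → MvPowerSeries (Fin 2) ℂ}
  {φ Q : MvPowerSeries (Fin 3) ℂ}

/-- Write `φ = z ψ`. The real relation evaluates `ψ` at `(Q + τ) / 2`, which differs from `τ` by `(Q
- τ) / 2`; Hadamard's lemma extracts this factor. Thus `φ` is `Q - τ` times a unit congruent to `1 /
(2i)` modulo `z`. -/
theorem IsComplexEquation.exists_unit (hC : IsComplexEquation ρ H Q) (h : IsRealEquation ρ H φ)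
    (hρ : IsFormalHypersurface ρ) :
    ∃ U : MvPowerSeries (Fin 3) ℂ, C (1 / (2 * Complex.I)) * (Q - X 2) =
      φ + X 0 * U * (Q - X 2) := by
  obtain ⟨ψ, hψ⟩ : (X 0 : MvPowerSeries (Fin 3) ℂ) ∣ φ := by
    rw [X_dvd_iff]
    intro d hd
    exact h.coeff_eq_zero (Or.inl hd)
  have hv : Vanish ![X 0, X 1, C (1 / 2) * (Q + X 2)] := by simp [hC.1]
  have hw : Vanish (![X 0, X 1, X 2] : Fin 3 → MvPowerSeries (Fin 3) ℂ) := by simp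
  obtain ⟨U, hU, -⟩ := exists_subst_sub_eq_mul hv hw 2
    (by intro j hj; fin_cases j <;> first | rfl | exact absurd rfl hj) ψ
  rw [subst_X_vec₃] at hU
  simp only [Matrix.cons_val] at hU
  have h1 := hC.real_relation h hρ
  rw [hψ, subst_mul hv.hasSubst, subst_X hv.hasSubst] at h1
  simp only [Matrix.cons_val] at h1
  refine ⟨C (1 / 2) * U, ?_⟩
  have hh : C (1 / 2) * (Q + X 2) - X 2 = C (1 / 2) * (Q - X 2) := by
    have : (C (1 / 2) + C (1 / 2) : MvPowerSeries (Fin 3) ℂ) = 1 := by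
      rw [← map_add]; norm_num
    linear_combination X 2 * this
  rw [hh] at hU
  rw [h1, hψ]
  linear_combination X 0 * hU

/-- The exponents of `z`, `s` allowed above an invariant pair `(α, μ)`. -/
abbrev Above (α μ : ℕ) (f : MvPowerSeries (Fin 3) ℂ) : Prop :=
  Sup (fun a _ c => (a = α ∧ c = μ) ∨ μ + 1 ≤ c ∨ α + μ + 1 ≤ a + c) f

theorem above_upward {α μ : ℕ} : ∀ d e : Fin 3 →₀ ℕ,
    ((d 0 = α ∧ d 2 = μ) ∨ μ + 1 ≤ d 2 ∨ α + μ + 1 ≤ d 0 + d 2) →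
    (((d + e) 0 = α ∧ (d + e) 2 = μ) ∨ μ + 1 ≤ (d + e) 2 ∨ α + μ + 1 ≤ (d + e) 0 + (d + e) 2) := by
  intro d e h
  simp only [Finsupp.add_apply]
  omega

theorem above_of_mul {α μ : ℕ} {f W : MvPowerSeries (Fin 3) ℂ} (hW : constantCoeff W ≠ 0)
    (h : Above α μ (f * W)) : Above α μ f := by
  have h1 := Supp.mul_right h above_upward W⁻¹
  rwa [mul_assoc, MvPowerSeries.mul_inv_cancel W hW, mul_one] at h1

theorem IsComplexEquation.above (hC : IsComplexEquation ρ H Q) (h : IsRealEquation ρ H φ)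
    (hρ : IsFormalHypersurface ρ) {α μ : ℕ} (hφ : Above α μ φ) : Above α μ (Q - X 2) := by
  obtain ⟨U, hU⟩ := hC.exists_unit h hρ
  refine above_of_mul (W := C (1 / (2 * Complex.I)) - X 0 * U) (by simp) ?_
  have : (Q - X 2) * (C (1 / (2 * Complex.I)) - X 0 * U) = φ := by linear_combination hU
  rwa [this]

/-- The extra factor `z` in `exists_unit` pushes the correction strictly above `(α, μ)`. -/
theorem IsComplexEquation.coeff_lead (hC : IsComplexEquation ρ H Q) (h : IsRealEquation ρ H φ)
    (hρ : IsFormalHypersurface ρ) {α μ : ℕ} (hφ : Above α μ φ) (j : ℕ) :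
    coeff (mon ![α, j, μ]) (Q - X 2) = 2 * Complex.I * coeff (mon ![α, j, μ]) φ := by
  have hP := hC.above h hρ hφ
  obtain ⟨U, hU⟩ := hC.exists_unit h hρ
  have h1 : Sup (fun a _ c => μ + 1 ≤ c ∨ α + μ + 1 ≤ a + c) (X 0 * U * (Q - X 2)) := by
    refine Sup.mul₃ (sup_X_zero (S := fun a _ _ => a = 1) rfl)
      (Sup.trivial U) hP ?_
    intros; omega
  have h2 := congrArg (coeff (mon ![α, j, μ])) hU
  rw [map_add, h1.coeff_eq_zero (by simp [mon_apply]), add_zero, coeff_C_mul] at h2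
  rw [← h2]
  field_simp

end RealToComplex

/-! ### Specialisations of the transformation identity -/

section Transform

variable {T : Fin 2 → MvPowerSeries (Fin 2) ℂ} {P P' : MvPowerSeries (Fin 3) ℂ}

theorem IsTransform.vanish (h : IsTransform T P P') {m : ℕ} {x y z t : MvPowerSeries (Fin m) ℂ}
    (hv : Vanish ![x, y]) (hv' : Vanish ![z, t]) :
    Vanish ![subst ![x, y] (T 0), subst ![z, t] (conj (T 0)), subst ![z, t] (conj (T 1))] := by
  simp [constantCoeff_subst_vanish hv, constantCoeff_subst_vanish hv', h.bihol.1 0, h.bihol.1 1]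

theorem IsTransform.constantCoeff_P' (h : IsTransform T P P') : constantCoeff P' = 0 :=
  (ord_two_iff.1 (ord_two_of_supp h.supp')).1

theorem IsTransform.vanish_Q (h : IsTransform T P P') : Vanish ![X 0, X 2 + P'] := by
  simp [h.constantCoeff_P']

/-- The case `χ = 0`, where `P'` drops out. The next lemmas take `z = 0`, then `z = χ = 0`.
Combining them with the full identity eliminates `Ḡ(χ, τ)`. -/
theorem IsTransform.eqn_mid (h : IsTransform T P P') :
    subst (![X 0, X 2] : Fin 2 → MvPowerSeries (Fin 3) ℂ) (T 1) = subst ![0, X 2] (conj (T 1)) +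
      subst ![subst ![X 0, X 2] (T 0), subst ![0, X 2] (conj (T 0)),
        subst ![0, X 2] (conj (T 1))] P := by
  have hs : Vanish (![X 0, 0, X 2] : Fin 3 → MvPowerSeries (Fin 3) ℂ) := by simp
  have h1 := congrArg (subst (![X 0, 0, X 2] : Fin 3 → MvPowerSeries (Fin 3) ℂ)) h.eqn
  rw [subst_vec₂ hs h.vanish_Q, subst_add hs.hasSubst, subst_add hs.hasSubst,
    subst_vec₂ hs (by simp), subst_vec₃ hs (h.vanish h.vanish_Q (by simp)),
    subst_vec₂ hs h.vanish_Q, subst_vec₂ hs (by simp), subst_vec₂ hs (by simp),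
    subst_add hs.hasSubst,
    subst_eq_zero_of_supp_mid (h.supp'.mono fun d hd => hd.2) (by simp), add_zero] at h1
  simpa [subst_X hs.hasSubst] using h1

theorem IsTransform.eqn_left (h : IsTransform T P P') :
    subst (![0, X 2] : Fin 2 → MvPowerSeries (Fin 3) ℂ) (T 1) = subst ![X 1, X 2] (conj (T 1)) +
      subst ![subst ![0, X 2] (T 0), subst ![X 1, X 2] (conj (T 0)),
        subst ![X 1, X 2] (conj (T 1))] P := by
  have hs : Vanish (![0, X 1, X 2] : Fin 3 → MvPowerSeries (Fin 3) ℂ) := by simp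
  have h1 := congrArg (subst (![0, X 1, X 2] : Fin 3 → MvPowerSeries (Fin 3) ℂ)) h.eqn
  rw [subst_vec₂ hs h.vanish_Q, subst_add hs.hasSubst, subst_add hs.hasSubst,
    subst_vec₂ hs (by simp), subst_vec₃ hs (h.vanish h.vanish_Q (by simp)),
    subst_vec₂ hs h.vanish_Q, subst_vec₂ hs (by simp), subst_vec₂ hs (by simp),
    subst_add hs.hasSubst,
    subst_eq_zero_of_supp_left (h.supp'.mono fun d hd => hd.1) (by simp), add_zero] at h1
  simpa [subst_X hs.hasSubst] using h1

theorem IsTransform.eqn_axis (h : IsTransform T P P') :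
    subst (![0, X 2] : Fin 2 → MvPowerSeries (Fin 3) ℂ) (T 1) = subst ![0, X 2] (conj (T 1)) +
      subst ![subst ![0, X 2] (T 0), subst ![0, X 2] (conj (T 0)),
        subst ![0, X 2] (conj (T 1))] P := by
  have hs : Vanish (![0, 0, X 2] : Fin 3 → MvPowerSeries (Fin 3) ℂ) := by simp
  have h1 := congrArg (subst (![0, 0, X 2] : Fin 3 → MvPowerSeries (Fin 3) ℂ)) h.eqn_mid
  rw [subst_vec₂ hs (by simp), subst_add hs.hasSubst,
    subst_vec₂ hs (by simp), subst_vec₃ hs (h.vanish (by simp) (by simp)),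
    subst_vec₂ hs (by simp), subst_vec₂ hs (by simp), subst_vec₂ hs (by simp)] at h1
  simpa [subst_X hs.hasSubst, subst_zero_right hs] using h1

/-- The case `χ = 0` with `τ` replaced by `τ + P'`: its left side is that of the full identity, so
`G(z, τ + P')` can be eliminated. -/
theorem IsTransform.eqn_graph (h : IsTransform T P P') :
    subst ![X 0, X 2 + P'] (T 1) = subst ![0, X 2 + P'] (conj (T 1)) +
      subst ![subst ![X 0, X 2 + P'] (T 0), subst ![0, X 2 + P'] (conj (T 0)),
        subst ![0, X 2 + P'] (conj (T 1))] P := by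
  have hs : Vanish (![X 0, X 1, X 2 + P'] : Fin 3 → MvPowerSeries (Fin 3) ℂ) := by
    simp [h.constantCoeff_P']
  have h1 := congrArg (subst (![X 0, X 1, X 2 + P'] : Fin 3 → MvPowerSeries (Fin 3) ℂ)) h.eqn_mid
  rw [subst_vec₂ hs (by simp), subst_add hs.hasSubst,
    subst_vec₂ hs (by simp), subst_vec₃ hs (h.vanish (by simp) (by simp)),
    subst_vec₂ hs (by simp), subst_vec₂ hs (by simp), subst_vec₂ hs (by simp)] at h1
  simpa [subst_X hs.hasSubst, subst_zero_right hs] using h1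

end Transform

end
end FormalHypersurface


namespace FormalHypersurface
open MvPowerSeries

noncomputable section

/-! ### Supports of the components of a coordinate change -/

section Components

variable {T : Fin 2 → MvPowerSeries (Fin 2) ℂ} {P P' : MvPowerSeries (Fin 3) ℂ}
  {f : MvPowerSeries (Fin 3) ℂ} {F : MvPowerSeries (Fin 2) ℂ}

theorem Sup.pow_last (hf : Sup (fun _ _ c => 1 ≤ c) f) (n : ℕ) :
    Sup (fun _ _ c => n ≤ c) (f ^ n) :=
  Sup.pow hf (fun n _ _ c => n ≤ c) (by simp) (by intros; omega) n

theorem Sup.pow_outer (hf : Sup (fun a _ c => 1 ≤ a + c) f) (n : ℕ) :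
    Sup (fun a _ c => n ≤ a + c) (f ^ n) :=
  Sup.pow hf (fun n a _ c => n ≤ a + c) (by simp) (by intros; omega) n

theorem Sup.pow_mid (hf : Sup (fun _ b _ => 1 ≤ b) f) (n : ℕ) :
    Sup (fun _ b _ => n ≤ b) (f ^ n) :=
  Sup.pow hf (fun n _ b _ => n ≤ b) (by simp) (by intros; omega) n

theorem supp_of_constantCoeff_eq_zero (h : constantCoeff F = 0) :
    Supp (fun d => 1 ≤ d 0 + d 1) F := by
  refine (ord_one_iff.2 h).mono fun d hd => ?_
  rw [degree_eq_sum', Fin.sum_univ_two] at hd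
  exact hd

theorem constantCoeff_eq_zero_of_conj (h : constantCoeff F = 0) :
    constantCoeff (conj F) = 0 := by simp [h]

theorem IsTransform.supp_P' (h : IsTransform T P P') : Sup (fun a b _ => 1 ≤ a ∧ 1 ≤ b) P' :=
  h.supp'

theorem IsTransform.sup_graph (h : IsTransform T P P') :
    Sup (fun a _ c => 1 ≤ a + c) (X 2 + P') :=
  Sup.add (sup_X_two (S := fun a _ c => 1 ≤ a + c) (by simp)) (Sup.imp h.supp_P' (by intros; omega))

theorem IsTransform.sup_on_graph (h : IsTransform T P P') (hF : constantCoeff F = 0) :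
    Sup (fun a _ c => 1 ≤ a + c) (subst ![X 0, X 2 + P'] F) := by
  refine Sup.subst₂ h.vanish_Q (R := fun i j => 1 ≤ i + j) (supp_of_constantCoeff_eq_zero hF) fun i j hij => ?_
  exact Sup.mul (sup_X_zero_pow (S := fun a _ _ => i ≤ a) i le_rfl) (h.sup_graph.pow_outer j)
    (by intros; omega)

theorem sup_outer (hF : constantCoeff F = 0) :
    Sup (fun a _ c => 1 ≤ a + c) (subst ![X 0, X 2] F) := by
  refine Sup.subst₂ (by simp) (R := fun i j => 1 ≤ i + j) (supp_of_constantCoeff_eq_zero hF) fun i j hij => ?_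
  exact Sup.mul (sup_X_zero_pow (S := fun a _ _ => i ≤ a) i le_rfl)
    (sup_X_two_pow (S := fun _ _ c => j ≤ c) j le_rfl) (by intros; omega)

theorem sup_axis (hF : constantCoeff F = 0) :
    Sup (fun _ _ c => 1 ≤ c) (subst ![0, X 2] F) := by
  refine Sup.subst_zero₂ (by simp) (R := fun i j => 1 ≤ i + j) (supp_of_constantCoeff_eq_zero hF) fun j hj => ?_
  exact sup_X_two_pow j (by omega)

theorem supp_sub_linear (hF : constantCoeff F = 0) :
    Supp (fun d => 1 ≤ d 0 ∨ 2 ≤ d 1) (F - C (coeff (mon ![0, 1]) F) * X 1) := by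
  intro d hd
  by_contra hc
  push Not at hc
  apply hd
  have hd0 : d 0 = 0 := by omega
  have hd1 : d 1 = 0 ∨ d 1 = 1 := by omega
  rw [eq_mon₂ d, hd0]
  rcases hd1 with hd1 | hd1
  · rw [hd1, map_sub, coeff_C_mul, X, ← single_eq_mon₂_one, coeff_monomial, if_neg, mul_zero, sub_zero]
    · have : (mon ![0, 0] : Fin 2 →₀ ℕ) = 0 := by ext l; fin_cases l <;> simp [mon_apply]
      rw [this, coeff_zero_eq_constantCoeff_apply, hF]
    · intro h
      have := DFunLike.congr_fun h 1
      simp [mon_apply] at this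
  · rw [hd1, map_sub, coeff_C_mul, ← single_eq_mon₂_one, coeff_index_single_self_X, mul_one, sub_self]

theorem supp_sub_linear' (hF : constantCoeff F = 0) :
    Supp (fun d => 1 ≤ d 1 ∨ 2 ≤ d 0) (F - C (coeff (mon ![1, 0]) F) * X 0) := by
  intro d hd
  by_contra hc
  push Not at hc
  apply hd
  have hd0 : d 1 = 0 := by omega
  have hd1 : d 0 = 0 ∨ d 0 = 1 := by omega
  rw [eq_mon₂ d, hd0]
  rcases hd1 with hd1 | hd1
  · rw [hd1, map_sub, coeff_C_mul, X, ← single_eq_mon₂_zero, coeff_monomial, if_neg, mul_zero, sub_zero]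
    · have : (mon ![0, 0] : Fin 2 →₀ ℕ) = 0 := by ext l; fin_cases l <;> simp [mon_apply]
      rw [this, coeff_zero_eq_constantCoeff_apply, hF]
    · intro h
      have := DFunLike.congr_fun h 0
      simp [mon_apply] at this
  · rw [hd1, map_sub, coeff_C_mul, ← single_eq_mon₂_zero, coeff_index_single_self_X, mul_one, sub_self]

theorem subst_axis_sub_linear (hF : constantCoeff F = 0) :
    Sup (fun _ _ c => 2 ≤ c)
      (subst ![0, X 2] F - C (coeff (mon ![0, 1]) F) * X 2) := by
  have h1 : subst ![0, X 2] F - C (coeff (mon ![0, 1]) F) * X 2 =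
      subst (![0, X 2] : Fin 2 → MvPowerSeries (Fin 3) ℂ) (F - C (coeff (mon ![0, 1]) F) * X 1) := by
    have hv : Vanish (![0, X 2] : Fin 2 → MvPowerSeries (Fin 3) ℂ) := by simp
    rw [subst_sub hv.hasSubst, subst_mul hv.hasSubst, subst_C, subst_X hv.hasSubst]
    simp
  rw [h1]
  refine Sup.subst_zero₂ (by simp) (R := fun i j => 1 ≤ i ∨ 2 ≤ j) (supp_sub_linear hF) fun j hj => ?_
  exact sup_X_two_pow j (by omega)

end Components

end
end FormalHypersurface


namespace FormalHypersurface
open MvPowerSeries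

noncomputable section

/-! ### The leading part at an invariant pair -/

section LeadingPart

/-- The exponents strictly above `(α, μ)`. -/
abbrev StrictlyAbove (α μ : ℕ) (f : MvPowerSeries (Fin 3) ℂ) : Prop :=
  Sup (fun a _ c => μ + 1 ≤ c ∨ α + μ + 1 ≤ a + c) f

variable {α μ : ℕ} {P : MvPowerSeries (Fin 3) ℂ}

theorem coeff_cf (j : ℕ) : coeff (Finsupp.single () j) (cf P α μ) = coeff (mon ![α, j, μ]) P := by
  change PowerSeries.coeff j (cf P α μ) = _
  rw [cf, PowerSeries.coeff_mk]

theorem coeff_subst_X_one (p : MvPowerSeries Unit ℂ) (j : ℕ) :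
    coeff (mon ![0, j, 0]) (subst (fun _ : Unit => (X 1 : MvPowerSeries (Fin 3) ℂ)) p) =
      coeff (Finsupp.single () j) p := by
  let e : Unit ↪ Fin 3 := ⟨fun _ => 1, fun _ _ _ => rfl⟩
  have h : subst (fun _ : Unit => (X 1 : MvPowerSeries (Fin 3) ℂ)) p = rename e p := by
    rw [rename_eq_subst]; rfl
  have h3 : Finsupp.embDomain e (Finsupp.single () j) = mon ![0, j, 0] := by
    rw [Finsupp.embDomain_single]
    have he : e () = 1 := rfl
    rw [he]
    ext i; fin_cases i <;> simp [mon_apply]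
  rw [h, ← h3, coeff_embDomain_rename]

theorem Sup.subst_unit {S : ℕ → Prop} {U : ℕ → ℕ → ℕ → Prop} {p : MvPowerSeries Unit ℂ}
    {A : MvPowerSeries (Fin 3) ℂ} (hA : constantCoeff A = 0)
    (hp : Supp (fun d => S (d ())) p) (h : ∀ j, S j → Sup U (A ^ j)) :
    Sup U (subst (fun _ : Unit => A) p) := by
  have hv : Vanish (fun _ : Unit => A) := fun _ => hA
  refine Supp.subst hv.hasSubst fun d hd => ?_
  rw [finsupp_prod_eq, Fintype.prod_unique]
  exact h _ (hp d hd)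

theorem vanish_unit {m : ℕ} {A : MvPowerSeries (Fin m) ℂ} (hA : constantCoeff A = 0) :
    Vanish (fun _ : Unit => A) := fun _ => hA

theorem sup_subst_X_one (p : MvPowerSeries Unit ℂ) :
    Sup (fun a _ c => a = 0 ∧ c = 0)
      (subst (fun _ : Unit => (X 1 : MvPowerSeries (Fin 3) ℂ)) p) :=
  Sup.subst_unit (by simp) (S := fun _ => True) (fun _ _ => True.intro) fun j _ =>
    sup_X_one_pow j (by simp)

theorem Above.sub_lead (hP : Above α μ P) : StrictlyAbove α μ
    (P - X 0 ^ α * X 2 ^ μ * subst (fun _ : Unit => (X 1 : MvPowerSeries (Fin 3) ℂ)) (cf P α μ)) := by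
  intro d hd
  by_contra hc
  apply hd
  have hR : Sup (fun a _ c => a = α ∧ c = μ) (X 0 ^ α * X 2 ^ μ *
      subst (fun _ : Unit => (X 1 : MvPowerSeries (Fin 3) ℂ)) (cf P α μ)) :=
    Sup.mul₃ (sup_X_zero_pow (S := fun a _ c => a = α ∧ c = 0) α (by simp))
      (sup_X_two_pow (S := fun a _ c => a = 0 ∧ c = μ) μ (by simp)) (sup_subst_X_one _)
      (by intros; omega)
  by_cases h : d 0 = α ∧ d 2 = μ
  · have h2 := coeff_mon_X_pow_mul α 0 μ 0 (d 1) 0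
      (subst (fun _ : Unit => (X 1 : MvPowerSeries (Fin 3) ℂ)) (cf P α μ))
    rw [pow_zero, mul_one, coeff_subst_X_one, coeff_cf, zero_add, add_zero, add_zero] at h2
    rw [eq_mon₃ d, h.1, h.2, map_sub, h2, sub_self]
  · rw [map_sub, hP.coeff_eq_zero (by omega), hR.coeff_eq_zero h, sub_zero]

theorem subst_lead {A B D : MvPowerSeries (Fin 3) ℂ} (hv : Vanish ![A, B, D]) (α μ : ℕ)
    (p : MvPowerSeries Unit ℂ) :
    subst ![A, B, D] (X 0 ^ α * X 2 ^ μ * subst (fun _ : Unit => (X 1 : MvPowerSeries (Fin 3) ℂ)) p) =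
      A ^ α * D ^ μ * subst (fun _ : Unit => B) p := by
  rw [subst_mul hv.hasSubst, subst_mul hv.hasSubst, subst_pow hv.hasSubst, subst_pow hv.hasSubst,
    subst_X hv.hasSubst, subst_X hv.hasSubst, subst_subst (vanish_unit (by simp)) hv]
  simp [subst_X hv.hasSubst]

/-- Only the corner `z^α τ^μ P_{α,μ}(χ)` survives modulo strictly higher exponents, and there each
argument may be replaced by its own leading part: `a₀ z`, `r τ` and `ψ`. -/
theorem Above.subst_sub_lead {A B D ψ : MvPowerSeries (Fin 3) ℂ} {a₀ r : ℂ} (hP : Above α μ P)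
    (hv : Vanish ![A, B, D]) (hA : Sup (fun a _ c => 1 ≤ a + c) A)
    (hD : Sup (fun _ _ c => 1 ≤ c) D) (hψ : constantCoeff ψ = 0)
    (hA' : Sup (fun a _ c => 1 ≤ c ∨ 2 ≤ a + c) (A - C a₀ * X 0))
    (hD' : Sup (fun _ _ c => 2 ≤ c) (D - C r * X 2))
    (hB' : Sup (fun _ _ c => 1 ≤ c) (B - ψ)) :
    StrictlyAbove α μ (subst ![A, B, D] P -
      (C a₀ * X 0) ^ α * (C r * X 2) ^ μ * subst (fun _ : Unit => ψ) (cf P α μ)) := by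
  have e1 : StrictlyAbove α μ (subst ![A, B, D] P - A ^ α * D ^ μ * subst (fun _ : Unit => B)
      (cf P α μ)) := by
    rw [← subst_lead hv, ← subst_sub hv.hasSubst]
    refine Sup.subst₃ hv hP.sub_lead fun i j k hi => ?_
    exact Sup.mul₃ (hA.pow_outer i) (Sup.trivial _) (hD.pow_last k) (by intros; omega)
  have hX : Sup (fun a _ c => 1 ≤ a + c) (C a₀ * X 0) :=
    (sup_X_zero (S := fun a _ c => 1 ≤ a + c) (by simp)).C_mul a₀
  have hX2 : Sup (fun _ _ c => 1 ≤ c) (C r * X 2) :=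
    (sup_X_two (S := fun _ _ c => 1 ≤ c) (by simp)).C_mul r
  have e2 : Sup (fun a _ c => α + 1 ≤ a + c ∨ (1 ≤ c ∧ α ≤ a + c)) (A ^ α - (C a₀ * X 0) ^ α) := by
    refine Sup.pow_sub hA' (S' := fun n a _ c => n ≤ a + c) (fun i j => ?_) α (by intros; omega)
    exact Sup.mul (hA.pow_outer i) (hX.pow_outer j) (by intros; omega)
  have e3 : Sup (fun _ _ c => μ + 1 ≤ c) (D ^ μ - (C r * X 2) ^ μ) := by
    refine Sup.pow_sub hD' (S' := fun n _ _ c => n ≤ c) (fun i j => ?_) μ (by intros; omega)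
    exact Sup.mul (hD.pow_last i) (hX2.pow_last j) (by intros; omega)
  have hB0 : constantCoeff B = 0 := (vanish₃.1 hv).2.1
  have e4 : Sup (fun _ _ c => 1 ≤ c) (subst (fun _ : Unit => B) (cf P α μ) -
      subst (fun _ : Unit => ψ) (cf P α μ)) :=
    Supp.subst_sub_of_ideal (vanish_unit hB0).hasSubst (vanish_unit hψ).hasSubst
      (by intro d e hd; rw [Finsupp.add_apply]; omega) (fun _ => hB') _
  have e5 : subst ![A, B, D] P -
      (C a₀ * X 0) ^ α * (C r * X 2) ^ μ * subst (fun _ : Unit => ψ) (cf P α μ) =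
      (subst ![A, B, D] P - A ^ α * D ^ μ * subst (fun _ : Unit => B) (cf P α μ)) +
      ((A ^ α - (C a₀ * X 0) ^ α) * D ^ μ * subst (fun _ : Unit => B) (cf P α μ) +
      (C a₀ * X 0) ^ α * (D ^ μ - (C r * X 2) ^ μ) * subst (fun _ : Unit => B) (cf P α μ) +
      (C a₀ * X 0) ^ α * (C r * X 2) ^ μ * (subst (fun _ : Unit => B) (cf P α μ) -
        subst (fun _ : Unit => ψ) (cf P α μ))) := by ring
  rw [e5]
  refine Sup.add e1 (Sup.add (Sup.add ?_ ?_) ?_)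
  · exact Sup.mul₃ e2 (hD.pow_last μ) (Sup.trivial _) (by intros; omega)
  · exact Sup.mul₃ (hX.pow_outer α) e3 (Sup.trivial _) (by intros; omega)
  · exact Sup.mul₃ (hX.pow_outer α) (hX2.pow_last μ) e4 (by intros; omega)

end LeadingPart

/-! ### Invariance of the corner and of its leading coefficient -/

section Invariance

variable {T : Fin 2 → MvPowerSeries (Fin 2) ℂ} {P P' : MvPowerSeries (Fin 3) ℂ} {α μ : ℕ}

/-- In the case `z = 0` both `G(0, τ)` and the `P`-term are divisible by `τ`, the latter because
each of its monomials contains the factor `F(0, τ)`. -/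
theorem IsTransform.sup_conj (h : IsTransform T P P') :
    Sup (fun _ _ c => 1 ≤ c) (subst ![X 1, X 2] (conj (T 1))) := by
  have h1 : subst ![X 1, X 2] (conj (T 1)) = subst (![0, X 2] : Fin 2 → MvPowerSeries (Fin 3) ℂ) (T 1) -
      subst ![subst ![0, X 2] (T 0), subst ![X 1, X 2] (conj (T 0)),
        subst ![X 1, X 2] (conj (T 1))] P := by rw [h.eqn_left]; ring
  rw [h1]
  refine Sup.sub (sup_axis (h.bihol.1 1)) (Sup.subst₃ (h.vanish (by simp) (by simp))
    (S := fun a _ _ => 1 ≤ a) (Supp.mono h.supp fun d hd => hd.1) fun i j k hi => ?_)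
  exact Sup.mul₃ ((sup_axis (h.bihol.1 0)).pow_last i) (Sup.trivial _) (Sup.trivial _)
    (by intros; omega)

/-- As `α + μ ≥ 2` and `P` is divisible by `z`, each monomial of `P` has degree at least two in `z`
and `τ`; both corresponding arguments are divisible by the variable `τ`. -/
theorem IsTransform.sup_conj_sub_linear (h : IsTransform T P P') (hP : Above α μ P)
    (hαμ : 2 ≤ α + μ) :
    Sup (fun _ _ c => 2 ≤ c)
      (subst ![X 1, X 2] (conj (T 1)) - C (coeff (mon ![0, 1]) (T 1)) * X 2) := by
  have h1 : subst ![X 1, X 2] (conj (T 1)) - C (coeff (mon ![0, 1]) (T 1)) * X 2 =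
      (subst (![0, X 2] : Fin 2 → MvPowerSeries (Fin 3) ℂ) (T 1) -
        C (coeff (mon ![0, 1]) (T 1)) * X 2) -
      subst ![subst ![0, X 2] (T 0), subst ![X 1, X 2] (conj (T 0)),
        subst ![X 1, X 2] (conj (T 1))] P := by rw [h.eqn_left]; ring
  rw [h1]
  refine Sup.sub (subst_axis_sub_linear (h.bihol.1 1)) (Sup.subst₃ (h.vanish (by simp) (by simp))
    (S := fun a _ c => 2 ≤ a + c) ?_ fun i j k hi => ?_)
  · refine (h.supp.and hP).mono fun d hd => ?_
    omega
  · exact Sup.mul₃ ((sup_axis (h.bihol.1 0)).pow_last i) (Sup.trivial _) (h.sup_conj.pow_last k)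
      (by intros; omega)

theorem IsTransform.exists_unit (h : IsTransform T P P') :
    ∃ U : MvPowerSeries (Fin 3) ℂ,
      subst ![X 0, X 2 + P'] (T 1) - subst ![X 0, X 2] (T 1) = P' * U ∧
      constantCoeff U = coeff (mon ![0, 1]) (T 1) := by
  obtain ⟨U, hU, hU0⟩ := exists_subst_sub_eq_mul h.vanish_Q
    (b := ![X 0, X 2]) (by simp) 1 (by intro j hj; fin_cases j <;> first | rfl | exact absurd rfl hj)
    (T 1)
  refine ⟨U, ?_, by rw [hU0, single_eq_mon₂_one]⟩
  rw [hU]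
  simp

/-- The alternating sum of the four identities leaves only values of `P` on the right. -/
theorem IsTransform.eqn_diff (h : IsTransform T P P') :
    subst ![X 0, X 2 + P'] (T 1) - subst ![X 0, X 2] (T 1) =
      subst ![subst ![X 0, X 2 + P'] (T 0), subst ![X 1, X 2] (conj (T 0)),
          subst ![X 1, X 2] (conj (T 1))] P -
        subst ![subst ![0, X 2] (T 0), subst ![X 1, X 2] (conj (T 0)),
          subst ![X 1, X 2] (conj (T 1))] P -
        subst ![subst ![X 0, X 2] (T 0), subst ![0, X 2] (conj (T 0)),
          subst ![0, X 2] (conj (T 1))] P +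
        subst ![subst ![0, X 2] (T 0), subst ![0, X 2] (conj (T 0)),
          subst ![0, X 2] (conj (T 1))] P := by
  linear_combination h.eqn - h.eqn_left - h.eqn_mid + h.eqn_axis

/-- Left side of `eqn_diff`: `P'` times a unit. Right side: `P` at arguments that respect the
weights of `z` and `τ`. -/
theorem IsTransform.above (h : IsTransform T P P') (hP : Above α μ P) : Above α μ P' := by
  obtain ⟨U, hU, hU0⟩ := h.exists_unit
  refine above_of_mul (W := U) (by rw [hU0]; exact h.linear.2.2.2) ?_
  rw [← hU, h.eqn_diff]
  have key : ∀ A B D : MvPowerSeries (Fin 3) ℂ, Vanish ![A, B, D] →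
      Sup (fun a _ c => 1 ≤ a + c) A → Sup (fun _ _ c => 1 ≤ c) D →
      Above α μ (subst ![A, B, D] P) := by
    intro A B D hv hA hD
    refine Sup.subst₃ hv hP fun i j k hi => ?_
    exact Sup.mul₃ (hA.pow_outer i) (Sup.trivial _) (hD.pow_last k) (by intros; omega)
  have hz := sup_axis (h.bihol.1 0)
  have hgb := sup_axis (constantCoeff_eq_zero_of_conj (h.bihol.1 1))
  refine Sup.add (Sup.sub (Sup.sub ?_ ?_) ?_) ?_
  · exact key _ _ _ (h.vanish h.vanish_Q (by simp)) (h.sup_on_graph (h.bihol.1 0)) h.sup_conj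
  · exact key _ _ _ (h.vanish (by simp) (by simp)) (hz.imp (by intros; omega)) h.sup_conj
  · exact key _ _ _ (h.vanish (by simp) (by simp)) (sup_outer (h.bihol.1 0)) hgb
  · exact key _ _ _ (h.vanish (by simp) (by simp)) (hz.imp (by intros; omega)) hgb

theorem IsTransform.diff_sub_linear (h : IsTransform T P P') (hP : Above α μ P) :
    StrictlyAbove α μ (subst ![X 0, X 2 + P'] (T 1) - subst ![X 0, X 2] (T 1) -
      C (coeff (mon ![0, 1]) (T 1)) * P') := by
  set r := coeff (mon ![0, 1]) (T 1) with hr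
  have hw : Vanish (![X 0, X 2] : Fin 2 → MvPowerSeries (Fin 3) ℂ) := by simp
  have e : subst ![X 0, X 2 + P'] (T 1) - subst ![X 0, X 2] (T 1) - C r * P' =
      subst ![X 0, X 2 + P'] (T 1 - C r * X 1) - subst ![X 0, X 2] (T 1 - C r * X 1) := by
    rw [subst_sub h.vanish_Q.hasSubst, subst_sub hw.hasSubst, subst_mul h.vanish_Q.hasSubst,
      subst_mul hw.hasSubst, subst_C, subst_C, subst_X h.vanish_Q.hasSubst, subst_X hw.hasSubst]
    simp
    ring
  rw [e]
  have h2 : Supp (fun d => 1 ≤ d 0 ∨ 2 ≤ d 1) (T 1 - C r * X 1) :=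
    supp_sub_linear (h.bihol.1 1)
  refine Sup.subst_sub₂ h.vanish_Q hw (R := fun i j => 1 ≤ i ∨ 2 ≤ j) h2 fun i j hij => ?_
  rw [← mul_sub]
  refine Sup.mul (T := fun a _ c => 1 ≤ j ∧ (μ + 1 ≤ c ∨ α + μ + j ≤ a + c + 1))
    (sup_X_zero_pow (S := fun a _ _ => i ≤ a) i le_rfl)
    (Sup.pow_sub (S := fun a _ c => μ + 1 ≤ c ∨ α + μ ≤ a + c)
      (S' := fun n a _ c => n ≤ a + c) ?_ (fun i j => ?_) j ?_) ?_
  · simpa using (h.above hP).imp (by intros; omega)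
  · exact Sup.mul (h.sup_graph.pow_outer i) (sup_X_two_pow (S := fun _ _ c => j ≤ c) j le_rfl)
      (by intros; omega)
  · intros; omega
  · intros; omega

theorem IsTransform.sup_graph_sub_linear (h : IsTransform T P P') (hP : Above α μ P)
    (hαμ : 2 ≤ α + μ) : Sup (fun a _ c => 1 ≤ c ∨ 2 ≤ a + c)
      (subst ![X 0, X 2 + P'] (T 0) - C (coeff (mon ![1, 0]) (T 0)) * X 0) := by
  set a₀ := coeff (mon ![1, 0]) (T 0) with ha₀
  have e : subst ![X 0, X 2 + P'] (T 0) - C a₀ * X 0 =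
      subst ![X 0, X 2 + P'] (T 0 - C a₀ * X 0) := by
    rw [subst_sub h.vanish_Q.hasSubst, subst_mul h.vanish_Q.hasSubst, subst_C,
      subst_X h.vanish_Q.hasSubst]
    simp
  rw [e]
  have hQ : Sup (fun a _ c => 1 ≤ c ∨ 2 ≤ a + c) (X 2 + P') := by
    refine Sup.add (sup_X_two (by simp)) ((h.above hP).and h.supp' |>.mono fun d hd => ?_)
    omega
  refine Sup.subst₂ h.vanish_Q (R := fun i j => 1 ≤ j ∨ 2 ≤ i) (supp_sub_linear' (h.bihol.1 0))
    fun i j hij => ?_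
  refine Sup.mul (sup_X_zero_pow (S := fun a _ _ => i ≤ a) i le_rfl)
    (hQ.pow (fun j a _ c => 1 ≤ j → (1 ≤ c ∨ 2 ≤ a + c)) (by simp) ?_ j) ?_ <;> intros <;> omega

/-- Transformation of the leading coefficient. -/
theorem IsTransform.lead (h : IsTransform T P P') (hP : Above α μ P) (hα : 1 ≤ α)
    (hαμ : 2 ≤ α + μ) :
    StrictlyAbove α μ (C (coeff (mon ![0, 1]) (T 1)) * P' -
      (C (coeff (mon ![1, 0]) (T 0)) * X 0) ^ α * (C (coeff (mon ![0, 1]) (T 1)) * X 2) ^ μ *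
        subst (fun _ : Unit => subst ![X 1, 0] (conj (T 0))) (cf P α μ)) := by
  set r := coeff (mon ![0, 1]) (T 1) with hr
  set a₀ := coeff (mon ![1, 0]) (T 0) with ha₀
  have hP' := h.above hP
  have hz := sup_axis (h.bihol.1 0)
  have hgb := sup_axis (constantCoeff_eq_zero_of_conj (h.bihol.1 1))
  have hfb := sup_axis (constantCoeff_eq_zero_of_conj (h.bihol.1 0))
  have hF1 := h.sup_on_graph (h.bihol.1 0)
  have e1 := h.diff_sub_linear hP
  -- The terms `e2`, `e3`, `e4` gain a power of `τ` over the corner: from `F(0, τ)` because `α ≥ 1`,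
  -- and in `e4` from `F̄(0, τ)` because `P` is divisible by `χ`.
  have e2 : StrictlyAbove α μ (subst ![subst ![0, X 2] (T 0), subst ![X 1, X 2] (conj (T 0)),
      subst ![X 1, X 2] (conj (T 1))] P) :=
    Sup.subst₃ (h.vanish (by simp) (by simp)) hP fun i j k hi =>
      Sup.mul₃ (hz.pow_last i) (Sup.trivial _) (h.sup_conj.pow_last k) (by intros; omega)
  have e3 : StrictlyAbove α μ (subst ![subst ![0, X 2] (T 0), subst ![0, X 2] (conj (T 0)),
      subst ![0, X 2] (conj (T 1))] P) :=
    Sup.subst₃ (h.vanish (by simp) (by simp)) hP fun i j k hi =>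
      Sup.mul₃ (hz.pow_last i) (Sup.trivial _) (hgb.pow_last k) (by intros; omega)
  have e4 : StrictlyAbove α μ (subst ![subst ![X 0, X 2] (T 0), subst ![0, X 2] (conj (T 0)),
      subst ![0, X 2] (conj (T 1))] P) :=
    Sup.subst₃ (S := fun a b c => ((a = α ∧ c = μ) ∨ μ + 1 ≤ c ∨ α + μ + 1 ≤ a + c) ∧ 1 ≤ b)
      (h.vanish (by simp) (by simp))
      ((hP.and h.supp).mono fun d hd => ⟨hd.1, hd.2.2⟩) fun i j k hi =>
      Sup.mul₃ ((sup_outer (h.bihol.1 0)).pow_outer i) (hfb.pow_last j) (hgb.pow_last k)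
        (by intros; omega)
  have hv := h.vanish h.vanish_Q (z := X 1) (t := X 2) (by simp)
  have e5 := hP.subst_sub_lead hv hF1 h.sup_conj (ψ := subst ![X 1, 0] (conj (T 0)))
    (by simp [constantCoeff_subst_vanish, h.bihol.1 0]) (h.sup_graph_sub_linear hP hαμ)
    (h.sup_conj_sub_linear hP hαμ) (by
      refine Supp.subst_sub_of_ideal (T := fun d => 1 ≤ d 2) (Vanish.hasSubst (by simp))
        (Vanish.hasSubst (by simp)) (by intro d e hd; rw [Finsupp.add_apply]; omega) ?_ _
      intro i
      fin_cases i
      · simpa using Supp.zero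
      · simpa using sup_X_two (S := fun _ _ c => 1 ≤ c) (by simp))
  have e6 := h.eqn_diff
  rw [← hr] at e5 e1
  rw [← ha₀] at e5
  have e7 := ((((e5.sub e1).sub e2).sub e4).add e3)
  convert e7 using 1
  linear_combination e6

end Invariance

end
end FormalHypersurface


namespace FormalHypersurface
open MvPowerSeries

noncomputable section

/-! ### Second order expansion of powers -/

section SecondOrder

theorem exists_pow_expansion {R : Type*} [CommRing R] (A B : R) (n : ℕ) :
    ∃ s, A ^ n = B ^ n + n * B ^ (n - 1) * (A - B) + s * (A - B) ^ 2 := by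
  obtain ⟨s, hs⟩ := Polynomial.powAddExpansion B (A - B) n
  exact ⟨s, by rw [← hs]; ring⟩

end SecondOrder

/-! ### Error terms for changes close to the identity -/

section Step

variable {T : Fin 2 → MvPowerSeries (Fin 2) ℂ} {P P' : MvPowerSeries (Fin 3) ℂ}
  {α μ k δ B n : ℕ}

/-- The exponents that are neglected when the coefficients of weight `k` are computed. -/
abbrev Neglected (α μ k δ B : ℕ) (f : MvPowerSeries (Fin 3) ℂ) : Prop :=
  Sup (fun a b c => α + 1 ≤ a ∨ μ + k + 1 ≤ c ∨ α + μ + k + δ ≤ a + c ∨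
    (α + δ ≤ 1 ∧ μ + k ≤ c) ∨ B + 1 ≤ b) f

/-- The map `T` agrees with the identity up to weight `k`. -/
structure IsNearIdentity (k δ : ℕ) (T : Fin 2 → MvPowerSeries (Fin 2) ℂ) : Prop where
  pos : 1 ≤ k
  le : δ ≤ 1
  fst : Supp (fun d => k ≤ d 1 ∧ k + δ ≤ d 0 + d 1) (T 0 - X 0)
  snd : Supp (fun d => d 0 = 0 → k + 1 ≤ d 1) (T 1 - X 1)

/-- The exponents of a defining series above `(α, μ)`. -/
abbrev Admissible (α μ : ℕ) (f : MvPowerSeries (Fin 3) ℂ) : Prop :=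
  Sup (fun a b c => 1 ≤ a ∧ 1 ≤ b ∧ ((a = α ∧ c = μ) ∨ μ + 1 ≤ c ∨ α + μ + 1 ≤ a + c)) f

theorem Above.admissible (hP : Above α μ P) (h : Supp (fun d => 1 ≤ d 0 ∧ 1 ≤ d 1) P) :
    Admissible α μ P :=
  (hP.and h).mono fun _ hd => ⟨hd.2.1, hd.2.2, hd.1⟩

/-- The weights of powers of `τ + P'`. -/
abbrev GraphWeight (α j : ℕ) (f : MvPowerSeries (Fin 3) ℂ) : Prop :=
  Sup (fun a _ c => α + 1 ≤ a ∨ j ≤ c ∨ (α ≤ a ∧ j ≤ c + 1)) f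

theorem GraphWeight.pow (hα : 1 ≤ α) {f : MvPowerSeries (Fin 3) ℂ} (hf : GraphWeight α 1 f) (j : ℕ) :
    GraphWeight α j (f ^ j) :=
  Sup.pow hf (fun j a _ c => α + 1 ≤ a ∨ j ≤ c ∨ (α ≤ a ∧ j ≤ c + 1)) (by simp)
    (by intros; omega) j

theorem Admissible.graphWeight (hP : Admissible α μ P) : GraphWeight α 1 (X 2 + P) :=
  Sup.add (sup_X_two (by simp)) (hP.imp (by intros; omega))

theorem graphWeight_X (j : ℕ) : GraphWeight α j (X 2 ^ j) := sup_X_two_pow j (by simp)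

theorem Admissible.pow_sub (hP : Admissible α μ P) (hα : 1 ≤ α) (j : ℕ) :
    Sup (fun a _ c => 1 ≤ a ∧ (α + 1 ≤ a ∨ μ + j ≤ c ∨ (α ≤ a ∧ μ + j ≤ c + 1)))
      ((X 2 + P) ^ j - X 2 ^ j) := by
  refine Sup.pow_sub (S := fun a b c => 1 ≤ a ∧ 1 ≤ b ∧
      ((a = α ∧ c = μ) ∨ μ + 1 ≤ c ∨ α + μ + 1 ≤ a + c))
    (S' := fun j a _ c => α + 1 ≤ a ∨ j ≤ c ∨ (α ≤ a ∧ j ≤ c + 1)) ?_ (fun i j => ?_) j ?_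
  · rw [add_sub_cancel_left]; exact hP
  · exact Sup.mul (hP.graphWeight.pow hα i) (graphWeight_X (α := α) j) (by intros; omega)
  · intros; omega

theorem Admissible.pow_sub_neglected (hP : Admissible α μ P) (hα : 1 ≤ α) (hδ : δ ≤ 1) {j : ℕ}
    (hj : k + 2 ≤ j) : Neglected α μ k δ B ((X 2 + P) ^ j - X 2 ^ j) := by
  refine Sup.pow_sub (S := fun a b c => 1 ≤ a ∧ 1 ≤ b ∧
      ((a = α ∧ c = μ) ∨ μ + 1 ≤ c ∨ α + μ + 1 ≤ a + c))
    (S' := fun j a _ c => α + 1 ≤ a ∨ j ≤ c ∨ (α ≤ a ∧ j ≤ c + 1)) ?_ (fun i j => ?_) j ?_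
  · rw [add_sub_cancel_left]; exact hP
  · exact Sup.mul (hP.graphWeight.pow hα i) (graphWeight_X (α := α) j) (by intros; omega)
  · intros; omega

/-- The remainder is `P` times a sum of terms `((τ + P)^i - τ^i) τ^{k-i}`, each containing a second
factor `P`. -/
theorem Admissible.pow_succ_sub (hP : Admissible α μ P) (hα : 1 ≤ α) (hδ : δ ≤ 1) :
    Neglected α μ k δ B ((X 2 + P) ^ (k + 1) - X 2 ^ (k + 1) - C ((k : ℂ) + 1) * (X 2 ^ k * P)) := by
  have e : (X 2 + P) ^ (k + 1) - X 2 ^ (k + 1) - C ((k : ℂ) + 1) * (X 2 ^ k * P) =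
      P * ∑ i ∈ Finset.range (k + 1), ((X 2 + P) ^ i - X 2 ^ i) * X 2 ^ (k - i) := by
    have h1 := (Commute.all (X 2 + P) (X 2)).mul_geom_sum₂ (k + 1)
    rw [← h1, add_sub_cancel_left, Finset.mul_sum, Finset.mul_sum]
    have h2 : C ((k : ℂ) + 1) * (X 2 ^ k * P) = ∑ i ∈ Finset.range (k + 1), X 2 ^ k * P := by
      rw [Finset.sum_const, Finset.card_range, nsmul_eq_mul]
      simp
    rw [h2, ← Finset.sum_sub_distrib]
    refine Finset.sum_congr rfl fun i hi => ?_
    rw [Finset.mem_range] at hi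
    have h3 : (X 2 : MvPowerSeries (Fin 3) ℂ) ^ k = X 2 ^ i * X 2 ^ (k - i) := by
      rw [← pow_add]; congr 1; omega
    rw [h3, show k + 1 - 1 - i = k - i by omega]
    ring
  rw [e]
  refine Sup.mul (T := fun a _ c => 1 ≤ a ∧ (α + 1 ≤ a ∨ k ≤ c ∨ (α ≤ a ∧ k ≤ c + 1))) hP
    (Supp.sum fun i hi => ?_) (by intros; omega)
  rw [Finset.mem_range] at hi
  refine Sup.mul (U := fun a _ c => 1 ≤ a ∧ (α + 1 ≤ a ∨ k ≤ c ∨ (α ≤ a ∧ k ≤ c + 1)))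
    (hP.pow_sub hα i) (graphWeight_X (α := α) (k - i)) ?_
  intros; omega

theorem IsNearIdentity.sup_axis_fst (hT : IsNearIdentity k δ T) :
    Sup (fun _ _ c => k + δ ≤ c) (subst ![0, X 2] (T 0)) := by
  have hv : Vanish (![0, X 2] : Fin 2 → MvPowerSeries (Fin 3) ℂ) := by simp
  have e : subst (![0, X 2] : Fin 2 → MvPowerSeries (Fin 3) ℂ) (T 0) =
      subst ![0, X 2] (T 0 - X 0) := by
    rw [subst_sub hv.hasSubst, subst_X hv.hasSubst]; simp
  rw [e]
  exact Sup.subst_zero₂ (R := fun i j => k ≤ j ∧ k + δ ≤ i + j) (by simp) hT.fst fun j hj =>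
    sup_X_two_pow j (by omega)

theorem IsNearIdentity.conj (hT : IsNearIdentity k δ T) :
    IsNearIdentity k δ fun i => conj (T i) := by
  refine ⟨hT.pos, hT.le, ?_, ?_⟩
  · simpa only [conj_sub, conj_X] using hT.fst.conj
  · simpa only [conj_sub, conj_X] using hT.snd.conj

theorem IsNearIdentity.fst_axis (hT : IsNearIdentity k δ T) :
    Supp (fun d => d 0 = 0 → k + δ ≤ d 1) (T 0) := by
  intro d hd h0
  refine (hT.fst d ?_).2.trans (by omega)
  rw [map_sub, coeff_X, if_neg (fun h => by simp [h] at h0), sub_zero]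
  exact hd

theorem IsNearIdentity.snd_axis (hT : IsNearIdentity k δ T) :
    Supp (fun d => d 0 = 0 → 1 ≤ d 1) (T 1) := by
  intro d hd h0
  by_contra hc
  have h1 : d = 0 := by ext l; fin_cases l <;> simp <;> omega
  have h2 := hT.snd.coeff_eq_zero (d := d) (by omega)
  rw [map_sub, coeff_X, if_neg (fun h => by simp [h] at hc), sub_zero] at h2
  exact hd h2

theorem Sup.pow_axis {f : MvPowerSeries (Fin 3) ℂ} {m : ℕ} (hm : 1 ≤ m)
    (hf : Sup (fun _ _ c => m ≤ c) f) (i : ℕ) :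
    Sup (fun _ _ c => 1 ≤ i → m + i ≤ c + 1) (f ^ i) :=
  hf.pow (fun i _ _ c => 1 ≤ i → m + i ≤ c + 1) (by simp) (by intros; omega) i

/-- The first argument has order `k + δ` in `τ` and enters at least to the power `α`, `μ` factors
`τ` being present as well. At the corner this gives order `α + μ + k + δ - 1` in `τ`; the clause `α
+ δ ≤ 1` of `Neglected` covers the one case where this is only `μ + k`. -/
theorem Admissible.neglected_axis (hP : Admissible α μ P) (hα : 1 ≤ α) (hk : 1 ≤ k)
    {A D E : MvPowerSeries (Fin 3) ℂ} (hv : Vanish ![A, D, E])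
    (hA : Sup (fun _ _ c => k + δ ≤ c) A) (hE : Sup (fun _ _ c => 1 ≤ c) E) :
    Neglected α μ k δ B (subst ![A, D, E] P) := by
  refine Sup.subst₃ hv hP fun i j l hijl => ?_
  exact Sup.mul₃ (hA.pow_axis (by omega) i) (Sup.trivial _) (hE.pow_last l) (by intros; omega)

theorem Admissible.sup_axis_graph (hP : Admissible α μ P) (hP0 : constantCoeff P = 0) (hα : 1 ≤ α)
    {F : MvPowerSeries (Fin 2) ℂ} {m : ℕ} (hF : Supp (fun d => d 0 = 0 → m ≤ d 1) F) :
    GraphWeight α m (subst ![0, X 2 + P] F) := by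
  refine Sup.subst_zero₂ (R := fun i j => i = 0 → m ≤ j) (by simp [hP0]) hF fun j hj => ?_
  exact (hP.graphWeight.pow hα j).imp (by intros; omega)

/-- Every monomial of `P` contains the middle argument, here `F̄(0, τ + P')`, which has weight `k +
δ` in the sense of `GraphWeight`. -/
theorem Admissible.neglected_graph (hP : Admissible α μ P) (hα : 1 ≤ α) (hδ : δ ≤ 1)
    {A D E : MvPowerSeries (Fin 3) ℂ} (hv : Vanish ![A, D, E])
    (hA : Sup (fun a _ c => 1 ≤ a + c) A) (hD : GraphWeight α (k + δ) D)
    (hE : GraphWeight α 1 E) :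
    Neglected α μ k δ B (subst ![A, D, E] P) := by
  refine Sup.subst₃ hv hP fun i j l hijl => ?_
  have hD' : Sup (fun a _ c => 1 ≤ j → (α + 1 ≤ a ∨ k + δ ≤ c ∨ (α ≤ a ∧ k + δ ≤ c + 1))) (D ^ j) :=
    Sup.pow hD (fun j a _ c => 1 ≤ j → (α + 1 ≤ a ∨ k + δ ≤ c ∨ (α ≤ a ∧ k + δ ≤ c + 1))) (by simp)
      (by intros; omega) j
  exact Sup.mul₃ (hA.pow_outer i) hD' (hE.pow hα l) (by intros; omega)

/-- Only the terms `w` and `r w^{k+1}` of `F(0, w)` matter: the first contributes `P` and the second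
`(k + 1) r τ^k P`. -/
theorem Admissible.sub_axis (hP : Admissible α μ P) (hP0 : constantCoeff P = 0) (hα : 1 ≤ α)
    (hδ : δ ≤ 1) (hk : 1 ≤ k) {F : MvPowerSeries (Fin 2) ℂ}
    (hF : Supp (fun d => d 0 = 0 → k + 1 ≤ d 1) (F - X 1)) :
    Neglected α μ k δ B (subst ![0, X 2 + P] F - subst ![0, X 2] F - P -
      C (((k : ℂ) + 1) * coeff (mon ![0, k + 1]) F) * (X 2 ^ k * P)) := by
  set r := coeff (mon ![0, k + 1]) F with hr
  have hv : Vanish ![0, X 2 + P] := by simp [hP0]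
  have hw : Vanish (![0, X 2] : Fin 2 → MvPowerSeries (Fin 3) ℂ) := by simp
  set E := F - X 1 - C r * X 1 ^ (k + 1) with hE
  have hF' : F = X 1 + C r * X 1 ^ (k + 1) + E := by rw [hE]; ring
  have hEs : Supp (fun d => d 0 = 0 → k + 2 ≤ d 1) E := by
    intro d hd h0
    by_contra hc
    apply hd
    have hs : d = Finsupp.single 1 (d 1) := by
      ext l; fin_cases l <;> simp [h0]
    have hm : mon ![0, k + 1] = (Finsupp.single 1 (k + 1) : Fin 2 →₀ ℕ) := by
      ext l; fin_cases l <;> simp [mon_apply]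
    by_cases hdk : d 1 = k + 1
    · rw [hs, hdk, hE, map_sub, map_sub, coeff_C_mul, coeff_X_pow, if_pos rfl, hr, hm, coeff_X,
        if_neg, mul_one, sub_zero, sub_self]
      intro h
      have := DFunLike.congr_fun h 1
      simp at this
      omega
    · rw [hE, map_sub, coeff_C_mul, coeff_X_pow, if_neg, mul_zero, sub_zero,
        hF.coeff_eq_zero fun h => by have := h h0; omega]
      intro h
      exact hdk (by rw [h]; simp)
  have e : subst ![0, X 2 + P] F - subst ![0, X 2] F - P -
      C (((k : ℂ) + 1) * r) * (X 2 ^ k * P) =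
      C r * ((X 2 + P) ^ (k + 1) - X 2 ^ (k + 1) - C ((k : ℂ) + 1) * (X 2 ^ k * P)) +
      (subst ![0, X 2 + P] E - subst ![0, X 2] E) := by
    rw [hF', subst_add hv.hasSubst, subst_add hw.hasSubst, subst_add hv.hasSubst,
      subst_add hw.hasSubst, subst_mul hv.hasSubst, subst_mul hw.hasSubst, subst_pow hv.hasSubst,
      subst_pow hw.hasSubst, subst_X hv.hasSubst, subst_X hw.hasSubst, subst_C, subst_C, map_mul]
    simp only [Matrix.cons_val]
    ring
  rw [e]
  refine Sup.add ((hP.pow_succ_sub hα hδ).C_mul r) (Sup.subst_sub₂ hv hw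
    (R := fun i j => i = 0 → k + 2 ≤ j) hEs fun i j hij => ?_)
  rcases Nat.eq_zero_or_pos i with rfl | hi
  · rw [pow_zero, one_mul, one_mul]
    exact hP.pow_sub_neglected hα hδ (hij rfl)
  · rw [zero_pow hi.ne', zero_mul, zero_mul, sub_zero]
    exact Sup.zero

/-- The exponents of `F(z, τ + P') - F(z, τ)`. -/
theorem Admissible.sub_outer (hP : Admissible α μ P) (hP0 : constantCoeff P = 0) (hα : 1 ≤ α)
    {F : MvPowerSeries (Fin 2) ℂ}
    (hF : Supp (fun d => k ≤ d 1 ∧ k + δ ≤ d 0 + d 1) (F - X 0)) :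
    Sup (fun a _ c => α + 1 ≤ a ∨ (μ + k ≤ c + 1 ∧ α ≤ a ∧ α + μ + k + δ ≤ a + c + 1) ∨
      (μ + k ≤ c ∧ 1 ≤ a ∧ μ + k + δ + 1 ≤ a + c))
      (subst ![X 0, X 2 + P] F - subst ![X 0, X 2] F) := by
  have hv : Vanish ![X 0, X 2 + P] := by simp [hP0]
  have hw : Vanish (![X 0, X 2] : Fin 2 → MvPowerSeries (Fin 3) ℂ) := by simp
  have e : subst ![X 0, X 2 + P] F - subst ![X 0, X 2] F =
      subst ![X 0, X 2 + P] (F - X 0) - subst ![X 0, X 2] (F - X 0) := by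
    rw [subst_sub hv.hasSubst, subst_sub hw.hasSubst, subst_X hv.hasSubst, subst_X hw.hasSubst]
    simp
  rw [e]
  refine Sup.subst_sub₂ hv hw (R := fun i j => k ≤ j ∧ k + δ ≤ i + j) hF fun i j hij => ?_
  rw [← mul_sub]
  refine Sup.mul (T := fun a _ c => α + 1 ≤ a ∨ (μ + j ≤ c + 1 ∧ α ≤ a) ∨ (μ + j ≤ c ∧ 1 ≤ a))
    (sup_X_zero_pow (S := fun a _ _ => i ≤ a) i le_rfl)
    ((hP.pow_sub hα j).imp (by intros; omega)) ?_
  intros; omega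

/-- Meant for `A = F(z, τ + P')` and `A' = F(z, τ)`: their difference, described in `sub_outer`,
becomes negligible after entering `P`, since `α + μ ≥ 2` supplies another factor. -/
theorem Admissible.subst_sub_fst (hP : Admissible α μ P) (hαμ : 2 ≤ α + μ)
    {A A' D E : MvPowerSeries (Fin 3) ℂ} (hv : Vanish ![A, D, E]) (hv' : Vanish ![A', D, E])
    (hA : Sup (fun a _ c => 1 ≤ a + c) A) (hA' : Sup (fun a _ c => 1 ≤ a + c) A')
    (hE : Sup (fun _ _ c => 1 ≤ c) E)
    (h : Sup (fun a _ c => α + 1 ≤ a ∨ (μ + k ≤ c + 1 ∧ α ≤ a ∧ α + μ + k + δ ≤ a + c + 1) ∨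
      (μ + k ≤ c ∧ 1 ≤ a ∧ μ + k + δ + 1 ≤ a + c)) (A - A')) :
    Neglected α μ k δ B (subst ![A, D, E] P - subst ![A', D, E] P) := by
  refine Sup.subst_sub₃ hv hv' hP fun i j l hijl => ?_
  rw [← sub_mul, ← sub_mul]
  refine Sup.mul₃ (Sup.pow_sub h (S' := fun i a _ c => i ≤ a + c) (fun p q => ?_) i
    (U := fun a _ c => (α + 1 ≤ a ∨ (μ + k ≤ c + 1 ∧ α ≤ a ∧ α + μ + k + δ + i ≤ a + c + 2) ∨
      (μ + k ≤ c ∧ 1 ≤ a ∧ μ + k + δ + i ≤ a + c))) ?_) (Sup.trivial _) (hE.pow_last l) ?_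
  · exact Sup.mul (hA.pow_outer p) (hA'.pow_outer q) (by intros; omega)
  · intros; omega
  · intros; omega

end Step

end
end FormalHypersurface


namespace FormalHypersurface
open MvPowerSeries

noncomputable section

/-! ### First order expansion of the leading monomial -/

section Comparison

variable {α μ k δ B n : ℕ} {A D E R : MvPowerSeries (Fin 3) ℂ}

theorem sup_fst_of_sub (hk : 1 ≤ k + δ) (hA : Sup (fun a _ c => k ≤ c ∧ k + δ ≤ a + c) (A - X 0)) :
    Sup (fun a _ c => 1 ≤ a + c) A := by
  have : A = (A - X 0) + X 0 := by ring
  rw [this]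
  exact Sup.add (hA.imp (by intros; omega)) (sup_X_zero (by simp))

theorem pow_sub_fst (hk : 1 ≤ k + δ)
    (hA : Sup (fun a _ c => k ≤ c ∧ k + δ ≤ a + c) (A - X 0)) (i : ℕ) :
    Sup (fun a _ c => 1 ≤ i ∧ k ≤ c ∧ k + δ + i ≤ a + c + 1) (A ^ i - X 0 ^ i) := by
  refine Sup.pow_sub hA (S' := fun m a _ c => m ≤ a + c) (fun p q => ?_) i (by intros; omega)
  exact Sup.mul ((sup_fst_of_sub hk hA).pow_outer p)
    (sup_X_zero_pow (S := fun a _ c => q ≤ a + c) q (by simp)) (by intros; omega)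

theorem sup_pow_snd_of_sub (hD : Sup (fun _ b c => k ≤ c ∧ k + δ ≤ b + c) (D - X 1)) (j : ℕ) :
    Sup (fun _ b c => j ≤ b ∨ k ≤ c) (D ^ j) := by
  have h1 : Sup (fun _ b c => 1 ≤ b ∨ k ≤ c) D := by
    have : D = (D - X 1) + X 1 := by ring
    rw [this]
    exact Sup.add (hD.imp (by intros; omega)) (sup_X_one (by simp))
  exact h1.pow (fun j _ b c => j ≤ b ∨ k ≤ c) (by simp) (by intros; omega) j

theorem pow_sub_snd (hk : 1 ≤ k) (hδ : δ ≤ 1)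
    (hD : Sup (fun _ b c => k ≤ c ∧ k + δ ≤ b + c) (D - X 1)) (j : ℕ) :
    Sup (fun _ b c => 1 ≤ j ∧ k ≤ c ∧ (k + 1 ≤ c ∨ δ = 0 ∨ j ≤ b)) (D ^ j - X 1 ^ j) := by
  refine Sup.pow_sub hD (S' := fun m _ b c => m ≤ b ∨ k ≤ c) (fun p q => ?_) j (by intros; omega)
  exact Sup.mul (sup_pow_snd_of_sub hD p)
    (sup_X_one_pow (S := fun _ b _ => q ≤ b) q (by simp)) (by intros; omega)

theorem sup_last_of_sub (hE : Sup (fun _ _ c => k + 1 ≤ c) (E - X 2)) :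
    Sup (fun _ _ c => 1 ≤ c) E := by
  have : E = (E - X 2) + X 2 := by ring
  rw [this]
  exact Sup.add (hE.imp (by intros; omega)) (sup_X_two (by simp))

theorem pow_sub_last (hE : Sup (fun _ _ c => k + 1 ≤ c) (E - X 2)) (l : ℕ) :
    Sup (fun _ _ c => 1 ≤ l ∧ k + l ≤ c) (E ^ l - X 2 ^ l) := by
  refine Sup.pow_sub hE (S' := fun m _ _ c => m ≤ c) (fun p q => ?_) l (by intros; omega)
  exact Sup.mul ((sup_last_of_sub hE).pow_last p)
    (sup_X_two_pow (S := fun _ _ c => q ≤ c) q (by simp)) (by intros; omega)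

/-- Away from the leading monomial, even the first order effect of the change of arguments is
neglected. At `(α, μ)` itself only powers of `χ` beyond `B` are allowed in `R`. -/
theorem neglected_subst_sub (hk : 1 ≤ k) (hδ : δ ≤ 1) (hv : Vanish ![A, D, E])
    (hA : Sup (fun a _ c => k ≤ c ∧ k + δ ≤ a + c) (A - X 0))
    (hD : Sup (fun _ b c => k ≤ c ∧ k + δ ≤ b + c) (D - X 1))
    (hE : Sup (fun _ _ c => k + 1 ≤ c) (E - X 2))
    (hR : Sup (fun a b c => (a = α ∧ c = μ ∧ B + 1 ≤ b) ∨ μ + 1 ≤ c ∨ α + μ + 1 ≤ a + c) R) :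
    Neglected α μ k δ B (subst ![A, D, E] R - R) := by
  have hw : Vanish (![X 0, X 1, X 2] : Fin 3 → MvPowerSeries (Fin 3) ℂ) := by simp
  have e : subst ![A, D, E] R - R = subst ![A, D, E] R - subst ![X 0, X 1, X 2] R := by
    rw [subst_X_vec₃]
  rw [e]
  refine Sup.subst_sub₃ hv hw hR fun i j l hijl => ?_
  rw [sub_pow_split]
  refine Sup.add (Sup.add ?_ ?_) ?_
  · exact Sup.mul₃ (pow_sub_fst (by omega) hA i) (sup_pow_snd_of_sub hD j)
      ((sup_last_of_sub hE).pow_last l) (by intros; omega)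
  · exact Sup.mul₃ (sup_X_zero_pow (S := fun a _ _ => i ≤ a) i le_rfl) (pow_sub_snd hk hδ hD j)
      ((sup_last_of_sub hE).pow_last l) (by intros; omega)
  · exact Sup.mul₃ (sup_X_zero_pow (S := fun a _ _ => i ≤ a) i le_rfl)
      (sup_X_one_pow (S := fun _ b _ => j ≤ b) j le_rfl) (pow_sub_last hE l) (by intros; omega)

/-- Both second order factors exceed `τ` by `k` powers, and the `m - 2` remaining ones keep their
own power of `τ`. -/
theorem pow_sub_linear_last (hE : Sup (fun _ _ c => k + 1 ≤ c) (E - X 2)) (m : ℕ) :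
    Sup (fun _ _ c => m + 2 * k ≤ c) (E ^ m - X 2 ^ m - (m : ℂ) • (X 2 ^ (m - 1) * (E - X 2))) := by
  induction m with
  | zero => simpa using Sup.zero
  | succ m ih =>
    have e : E ^ (m + 1) - X 2 ^ (m + 1) -
        ((m + 1 : ℕ) : ℂ) • (X 2 ^ (m + 1 - 1) * (E - X 2)) =
        E * (E ^ m - X 2 ^ m - (m : ℂ) • (X 2 ^ (m - 1) * (E - X 2))) +
        (m : ℂ) • (X 2 ^ (m - 1) * (E - X 2) * (E - X 2)) := by
      rcases m with _ | m
      · simp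
      · simp only [smul_eq_C_mul, Nat.add_sub_cancel, Nat.cast_add, Nat.cast_one, map_add, map_one]
        ring
    rw [e]
    refine Sup.add (Sup.mul (T := fun _ _ c => m + 2 * k ≤ c) (sup_last_of_sub hE) ih
      (by intros; omega)) ?_
    rw [smul_eq_C_mul]
    rcases m with _ | m
    · simpa using Sup.zero
    · refine Sup.C_mul (Sup.mul₃ (sup_X_two_pow (S := fun _ _ c => m ≤ c) _ (by simp)) hE hE ?_) _
      intros; omega

theorem pow_sub_linear {X' : MvPowerSeries (Fin 3) ℂ} (hA : Sup (fun _ _ c => k ≤ c) (A - X'))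
    (m : ℕ) : Sup (fun _ _ c => 2 * k ≤ c) (A ^ m - X' ^ m - (m : ℂ) • (X' ^ (m - 1) * (A - X'))) := by
  obtain ⟨s, hs⟩ := exists_pow_expansion A X' m
  have e : A ^ m - X' ^ m - (m : ℂ) • (X' ^ (m - 1) * (A - X')) = s * (A - X') * (A - X') := by
    rw [hs, smul_eq_C_mul, map_natCast]; ring
  rw [e]
  exact Sup.mul₃ (Sup.trivial _) hA hA (by intros; omega)

/-- The part linear in `V`, `W`, `Y` of the product `(z + V)^α (χ + W)^n (τ + Y)^μ`. -/
def linearPart (α n μ : ℕ) (V W Y : MvPowerSeries (Fin 3) ℂ) : MvPowerSeries (Fin 3) ℂ :=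
  C (α : ℂ) * (X 0 ^ (α - 1) * X 1 ^ n * X 2 ^ μ * V) +
    C (n : ℂ) * (X 0 ^ α * X 1 ^ (n - 1) * X 2 ^ μ * W) +
    C (μ : ℂ) * (X 0 ^ α * X 1 ^ n * X 2 ^ (μ - 1) * Y)

/-- Each quadratic term contains at least `2k ≥ k + 1` extra powers of `τ` beyond `τ^μ`. -/
theorem neglected_monomial_sub (hk : 1 ≤ k)
    (hA : Sup (fun a _ c => k ≤ c ∧ k + δ ≤ a + c) (A - X 0))
    (hD : Sup (fun _ b c => k ≤ c ∧ k + δ ≤ b + c) (D - X 1))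
    (hE : Sup (fun _ _ c => k + 1 ≤ c) (E - X 2)) :
    Neglected α μ k δ B (A ^ α * D ^ n * E ^ μ - X 0 ^ α * X 1 ^ n * X 2 ^ μ -
      linearPart α n μ (A - X 0) (D - X 1) (E - X 2)) := by
  have hA' : Sup (fun _ _ c => k ≤ c) (A - X 0) := hA.imp (by intros; omega)
  have hD' : Sup (fun _ _ c => k ≤ c) (D - X 1) := hD.imp (by intros; omega)
  have a2 := pow_sub_linear hA' α
  have d2 := pow_sub_linear hD' n
  have e2 := pow_sub_linear_last hE μ
  have d1 : Sup (fun _ _ c => k ≤ c) (D ^ n - X 1 ^ n) :=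
    Sup.pow_sub hD' (S' := fun _ _ _ _ => True) (fun _ _ => Sup.trivial _) n (by intros; omega)
  have e1 := pow_sub_last hE μ
  have e0 := (sup_last_of_sub hE).pow_last μ
  have key : A ^ α * D ^ n * E ^ μ - X 0 ^ α * X 1 ^ n * X 2 ^ μ -
      linearPart α n μ (A - X 0) (D - X 1) (E - X 2) =
    (A ^ α - X 0 ^ α - (α : ℂ) • (X 0 ^ (α - 1) * (A - X 0))) * D ^ n * E ^ μ +
    (C (α : ℂ) * X 0 ^ (α - 1) * (A - X 0)) * (D ^ n - X 1 ^ n) * E ^ μ +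
    (C (α : ℂ) * X 0 ^ (α - 1) * X 1 ^ n) * (A - X 0) * (E ^ μ - X 2 ^ μ) +
    X 0 ^ α * (D ^ n - X 1 ^ n - (n : ℂ) • (X 1 ^ (n - 1) * (D - X 1))) * E ^ μ +
    (C (n : ℂ) * X 0 ^ α * X 1 ^ (n - 1)) * (D - X 1) * (E ^ μ - X 2 ^ μ) +
    X 0 ^ α * X 1 ^ n * (E ^ μ - X 2 ^ μ - (μ : ℂ) • (X 2 ^ (μ - 1) * (E - X 2))) := by
    simp only [smul_eq_C_mul, linearPart]
    ring
  rw [key]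
  refine Sup.add (Sup.add (Sup.add (Sup.add (Sup.add ?_ ?_) ?_) ?_) ?_) ?_
  · exact Sup.mul₃ a2 (Sup.trivial _) e0 (by intros; omega)
  · exact Sup.mul₃ (Sup.mul (U := fun _ _ c => k ≤ c) (Sup.trivial _) hA' (by intros; omega)) d1 e0
      (by intros; omega)
  · exact Sup.mul₃ (Sup.trivial _) hA' e1 (by intros; omega)
  · exact Sup.mul₃ (Sup.trivial _) d2 e0 (by intros; omega)
  · exact Sup.mul₃ (Sup.trivial _) hD' e1 (by intros; omega)
  · exact Sup.mul₃ (Sup.trivial _) (Sup.trivial _) e2 (by intros; omega)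

end Comparison

/-! ### The linearised transformation rule -/

section Step

variable {T : Fin 2 → MvPowerSeries (Fin 2) ℂ} {P P' : MvPowerSeries (Fin 3) ℂ}
  {α μ k δ B n : ℕ}

theorem neglected_upward (a b c a' b' c' : ℕ) (h : α + 1 ≤ a ∨ μ + k + 1 ≤ c ∨
    α + μ + k + δ ≤ a + c ∨ (α + δ ≤ 1 ∧ μ + k ≤ c) ∨ B + 1 ≤ b) : α + 1 ≤ a + a' ∨
    μ + k + 1 ≤ c + c' ∨ α + μ + k + δ ≤ (a + a') + (c + c') ∨
    (α + δ ≤ 1 ∧ μ + k ≤ c + c') ∨ B + 1 ≤ b + b' := by omega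

/-- Eliminating `G(z, τ + P')` and `Ḡ(χ, τ)` leaves `Ḡ(0, τ + P') - Ḡ(0, τ)` equal to a combination
of values of `P`. The left side is `P' + (k + 1) ḡ τ^k P'`. On the right only `P(F(z, τ), F̄(χ, τ),
G(0, τ))` is not neglected, and it is expanded to first order at the leading monomial. The bound `B`
on powers of `χ` allows the leading coefficient to be a monomial only up to order `B`. -/
theorem IsTransform.step (h : IsTransform T P P') (hT : IsNearIdentity k δ T) (hα : 1 ≤ α)
    (hαμ : 2 ≤ α + μ) (hP : Above α μ P)
    (hlead : ∀ j, j ≤ B → j ≠ n → coeff (mon ![α, j, μ]) P = 0) :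
    Neglected α μ k δ B (P' +
      C (((k : ℂ) + 1) * starRingEnd ℂ (coeff (mon ![0, k + 1]) (T 1))) * (X 2 ^ k * P') - P -
      C (coeff (mon ![α, n, μ]) P) * linearPart α n μ (subst ![X 0, X 2] (T 0 - X 0))
        (subst ![X 1, X 2] (conj (T 0 - X 0))) (subst ![0, X 2] (T 1 - X 1))) := by
  have hk := hT.pos
  have hδ := hT.le
  have hPa := hP.admissible h.supp
  have hPa' := (h.above hP).admissible h.supp'
  have hP0' := h.constantCoeff_P'
  have v02 : Vanish (![0, X 2] : Fin 2 → MvPowerSeries (Fin 3) ℂ) := by simp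
  have v12 : Vanish (![X 1, X 2] : Fin 2 → MvPowerSeries (Fin 3) ℂ) := by simp
  have v00 : Vanish (![X 0, X 2] : Fin 2 → MvPowerSeries (Fin 3) ℂ) := by simp
  have v0Q : Vanish ![0, X 2 + P'] := by simp [hP0']
  have hg := sup_axis (h.bihol.1 1)
  have hgb := sup_axis (constantCoeff_eq_zero_of_conj (h.bihol.1 1))
  have hF1 := h.sup_on_graph (h.bihol.1 0)
  set u := coeff (mon ![α, n, μ]) P with hu
  set F1 := subst ![X 0, X 2 + P'] (T 0) with hF1d
  set F0 := subst (![X 0, X 2] : Fin 2 → MvPowerSeries (Fin 3) ℂ) (T 0) with hF0d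
  set f := subst (![0, X 2] : Fin 2 → MvPowerSeries (Fin 3) ℂ) (T 0) with hfd
  set Fb := subst (![X 1, X 2] : Fin 2 → MvPowerSeries (Fin 3) ℂ) (conj (T 0)) with hFbd
  set fb := subst (![0, X 2] : Fin 2 → MvPowerSeries (Fin 3) ℂ) (conj (T 0)) with hfbd
  set fb1 := subst ![0, X 2 + P'] (conj (T 0)) with hfb1d
  set g := subst (![0, X 2] : Fin 2 → MvPowerSeries (Fin 3) ℂ) (T 1) with hgd
  set Gb := subst (![X 1, X 2] : Fin 2 → MvPowerSeries (Fin 3) ℂ) (conj (T 1)) with hGbd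
  set gb := subst (![0, X 2] : Fin 2 → MvPowerSeries (Fin 3) ℂ) (conj (T 1)) with hgbd
  set gb1 := subst ![0, X 2 + P'] (conj (T 1)) with hgb1d
  have vT2 : Vanish ![f, Fb, Gb] := h.vanish v02 v12
  have vT4 : Vanish ![f, fb, gb] := h.vanish v02 v02
  have vN1 : Vanish ![F1, fb1, gb1] := h.vanish h.vanish_Q v0Q
  have vM : Vanish ![F1, Fb, Gb] := h.vanish h.vanish_Q v12
  have hg0 : constantCoeff g = 0 := by
    rw [hgd, constantCoeff_subst_vanish v02]; exact h.bihol.1 1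
  have vM' : Vanish ![F1, Fb, g] := by
    rw [vanish₃] at vM ⊢; exact ⟨vM.1, vM.2.1, hg0⟩
  have v0 : Vanish ![F0, Fb, g] := by
    have := h.vanish v00 v12
    rw [vanish₃] at this ⊢; exact ⟨this.1, this.2.1, hg0⟩
  have t2 : Neglected α μ k δ B (subst ![f, Fb, Gb] P) :=
    hPa.neglected_axis hα hk vT2 hT.sup_axis_fst h.sup_conj
  have t4 : Neglected α μ k δ B (subst ![f, fb, gb] P) :=
    hPa.neglected_axis hα hk vT4 hT.sup_axis_fst hgb
  have n1 : Neglected α μ k δ B (subst ![F1, fb1, gb1] P) := by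
    refine hPa.neglected_graph hα hδ vN1 hF1 (hPa'.sup_axis_graph hP0' hα ?_)
      (hPa'.sup_axis_graph hP0' hα ?_)
    · refine hT.conj.fst_axis
    · refine hT.conj.snd_axis
  have d1 : Neglected α μ k δ B (gb1 - gb - P' -
      C (((k : ℂ) + 1) * starRingEnd ℂ (coeff (mon ![0, k + 1]) (T 1))) * (X 2 ^ k * P')) := by
    have := hPa'.sub_axis (B := B) hP0' hα hδ hk hT.conj.snd
    rwa [coeff_conj] at this
  -- By the case `z = 0`, `Ḡ(χ, τ)` and `G(0, τ)` differ by the series already neglected in `t2`.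
  have m1 : Neglected α μ k δ B (subst ![F1, Fb, Gb] P - subst ![F1, Fb, g] P) := by
    refine Sup.subst_sub_of_ideal vM vM' neglected_upward ?_ ?_ ?_ P
    · rw [sub_self]; exact Sup.zero
    · rw [sub_self]; exact Sup.zero
    · have : Gb - g = - subst ![f, Fb, Gb] P := by rw [hgd, h.eqn_left]; ring
      rw [this]; exact t2.neg
  have m2 : Neglected α μ k δ B (subst ![F1, Fb, g] P - subst ![F0, Fb, g] P) :=
    hPa.subst_sub_fst hαμ vM' v0 hF1 (sup_outer (h.bihol.1 0)) hg (hPa'.sub_outer hP0' hα hT.fst)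
  have hA : F0 - X 0 = subst ![X 0, X 2] (T 0 - X 0) := by
    rw [subst_sub v00.hasSubst, subst_X v00.hasSubst]; simp [hF0d]
  have hD : Fb - X 1 = subst ![X 1, X 2] (conj (T 0 - X 0)) := by
    rw [conj_sub, conj_X, subst_sub v12.hasSubst, subst_X v12.hasSubst]; simp [hFbd]
  have hE : g - X 2 = subst ![0, X 2] (T 1 - X 1) := by
    rw [subst_sub v02.hasSubst, subst_X v02.hasSubst]; simp [hgd]
  rw [← hA, ← hD, ← hE]
  have hA1 : Sup (fun a _ c => k ≤ c ∧ k + δ ≤ a + c) (F0 - X 0) := by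
    rw [hA]
    exact Sup.subst₂ v00 (R := fun i j => k ≤ j ∧ k + δ ≤ i + j) hT.fst fun i j hij =>
      Sup.mul (sup_X_zero_pow (S := fun a _ _ => a = i) i rfl)
        (sup_X_two_pow (S := fun _ _ c => c = j) j rfl) (by intros; omega)
  have hD1 : Sup (fun _ b c => k ≤ c ∧ k + δ ≤ b + c) (Fb - X 1) := by
    rw [hD]
    exact Sup.subst₂ v12 (R := fun i j => k ≤ j ∧ k + δ ≤ i + j) hT.fst.conj fun i j hij =>
      Sup.mul (sup_X_one_pow (S := fun _ b _ => b = i) i rfl)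
        (sup_X_two_pow (S := fun _ _ c => c = j) j rfl) (by intros; omega)
  have hE1 : Sup (fun _ _ c => k + 1 ≤ c) (g - X 2) := by
    rw [hE]
    exact Sup.subst_zero₂ (R := fun i j => i = 0 → k + 1 ≤ j) (by simp) hT.snd fun j hj =>
      sup_X_two_pow j (hj rfl)
  -- The leading monomial is split off; the rest has no first order effect by `neglected_subst_sub`.
  set R := P - C u * (X 0 ^ α * X 1 ^ n * X 2 ^ μ) with hR
  have hRs : Sup (fun a b c => (a = α ∧ c = μ ∧ B + 1 ≤ b) ∨ μ + 1 ≤ c ∨ α + μ + 1 ≤ a + c) R := by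
    have hm : Sup (fun a b c => a = α ∧ b = n ∧ c = μ) (X 0 ^ α * X 1 ^ n * X 2 ^ μ) :=
      Sup.mul₃ (sup_X_zero_pow (S := fun a b c => a = α ∧ b = 0 ∧ c = 0) α (by simp))
        (sup_X_one_pow (S := fun a b c => a = 0 ∧ b = n ∧ c = 0) n (by simp))
        (sup_X_two_pow (S := fun a b c => a = 0 ∧ b = 0 ∧ c = μ) μ (by simp)) (by intros; omega)
    intro d hd
    by_contra hc
    apply hd
    rw [hR, map_sub, coeff_C_mul]
    by_cases h1 : d 0 = α ∧ d 2 = μ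
    · by_cases h2 : d 1 = n
      · have h3 := coeff_mon_X_pow_mul α n μ 0 0 0 (1 : MvPowerSeries (Fin 3) ℂ)
        have h4 : (mon ![0, 0, 0] : Fin 3 →₀ ℕ) = 0 := by ext l; fin_cases l <;> simp [mon_apply]
        rw [mul_one, h4, coeff_zero_one, add_zero, add_zero, add_zero] at h3
        rw [eq_mon₃ d, h1.1, h1.2, h2, h3, mul_one, sub_self]
      · rw [hm.coeff_eq_zero (by omega), mul_zero, sub_zero, eq_mon₃ d, h1.1, h1.2,
          hlead _ (by omega) h2]
    · rw [hm.coeff_eq_zero (by omega), mul_zero, sub_zero, hP.coeff_eq_zero (by omega)]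
  have r1 := neglected_subst_sub hk hδ v0 hA1 hD1 hE1 hRs
  have r2 : Neglected α μ k δ B _ :=
    (neglected_monomial_sub (α := α) (μ := μ) (n := n) (B := B) hk hA1 hD1 hE1).C_mul u
  have e1 : subst ![F0, Fb, g] P = subst ![F0, Fb, g] R + C u * (F0 ^ α * Fb ^ n * g ^ μ) := by
    have : P = R + C u * (X 0 ^ α * X 1 ^ n * X 2 ^ μ) := by rw [hR]; ring
    conv_lhs => rw [this]
    rw [subst_add v0.hasSubst, subst_mul v0.hasSubst, subst_C, subst_mul v0.hasSubst,
      subst_mul v0.hasSubst, subst_pow v0.hasSubst, subst_pow v0.hasSubst, subst_pow v0.hasSubst,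
      subst_X v0.hasSubst, subst_X v0.hasSubst, subst_X v0.hasSubst]
    simp
  have final : Neglected α μ k δ B _ :=
    ((((((r1.add r2).add m1).add m2).sub d1).sub t2).add t4).sub n1
  convert final using 1
  have i1 := h.eqn
  have i2 := h.eqn_left
  have i3 := h.eqn_axis
  have i4 := h.eqn_graph
  rw [← hGbd, ← hFbd, ← hF1d] at i1
  rw [← hgd, ← hfd, ← hGbd, ← hFbd] at i2
  rw [← hgd, ← hfd, ← hgbd, ← hfbd] at i3
  rw [← hgb1d, ← hfb1d, ← hF1d] at i4
  linear_combination (i1 - i4) + (i3 - i2) + hR + e1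

end Step

end
end FormalHypersurface


namespace FormalHypersurface
open MvPowerSeries

noncomputable section

/-! ### Coefficients changed by a step -/

section Extraction

theorem coeff_subst_axis (F : MvPowerSeries (Fin 2) ℂ) (k : ℕ) :
    coeff (mon ![0, 0, k]) (subst (![0, X 2] : Fin 2 → MvPowerSeries (Fin 3) ℂ) F) =
      coeff (mon ![0, k]) F := by
  have hv : Vanish (![0, X 2] : Fin 2 → MvPowerSeries (Fin 3) ℂ) := by simp
  have hw : Vanish (![X 0, X 2] : Fin 2 → MvPowerSeries (Fin 3) ℂ) := by simp
  have h : Sup (fun a _ _ => 1 ≤ a) (subst (![X 0, X 2] : Fin 2 → MvPowerSeries (Fin 3) ℂ) F -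
      subst (![0, X 2] : Fin 2 → MvPowerSeries (Fin 3) ℂ) F) := by
    refine Supp.subst_sub_of_ideal hw.hasSubst hv.hasSubst
      (by intro d e h; rw [Finsupp.add_apply]; omega) (fun i => ?_) F
    fin_cases i
    · simpa using sup_X_zero (S := fun a _ _ => 1 ≤ a) le_rfl
    · simpa using Sup.zero (S := fun a _ _ => 1 ≤ a)
  have h1 := h.coeff_eq_zero (d := mon ![0, 0, k]) (by simp [mon_apply])
  rw [map_sub, coeff_subst_outer, sub_eq_zero] at h1
  exact h1.symm

theorem supp_subst_axis (f : MvPowerSeries (Fin 2) ℂ) :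
    Sup (fun a b _ => a = 0 ∧ b = 0) (subst ![0, X 2] f) := by
  refine Sup.subst_zero₂ (by simp) (R := fun _ _ => True) (fun _ _ => True.intro) fun b _ => ?_
  exact sup_X_two_pow b ⟨rfl, rfl⟩

theorem sup_monomial (i j k : ℕ) :
    Sup (fun a b c => a = i ∧ b = j ∧ c = k) (X 0 ^ i * X 1 ^ j * X 2 ^ k) :=
  Sup.mul₃ (sup_X_zero_pow (S := fun a b c => a = i ∧ b = 0 ∧ c = 0) i (by simp))
    (sup_X_one_pow (S := fun a b c => a = 0 ∧ b = j ∧ c = 0) j (by simp))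
    (sup_X_two_pow (S := fun a b c => a = 0 ∧ b = 0 ∧ c = k) k (by simp)) (by intros; omega)

theorem Sup.coeff_eq_zero {S : ℕ → ℕ → ℕ → Prop} {f : MvPowerSeries (Fin 3) ℂ} (hf : Sup S f)
    {a b c : ℕ} (h : ¬ S a b c) : coeff (mon ![a, b, c]) f = 0 :=
  Supp.coeff_eq_zero hf (by simpa [mon_apply] using h)

variable {T : Fin 2 → MvPowerSeries (Fin 2) ℂ} {P P' : MvPowerSeries (Fin 3) ℂ}
  {α μ k δ B n : ℕ}

theorem coeff_fst_sub (hk : 1 ≤ k) (i : ℕ) :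
    coeff (mon ![i, k]) (T 0 - X 0) = coeff (mon ![i, k]) (T 0) := by
  rw [map_sub, coeff_X, if_neg, sub_zero]
  intro h
  have := DFunLike.congr_fun h 1
  simp [mon_apply] at this
  omega

theorem coeff_snd_sub (hk : 1 ≤ k) (i : ℕ) :
    coeff (mon ![i, k + 1]) (T 1 - X 1) = coeff (mon ![i, k + 1]) (T 1) := by
  rw [map_sub, coeff_X, if_neg, sub_zero]
  intro h
  have := DFunLike.congr_fun h 1
  simp [mon_apply] at this
  omega

section

variable (hT : IsNearIdentity k δ T)
include hT

theorem IsNearIdentity.sup_outer :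
    Sup (fun a b c => b = 0 ∧ k ≤ c ∧ k + δ ≤ a + c) (subst ![X 0, X 2] (T 0 - X 0)) :=
  Sup.subst₂ (by simp) (R := fun i j => k ≤ j ∧ k + δ ≤ i + j) hT.fst fun i j hij =>
    Sup.mul (sup_X_zero_pow (S := fun a b c => a = i ∧ b = 0 ∧ c = 0) i (by simp))
      (sup_X_two_pow (S := fun a b c => a = 0 ∧ b = 0 ∧ c = j) j (by simp)) (by intros; omega)

theorem IsNearIdentity.sup_tail :
    Sup (fun a b c => a = 0 ∧ k ≤ c ∧ k + δ ≤ b + c) (subst ![X 1, X 2] (FormalHypersurface.conj (T 0 - X 0))) :=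
  Sup.subst₂ (by simp) (R := fun i j => k ≤ j ∧ k + δ ≤ i + j) hT.fst.conj fun i j hij =>
    Sup.mul (sup_X_one_pow (S := fun a b c => a = 0 ∧ b = i ∧ c = 0) i (by simp))
      (sup_X_two_pow (S := fun a b c => a = 0 ∧ b = 0 ∧ c = j) j (by simp)) (by intros; omega)

theorem IsNearIdentity.sup_axis :
    Sup (fun a b c => a = 0 ∧ b = 0 ∧ k + 1 ≤ c) (subst ![0, X 2] (T 1 - X 1)) :=
  Sup.subst_zero₂ (by simp) (R := fun i j => i = 0 → k + 1 ≤ j) hT.snd fun j hj =>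
    sup_X_two_pow j ⟨rfl, rfl, hj rfl⟩

theorem IsNearIdentity.sup_linearPart (hα : 1 ≤ α) : Sup (fun a b c => μ + k ≤ c ∧
      ((b = n ∧ α + μ + k + δ ≤ a + c + 1) ∨ α ≤ a))
    (linearPart α n μ (subst ![X 0, X 2] (T 0 - X 0)) (subst ![X 1, X 2] (FormalHypersurface.conj (T 0 - X 0)))
      (subst ![0, X 2] (T 1 - X 1))) := by
  refine Sup.add (Sup.add (Sup.C_mul ?_ _) (Sup.C_mul ?_ _)) ?_
  · exact Sup.mul (sup_monomial _ _ _) hT.sup_outer (by intros; omega)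
  · exact Sup.mul (sup_monomial _ _ _) hT.sup_tail (by intros; omega)
  · rcases μ with _ | μ
    · simpa using Sup.zero
    · exact Sup.C_mul (Sup.mul (sup_monomial _ _ _) hT.sup_axis (by intros; omega)) _

end

/-- The term `z^j w^k` of `F` acts through `F` only for `j = 1` and `b = n`, but through `F̄` it
produces `χ^{n-1+j}`; hence the index `b + 1 - n`. For `n = 0` the latter contribution has the
factor `0`. -/
theorem coeff_linearPart_top (hα : 1 ≤ α) (hk : 1 ≤ k) (b : ℕ) :
    coeff (mon ![α, b, μ + k])
      (linearPart α n μ (subst ![X 0, X 2] (T 0 - X 0)) (subst ![X 1, X 2] (conj (T 0 - X 0)))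
        (subst ![0, X 2] (T 1 - X 1))) =
      (if b = n then α * coeff (mon ![1, k]) (T 0) + μ * coeff (mon ![0, k + 1]) (T 1) else 0) +
      if n ≤ b + 1 then n * starRingEnd ℂ (coeff (mon ![b + 1 - n, k]) (T 0)) else 0 := by
  have e1 : coeff (mon ![α, b, μ + k]) (X 0 ^ (α - 1) * X 1 ^ n * X 2 ^ μ *
      subst (![X 0, X 2] : Fin 2 → MvPowerSeries (Fin 3) ℂ) (T 0 - X 0)) =
      if b = n then coeff (mon ![1, k]) (T 0) else 0 := by
    split_ifs with h
    · have := coeff_mon_X_pow_mul (α - 1) n μ 1 0 k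
        (subst (![X 0, X 2] : Fin 2 → MvPowerSeries (Fin 3) ℂ) (T 0 - X 0))
      rw [coeff_subst_outer, coeff_fst_sub hk, Nat.sub_add_cancel hα, add_zero, ← h] at this
      rw [← h, this]
    · refine Sup.coeff_eq_zero (S := fun _ b _ => b = n) (Sup.mul (sup_monomial _ _ _)
        (supp_subst_outer _) (by intros; omega)) h
  have e2 : (n : ℂ) * coeff (mon ![α, b, μ + k]) (X 0 ^ α * X 1 ^ (n - 1) * X 2 ^ μ *
      subst (![X 1, X 2] : Fin 2 → MvPowerSeries (Fin 3) ℂ) (conj (T 0 - X 0))) =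
      if n ≤ b + 1 then n * starRingEnd ℂ (coeff (mon ![b + 1 - n, k]) (T 0)) else 0 := by
    rcases Nat.eq_zero_or_pos n with rfl | hn
    · simp
    split_ifs with h
    · have := coeff_mon_X_pow_mul α (n - 1) μ 0 (b + 1 - n) k
        (subst (![X 1, X 2] : Fin 2 → MvPowerSeries (Fin 3) ℂ) (conj (T 0 - X 0)))
      rw [coeff_subst_tail, coeff_conj, coeff_fst_sub hk, add_zero,
        show n - 1 + (b + 1 - n) = b by omega] at this
      rw [this]
    · rw [Sup.coeff_eq_zero (S := fun _ b _ => n - 1 ≤ b) (Sup.mul (sup_monomial _ _ _)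
        (Sup.trivial _) (by intros; omega)) (by omega), mul_zero]
  have e3 : (μ : ℂ) * coeff (mon ![α, b, μ + k]) (X 0 ^ α * X 1 ^ n * X 2 ^ (μ - 1) *
      subst (![0, X 2] : Fin 2 → MvPowerSeries (Fin 3) ℂ) (T 1 - X 1)) =
      if b = n then μ * coeff (mon ![0, k + 1]) (T 1) else 0 := by
    rcases Nat.eq_zero_or_pos μ with rfl | hμ
    · simp
    split_ifs with h
    · have := coeff_mon_X_pow_mul α n (μ - 1) 0 0 (k + 1)
        (subst (![0, X 2] : Fin 2 → MvPowerSeries (Fin 3) ℂ) (T 1 - X 1))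
      rw [coeff_subst_axis, coeff_snd_sub hk, add_zero, add_zero,
        show μ - 1 + (k + 1) = μ + k by omega] at this
      rw [h, this]
    · rw [Sup.coeff_eq_zero (S := fun _ b _ => b = n) (Sup.mul (sup_monomial _ _ _)
        (supp_subst_axis _) (by intros; omega)) h, mul_zero]
  rw [linearPart, map_add, map_add, coeff_C_mul, coeff_C_mul, coeff_C_mul, e1, e2, e3]
  split_ifs <;> ring

/-- Lowering the power of `z` by one is possible only by replacing one factor `F` with its pure term
in `w^k`. -/
theorem coeff_linearPart_shifted (hα : 1 ≤ α) (hk : 1 ≤ k) (b : ℕ) :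
    coeff (mon ![α - 1, b, μ + k])
      (linearPart α n μ (subst ![X 0, X 2] (T 0 - X 0)) (subst ![X 1, X 2] (conj (T 0 - X 0)))
        (subst ![0, X 2] (T 1 - X 1))) =
      if b = n then α * coeff (mon ![0, k]) (T 0) else 0 := by
  have e1 : coeff (mon ![α - 1, b, μ + k]) (X 0 ^ (α - 1) * X 1 ^ n * X 2 ^ μ *
      subst (![X 0, X 2] : Fin 2 → MvPowerSeries (Fin 3) ℂ) (T 0 - X 0)) =
      if b = n then coeff (mon ![0, k]) (T 0) else 0 := by
    split_ifs with h
    · have := coeff_mon_X_pow_mul (α - 1) n μ 0 0 k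
        (subst (![X 0, X 2] : Fin 2 → MvPowerSeries (Fin 3) ℂ) (T 0 - X 0))
      rw [coeff_subst_outer, coeff_fst_sub hk, add_zero, add_zero] at this
      rw [h, this]
    · refine Sup.coeff_eq_zero (S := fun _ b _ => b = n) (Sup.mul (sup_monomial _ _ _)
        (supp_subst_outer _) (by intros; omega)) h
  have e2 : ∀ (j m : ℕ) (f : MvPowerSeries (Fin 3) ℂ), coeff (mon ![α - 1, b, μ + k])
      (X 0 ^ α * X 1 ^ j * X 2 ^ m * f) = 0 := fun j m f =>
    Sup.coeff_eq_zero (S := fun a _ _ => α ≤ a) (Sup.mul (sup_monomial _ _ _)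
        (Sup.trivial _) (by intros; omega)) (by omega)
  rw [linearPart, map_add, map_add, coeff_C_mul, coeff_C_mul, coeff_C_mul, e1, e2, e2]
  split_ifs <;> ring

theorem Above.sup_shift (hP : Above α μ P) :
    Sup (fun a _ c => (a = α ∧ c = μ + k) ∨ μ + k + 1 ≤ c ∨ α + μ + k + 1 ≤ a + c)
      (X 2 ^ k * P) :=
  Sup.mul (sup_X_two_pow (S := fun a _ c => a = 0 ∧ c = k) k (by simp)) hP (by intros; omega)

/-- Below the layer `μ + k`, and within it for smaller powers of `z` when `δ = 1`, neither the
linear part nor `τ^k P'` has a coefficient. This preserves the conditions achieved earlier. -/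
theorem IsTransform.coeff_low (h : IsTransform T P P') (hT : IsNearIdentity k δ T) (hα : 1 ≤ α)
    (hαμ : 2 ≤ α + μ) (hP : Above α μ P)
    (hlead : ∀ j, j ≤ B → j ≠ n → coeff (mon ![α, j, μ]) P = 0) {a b c : ℕ} (hb : b ≤ B)
    (hac : (a ≤ α ∧ c < μ + k) ∨ (δ = 1 ∧ a < α ∧ c ≤ μ + k)) :
    coeff (mon ![a, b, c]) P' = coeff (mon ![a, b, c]) P := by
  have hδ := hT.le
  have hk := hT.pos
  have h1 := (h.step hT hα hαμ hP hlead).coeff_eq_zero (a := a) (b := b) (c := c)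
    (by omega)
  rw [map_sub, map_sub, map_add, coeff_C_mul, coeff_C_mul,
    ((h.above hP).sup_shift (k := k)).coeff_eq_zero (a := a) (b := b) (c := c) (by omega),
    (hT.sup_linearPart (n := n) (μ := μ) hα).coeff_eq_zero (a := a) (b := b) (c := c) (by omega)]
    at h1
  linear_combination h1

theorem IsTransform.coeff_shifted (h : IsTransform T P P') (hT : IsNearIdentity k 0 T)
    (hα : 2 ≤ α) (hP : Above α μ P)
    (hlead : ∀ j, j ≤ B → j ≠ n → coeff (mon ![α, j, μ]) P = 0) {b : ℕ} (hb : b ≤ B) :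
    coeff (mon ![α - 1, b, μ + k]) P' = coeff (mon ![α - 1, b, μ + k]) P +
      coeff (mon ![α, n, μ]) P * if b = n then α * coeff (mon ![0, k]) (T 0) else 0 := by
  have hk := hT.pos
  have h1 := (h.step hT (by omega) (by omega) hP hlead).coeff_eq_zero (a := α - 1) (b := b) (c := μ + k)
    (by omega)
  rw [map_sub, map_sub, map_add, coeff_C_mul, coeff_C_mul,
    ((h.above hP).sup_shift (k := k)).coeff_eq_zero (a := α - 1) (b := b) (c := μ + k) (by omega),
    coeff_linearPart_shifted (by omega) hk] at h1
  linear_combination h1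

/-- The term with factor `k + 1` comes from `τ^k P'`, whose corner coefficient is that of `P` by
`coeff_low`. -/
theorem IsTransform.coeff_top (h : IsTransform T P P') (hT : IsNearIdentity k 1 T)
    (hα : 1 ≤ α) (hαμ : 2 ≤ α + μ) (hP : Above α μ P)
    (hlead : ∀ j, j ≤ B → j ≠ n → coeff (mon ![α, j, μ]) P = 0) {b : ℕ} (hb : b ≤ B) :
    coeff (mon ![α, b, μ + k]) P' = coeff (mon ![α, b, μ + k]) P +
      coeff (mon ![α, n, μ]) P *
      ((if b = n then α * coeff (mon ![1, k]) (T 0) + μ * coeff (mon ![0, k + 1]) (T 1) -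
        (k + 1) * starRingEnd ℂ (coeff (mon ![0, k + 1]) (T 1)) else 0) +
      if n ≤ b then n * starRingEnd ℂ (coeff (mon ![b + 1 - n, k]) (T 0)) else 0) := by
  have hk := hT.pos
  have h1 := (h.step hT hα hαμ hP hlead).coeff_eq_zero (a := α) (b := b) (c := μ + k)
    (by omega)
  have h2 := coeff_mon_X_pow_mul 0 0 k α b μ P'
  rw [pow_zero, pow_zero, one_mul, one_mul, zero_add, zero_add, add_comm k,
    h.coeff_low hT hα hαμ hP hlead hb (by omega)] at h2
  have h3 : coeff (mon ![α, b, μ]) P = if b = n then coeff (mon ![α, n, μ]) P else 0 := by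
    split_ifs with hbn
    · rw [hbn]
    · exact hlead b hb hbn
  -- The boundary case `b + 1 = n` involves the coefficient of `z^0 w^k` in `F`, which vanishes for
  -- `δ = 1`.
  have h4 : (if n ≤ b + 1 then (n : ℂ) * starRingEnd ℂ (coeff (mon ![b + 1 - n, k]) (T 0)) else 0) =
      if n ≤ b then (n : ℂ) * starRingEnd ℂ (coeff (mon ![b + 1 - n, k]) (T 0)) else 0 := by
    by_cases hb1 : n ≤ b
    · rw [if_pos hb1, if_pos (by omega)]
    · rw [if_neg hb1]
      split_ifs with hb2
      · have : coeff (mon ![b + 1 - n, k]) (T 0) = 0 := by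
          rw [← coeff_fst_sub hk]
          refine hT.fst.coeff_eq_zero ?_
          simp [mon_apply]
          omega
        rw [this, map_zero, mul_zero]
      · rfl
  rw [map_sub, map_sub, map_add, coeff_C_mul, coeff_C_mul, h2, h3,
    coeff_linearPart_top hα hk, h4] at h1
  split_ifs at h1 ⊢ <;> linear_combination h1

end Extraction

end
end FormalHypersurface


namespace FormalHypersurface
open MvPowerSeries

noncomputable section

/-! ### Transformation of the order and of the lowest coefficient -/

section Leading

variable {T : Fin 2 → MvPowerSeries (Fin 2) ℂ} {P P' : MvPowerSeries (Fin 3) ℂ} {α μ n : ℕ}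

/-- `P` has order `n` in `χ` at its lowest exponents `(α, μ)`. -/
structure Leading (α n μ : ℕ) (P : MvPowerSeries (Fin 3) ℂ) : Prop where
  above : Above α μ P
  ne_zero : coeff (mon ![α, n, μ]) P ≠ 0
  eq_zero : ∀ j < n, coeff (mon ![α, j, μ]) P = 0

/-- The series `F(χ, 0)` in the variables `z, χ, τ`. -/
abbrev restr (F : MvPowerSeries (Fin 2) ℂ) : MvPowerSeries (Fin 3) ℂ := subst ![X 1, 0] F

theorem vanish_restr : Vanish (![X 1, 0] : Fin 2 → MvPowerSeries (Fin 3) ℂ) := by simp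

theorem constantCoeff_restr {F : MvPowerSeries (Fin 2) ℂ} (hF : constantCoeff F = 0) :
    constantCoeff (restr F) = 0 := by
  rw [constantCoeff_subst_vanish vanish_restr, hF]

theorem sup_restr_of {F : MvPowerSeries (Fin 2) ℂ} {R : ℕ → ℕ → Prop}
    (hF : Supp (fun d => R (d 0) (d 1)) F) :
    Sup (fun a b c => a = 0 ∧ R b 0 ∧ c = 0) (restr F) := by
  refine Sup.subst₂ vanish_restr hF fun i j hij => ?_
  rcases Nat.eq_zero_or_pos j with rfl | hj
  · rw [pow_zero, mul_one]
    exact sup_X_one_pow i ⟨rfl, hij, rfl⟩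
  · rw [zero_pow hj.ne', mul_zero]; exact Sup.zero

theorem sup_restr {F : MvPowerSeries (Fin 2) ℂ} (hF : constantCoeff F = 0) :
    Sup (fun _ b _ => 1 ≤ b) (restr F) :=
  (sup_restr_of (R := fun i j => 1 ≤ i + j) (supp_of_constantCoeff_eq_zero hF)).imp
    (by intros; omega)

theorem sup_restr_sub_linear {F : MvPowerSeries (Fin 2) ℂ} (hF : constantCoeff F = 0) :
    Sup (fun _ b _ => 2 ≤ b) (restr F - C (coeff (mon ![1, 0]) F) * X 1) := by
  have e : restr F - C (coeff (mon ![1, 0]) F) * X 1 =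
      restr (F - C (coeff (mon ![1, 0]) F) * X 0) := by
    rw [restr, restr, subst_sub vanish_restr.hasSubst, subst_mul vanish_restr.hasSubst, subst_C,
      subst_X vanish_restr.hasSubst]
    simp
  rw [e]
  exact (sup_restr_of (R := fun i j => 1 ≤ j ∨ 2 ≤ i) (supp_sub_linear' hF)).imp
    (by intros; omega)

theorem IsTransform.coeff_lead_eq (h : IsTransform T P P') (hP : Above α μ P) (hα : 1 ≤ α)
    (hαμ : 2 ≤ α + μ) (j : ℕ) :
    coeff (mon ![0, 1]) (T 1) * coeff (mon ![α, j, μ]) P' =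
      coeff (mon ![1, 0]) (T 0) ^ α * coeff (mon ![0, 1]) (T 1) ^ μ *
        coeff (mon ![0, j, 0]) (subst (fun _ : Unit => restr (conj (T 0))) (cf P α μ)) := by
  have h1 := (h.lead hP hα hαμ).coeff_eq_zero (a := α) (b := j) (c := μ) (by omega)
  have h2 := coeff_mon_X_pow_mul α 0 μ 0 j 0
    (subst (fun _ : Unit => restr (conj (T 0))) (cf P α μ))
  rw [add_zero, zero_add, add_zero] at h2
  have e : (C (coeff (mon ![1, 0]) (T 0)) * X 0) ^ α * (C (coeff (mon ![0, 1]) (T 1)) * X 2) ^ μ *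
        subst (fun _ : Unit => restr (conj (T 0))) (cf P α μ) =
      C (coeff (mon ![1, 0]) (T 0) ^ α * coeff (mon ![0, 1]) (T 1) ^ μ) *
        (X 0 ^ α * X 1 ^ 0 * X 2 ^ μ * subst (fun _ : Unit => restr (conj (T 0))) (cf P α μ)) := by
    rw [map_mul, map_pow, map_pow]; ring
  rw [map_sub, e, coeff_C_mul, coeff_C_mul, h2] at h1
  linear_combination h1

theorem sup_subst_unit_sub {p : MvPowerSeries Unit ℂ} {F : MvPowerSeries (Fin 2) ℂ}
    (hF : constantCoeff F = 0) (hp : ∀ j < n, coeff (Finsupp.single () j) p = 0) :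
    Sup (fun _ b _ => n + 1 ≤ b) (subst (fun _ : Unit => restr F) p -
      C (coeff (Finsupp.single () n) p * coeff (mon ![1, 0]) F ^ n) * X 1 ^ n) := by
  have hv := vanish_unit (constantCoeff_restr hF)
  set ψ := restr F with hψ
  set a := coeff (mon ![1, 0]) F with ha
  set c := coeff (Finsupp.single () n) p with hc
  have e : subst (fun _ : Unit => ψ) p - C (c * a ^ n) * X 1 ^ n =
      subst (fun _ : Unit => ψ) (p - C c * X () ^ n) + C c * (ψ ^ n - (C a * X 1) ^ n) := by
    rw [subst_sub hv.hasSubst, subst_mul hv.hasSubst, subst_C, subst_pow hv.hasSubst,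
      subst_X hv.hasSubst, map_mul, map_pow]
    ring
  rw [e]
  refine Sup.add (Sup.subst_unit (S := fun j => n + 1 ≤ j) (constantCoeff_restr hF) ?_
    fun j hj => ((sup_restr hF).pow_mid j).imp (by intros; omega)) (Sup.C_mul ?_ _)
  · intro d hd
    by_contra hlt
    apply hd
    have hds : d = Finsupp.single () (d ()) := by ext; simp
    rw [map_sub, coeff_C_mul, coeff_X_pow]
    rcases Nat.lt_or_ge (d ()) n with h1 | h1
    · rw [if_neg (fun h => by rw [h] at h1; simp at h1), hds, hp _ h1]; simp
    · have h2 : d () = n := by omega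
      rw [hds, h2, if_pos rfl, ← hc]; simp
  · refine Sup.pow_sub (sup_restr_sub_linear hF) (S' := fun m _ b _ => m ≤ b) (fun i j => ?_) n
      (by intros; omega)
    exact Sup.mul ((sup_restr hF).pow_mid i)
      (Sup.pow_mid ((sup_X_one (S := fun _ b _ => 1 ≤ b) le_rfl).C_mul a) j) (by intros; omega)

/-- Composing with `F̄(χ, 0) = ā χ + ⋯` keeps the order `n` and multiplies the lowest coefficient by
`ā^n`. -/
theorem IsTransform.leading (h : IsTransform T P P') (hP : Leading α n μ P) (hα : 1 ≤ α)
    (hαμ : 2 ≤ α + μ) :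
    Leading α n μ P' ∧ coeff (mon ![1, 0]) (T 0) ^ α *
      starRingEnd ℂ (coeff (mon ![1, 0]) (T 0)) ^ n * coeff (mon ![0, 1]) (T 1) ^ μ *
        coeff (mon ![α, n, μ]) P = coeff (mon ![0, 1]) (T 1) * coeff (mon ![α, n, μ]) P' := by
  obtain ⟨-, -, ha, hr⟩ := h.linear
  have hl := h.coeff_lead_eq hP.above hα hαμ
  have hs := sup_subst_unit_sub (n := n) (p := cf P α μ)
    (constantCoeff_eq_zero_of_conj (h.bihol.1 0)) fun j hj => by rw [coeff_cf]; exact hP.eq_zero j hj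
  rw [coeff_cf, coeff_conj] at hs
  have hX : Sup (fun _ b _ => b = n) ((X 1 : MvPowerSeries (Fin 3) ℂ) ^ n) := sup_X_one_pow n rfl
  have hXn : coeff (mon ![0, n, 0]) ((X 1 : MvPowerSeries (Fin 3) ℂ) ^ n) = 1 := by
    rw [coeff_X_pow, if_pos]
    ext l; fin_cases l <;> simp [mon_apply]
  have hn : coeff (mon ![1, 0]) (T 0) ^ α *
      starRingEnd ℂ (coeff (mon ![1, 0]) (T 0)) ^ n * coeff (mon ![0, 1]) (T 1) ^ μ *
        coeff (mon ![α, n, μ]) P = coeff (mon ![0, 1]) (T 1) * coeff (mon ![α, n, μ]) P' := by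
    have h1 := hs.coeff_eq_zero (a := 0) (b := n) (c := 0) (by omega)
    rw [map_sub, coeff_C_mul, hXn, sub_eq_zero] at h1
    rw [hl n, h1]
    ring
  refine ⟨⟨h.above hP.above, fun h0 => ?_, fun j hj => ?_⟩, hn⟩
  · rw [h0, mul_zero] at hn
    have hc : starRingEnd ℂ (coeff (mon ![1, 0]) (T 0)) ≠ 0 := by simpa using ha
    exact mul_ne_zero (mul_ne_zero (mul_ne_zero (pow_ne_zero _ ha) (pow_ne_zero _ hc))
      (pow_ne_zero _ hr)) hP.ne_zero hn
  · have h1 := hs.coeff_eq_zero (a := 0) (b := j) (c := 0) (by omega)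
    rw [map_sub, coeff_C_mul, hX.coeff_eq_zero (by omega), mul_zero, sub_zero] at h1
    have h2 := hl j
    rw [h1, mul_zero] at h2
    exact (mul_eq_zero.1 h2).resolve_left hr

end Leading

/-! ### Two invariant pairs -/

section Pairs

variable {ρ : MvPowerSeries (Fin 4) ℂ} {H H' : Fin 2 → MvPowerSeries (Fin 2) ℂ}
  {φ Q Q' : MvPowerSeries (Fin 3) ℂ} {α n μ α₁ n₁ μ₁ : ℕ}

theorem exists_transition (hH : IsFormalBihol H) (hH' : IsFormalBihol H') :
    ∃ T, IsFormalBihol T ∧ H' = comp H T := by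
  obtain ⟨S, hS, h1, h2⟩ := exists_inverse hH
  exact ⟨comp S H', hS.comp hH', by rw [← comp_assoc hS.1 hH'.1, h1, X_comp hH'.1]⟩

theorem IsNormalCoordinates.bihol (h : IsNormalCoordinates ρ H) : IsFormalBihol H := by
  obtain ⟨φ, hφ⟩ := h
  exact hφ.bihol

theorem IsNormalCoordinates.isTransform (hρ : IsFormalHypersurface ρ)
    {T : Fin 2 → MvPowerSeries (Fin 2) ℂ} (h : IsNormalCoordinates ρ H)
    (hC : IsComplexEquation ρ H Q) (hT : IsFormalBihol T) (h' : IsNormalCoordinates ρ (comp H T))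
    (hC' : IsComplexEquation ρ (comp H T) Q') : IsTransform T (Q - X 2) (Q' - X 2) := by
  obtain ⟨φ, hφ⟩ := h
  obtain ⟨φ', hφ'⟩ := h'
  exact FormalHypersurface.isTransform hρ hφ hC hT hφ' hC'

theorem IsInvariantPair.above (h : IsInvariantPair φ α μ) : Above α μ φ := by
  intro d hd
  by_contra hc
  push Not at hc
  have h1 := h.2 (d 0) (d 2) ⟨by simp only; omega, by simp only; omega, by
    intro h; exact hc.1 (by simpa using congrArg Prod.fst h) (by simpa using congrArg Prod.snd h)⟩
  apply hd
  have h2 := congrArg (PowerSeries.coeff (d 1)) h1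
  rw [cf, PowerSeries.coeff_mk] at h2
  rw [eq_mon₃ d]
  exact h2.trans (map_zero _)

/-- By reality the coefficients at `(α, n, μ)` and `(n, α, μ)` are conjugate. The second would lie
below the corner if `n < α`, so `α ≤ n`. -/
theorem exists_leading (hρ : IsFormalHypersurface ρ) (h : (α, n, μ) ∈ Lam ρ) :
    ∃ H Q, IsNormalCoordinates ρ H ∧ IsComplexEquation ρ H Q ∧ Leading α n μ (Q - X 2) ∧
      1 ≤ α ∧ α ≤ n := by
  obtain ⟨H, φ, hφ, hp, hn, hl⟩ := h
  simp only [Set.mem_ofPred_eq, cf, PowerSeries.coeff_mk] at hp hn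
  obtain ⟨Q, hQ⟩ := hφ.exists_complex hρ
  have ha := hp.above
  refine ⟨H, Q, ⟨φ, hφ⟩, hQ, ⟨hQ.above hφ hρ ha, ?_, fun j hj => ?_⟩, ?_, ?_⟩
  · rw [hQ.coeff_lead hφ hρ ha]
    exact mul_ne_zero (by simp) hn
  · rw [hQ.coeff_lead hφ hρ ha]
    have : coeff (mon ![α, j, μ]) φ = 0 := by
      by_contra h0
      have := hl (show j ∈ {j : ℕ | PowerSeries.coeff j (cf φ α μ) ≠ 0} by
        simpa [cf, PowerSeries.coeff_mk] using h0)
      simp only at this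
      omega
    rw [this, mul_zero]
  · by_contra h0
    exact hn (by rw [show α = 0 by omega]; exact hφ.normal_right _ _)
  · by_contra h0
    have h1 := hφ.real α n μ
    rw [ha.coeff_eq_zero (a := n) (b := α) (c := μ) (by omega), map_zero] at h1
    exact hn h1

theorem Leading.of_normal (hρ : IsFormalHypersurface ρ) (h : IsNormalCoordinates ρ H)
    (hC : IsComplexEquation ρ H Q) (h' : IsNormalCoordinates ρ H')
    (hC' : IsComplexEquation ρ H' Q') (hα : 1 ≤ α) (hαμ : 2 ≤ α + μ)
    (hP : Leading α n μ (Q - X 2)) : Leading α n μ (Q' - X 2) := by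
  obtain ⟨T, hT, rfl⟩ := exists_transition h.bihol h'.bihol
  exact ((h.isTransform hρ hC hT h' hC').leading hP hα hαμ).1

theorem Above.of_normal (hρ : IsFormalHypersurface ρ) (h : IsNormalCoordinates ρ H)
    (hC : IsComplexEquation ρ H Q) (h' : IsNormalCoordinates ρ H')
    (hC' : IsComplexEquation ρ H' Q')
    (hP : Above α μ (Q - X 2)) : Above α μ (Q' - X 2) := by
  obtain ⟨T, hT, rfl⟩ := exists_transition h.bihol h'.bihol
  exact (h.isTransform hρ hC hT h' hC').above hP

/-- Two distinct invariant pairs and their orders. -/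
structure TwoPairs (ρ : MvPowerSeries (Fin 4) ℂ) (α n μ α₁ n₁ μ₁ : ℕ) : Prop where
  hypersurface : IsFormalHypersurface ρ
  pos : 1 ≤ α
  pos' : 1 ≤ α₁
  two_le : 2 ≤ α + μ
  two_le' : 2 ≤ α₁ + μ₁
  lt : α < n
  le : α₁ ≤ n₁
  one_lt : 1 < α ∨ 1 < α₁
  indep : (μ₁ < μ ∧ α + μ < α₁ + μ₁) ∨ (μ < μ₁ ∧ α₁ + μ₁ < α + μ)
  exists_coordinates : ∃ H, IsNormalCoordinates ρ H
  leading : ∀ H Q, IsNormalCoordinates ρ H → IsComplexEquation ρ H Q → Leading α n μ (Q - X 2)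
  leading' : ∀ H Q, IsNormalCoordinates ρ H → IsComplexEquation ρ H Q →
    Leading α₁ n₁ μ₁ (Q - X 2)

/-- Each pair lies in the support region above the other, so the two are incomparable: one has the
smaller `μ` and the larger `α + μ`. This excludes `α = α₁ = 1` and the pair `(1, 0)`. -/
theorem twoPairs (hρ : IsFormalHypersurface ρ) (h : (α, n, μ) ∈ Lam ρ)
    (h₁ : (α₁, n₁, μ₁) ∈ Lam ρ) (hne : (α, μ) ≠ (α₁, μ₁)) (hαn : α ≠ n) :
    TwoPairs ρ α n μ α₁ n₁ μ₁ := by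
  obtain ⟨H, Q, hH, hQ, hP, hα, hn⟩ := exists_leading hρ h
  obtain ⟨H₁, Q₁, hH₁, hQ₁, hP₁, hα₁, hn₁⟩ := exists_leading hρ h₁
  have hne' : ¬ (α = α₁ ∧ μ = μ₁) := fun h => hne (by rw [h.1, h.2])
  have e1 : μ + 1 ≤ μ₁ ∨ α + μ + 1 ≤ α₁ + μ₁ := by
    have := (hP.above.of_normal hρ hH hQ hH₁ hQ₁) _ hP₁.ne_zero
    simp only [mon_apply, Matrix.cons_val] at this
    omega
  have e2 : μ₁ + 1 ≤ μ ∨ α₁ + μ₁ + 1 ≤ α + μ := by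
    have := (hP₁.above.of_normal hρ hH₁ hQ₁ hH hQ) _ hP.ne_zero
    simp only [mon_apply, Matrix.cons_val] at this
    omega
  exact ⟨hρ, hα, hα₁, by omega, by omega, by omega, hn₁, by omega, by omega, ⟨H, hH⟩,
    fun H' Q' h' hC' => hP.of_normal hρ hH hQ h' hC' hα (by omega),
    fun H' Q' h' hC' => hP₁.of_normal hρ hH₁ hQ₁ h' hC' hα₁ (by omega)⟩

end Pairs

end
end FormalHypersurface


namespace FormalHypersurface
open MvPowerSeries

noncomputable section

/-! ### Construction of coordinate changes -/

section Change

variable {ρ : MvPowerSeries (Fin 4) ℂ} {H : Fin 2 → MvPowerSeries (Fin 2) ℂ}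
  {Q : MvPowerSeries (Fin 3) ℂ}

theorem supp_last_pow {m : ℕ} {f : MvPowerSeries (Fin 2) ℂ} (hf : Supp (fun d => m ≤ d 1) f)
    {i : ℕ} (hi : 1 ≤ i) : Supp (fun d => m ≤ d 1) (f ^ i) := by
  obtain ⟨i, rfl⟩ : ∃ j, i = j + 1 := ⟨i - 1, by omega⟩
  rw [pow_succ]
  exact hf.mul_left (by intro d e h; rw [Finsupp.add_apply]; omega) _

theorem axis_eq (F : MvPowerSeries (Fin 2) ℂ) :
    Supp (fun d => 1 ≤ d 0)
      (F - subst (![0, X 1] : Fin 2 → MvPowerSeries (Fin 2) ℂ) F) := by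
  have h := Supp.subst_sub_of_ideal (T := fun d : Fin 2 →₀ ℕ => 1 ≤ d 0)
    (a := (![X 0, X 1] : Fin 2 → MvPowerSeries (Fin 2) ℂ)) (b := ![0, X 1])
    (Vanish.hasSubst (by simp)) vanish_zero_X.hasSubst
    (by intro d e h; rw [Finsupp.add_apply]; omega) (fun i => ?_) F
  · rwa [subst_X_vec₂] at h
  · fin_cases i
    · simpa using Supp.X (S := fun d : Fin 2 →₀ ℕ => 1 ≤ d 0) (i := 0) (by simp)
    · simpa using Supp.zero (S := fun d : Fin 2 →₀ ℕ => 1 ≤ d 0)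

theorem coeff_axis (F : MvPowerSeries (Fin 2) ℂ) (k : ℕ) :
    coeff (mon ![0, k]) (subst (![0, X 1] : Fin 2 → MvPowerSeries (Fin 2) ℂ) F) =
      coeff (mon ![0, k]) F := by
  have h := (axis_eq F).coeff_eq_zero (d := mon ![0, k]) (by simp [mon_apply])
  rw [map_sub, sub_eq_zero] at h
  exact h.symm

theorem supp_axis {m : ℕ} {f : MvPowerSeries (Fin 2) ℂ}
    (hf : Supp (fun d => d 0 = 0 → m ≤ d 1) f) :
    Supp (fun d => m ≤ d 1) (subst (![0, X 1] : Fin 2 → MvPowerSeries (Fin 2) ℂ) f) := by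
  refine Supp.subst vanish_zero_X.hasSubst fun d hd => ?_
  rw [finsupp_prod_eq, Fin.prod_univ_two]
  rcases Nat.eq_zero_or_pos (d 0) with h0 | h0
  · have := hf d hd h0
    rw [h0, pow_zero, one_mul]
    simp only [Matrix.cons_val]
    rw [X_pow_eq]
    exact Supp.monomial _ (by simpa using this)
  · simp only [Matrix.cons_val]
    rw [zero_pow h0.ne', zero_mul]
    exact Supp.zero

/-- On the axis, `G - p = i φ(F, F̄, p)`. As `φ` is divisible by `z χ`, this has twice the order of
`F(0, w)`, so low coefficients of `G(0, w)` can be prescribed through `p`. -/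
theorem IsNormalCoordinates.exists_change (hρ : IsFormalHypersurface ρ)
    (h : IsNormalCoordinates ρ H) (hC : IsComplexEquation ρ H Q) {F p : MvPowerSeries (Fin 2) ℂ}
    (hF : constantCoeff F = 0) (hF1 : coeff (mon ![1, 0]) F ≠ 0) (hp0 : constantCoeff p = 0)
    (hp : subst (![0, X 1] : Fin 2 → MvPowerSeries (Fin 2) ℂ) p = p) (hpr : conj p = p)
    (hp1 : coeff (mon ![0, 1]) p ≠ 0) :
    ∃ G Q', IsFormalBihol ![F, G] ∧ PreservesNormal Q ![F, G] ∧
      IsNormalCoordinates ρ (comp H ![F, G]) ∧ IsComplexEquation ρ (comp H ![F, G]) Q' ∧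
      ∀ m, Supp (fun d => d 0 = 0 → m ≤ d 1) F →
        Supp (fun d => d 0 = 0 → 2 * m ≤ d 1) (G - p) := by
  obtain ⟨φ, hφ⟩ := h
  obtain ⟨G, hT, hE, hG⟩ := exists_preservesNormal hρ hφ hC hF hF1 hp0 hp hpr hp1
  have hN := isNormalCoordinates_of_preservesNormal hρ hφ hC hT hE
  obtain ⟨Q', hQ'⟩ : ∃ Q', IsComplexEquation ρ (comp H ![F, G]) Q' := by
    obtain ⟨φ', hφ'⟩ := hN
    exact hφ'.exists_complex hρ
  refine ⟨G, Q', hT, hE, hN, hQ', fun m hm => ?_⟩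
  have hv : Vanish ![subst (![0, X 1] : Fin 2 → MvPowerSeries (Fin 2) ℂ) F,
      subst (![0, X 1] : Fin 2 → MvPowerSeries (Fin 2) ℂ) (conj F), p] := by
    simp [constantCoeff_subst_vanish vanish_zero_X, hF, hp0]
  have hE2 : Supp (fun d => 2 * m ≤ d 1)
      (subst (![0, X 1] : Fin 2 → MvPowerSeries (Fin 2) ℂ) G - p) := by
    rw [hG, add_sub_cancel_left]
    refine (Supp.subst hv.hasSubst fun d hd => ?_).C_mul _
    obtain ⟨h0, h1⟩ := hφ.supp d hd
    rw [finsupp_prod_eq, Fin.prod_univ_three]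
    simp only [Matrix.cons_val]
    refine Supp.mul_right (Supp.mul (supp_last_pow (supp_axis hm) h0)
      (supp_last_pow (supp_axis hm.conj) h1) ?_) ?_ _
    · intro d e h1 h2; rw [Finsupp.add_apply]; omega
    · intro d e h1; rw [Finsupp.add_apply]; omega
  have e : G - p = (G - subst (![0, X 1] : Fin 2 → MvPowerSeries (Fin 2) ℂ) G) +
      (subst (![0, X 1] : Fin 2 → MvPowerSeries (Fin 2) ℂ) G - p) := by ring
  rw [e]
  exact Supp.add ((axis_eq G).mono (by intros; omega)) (hE2.mono (by intros; omega))

theorem coeff_linear_of_axis {G p : MvPowerSeries (Fin 2) ℂ}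
    (h : Supp (fun d => d 0 = 0 → 2 ≤ d 1) (G - p)) :
    coeff (mon ![0, 1]) G = coeff (mon ![0, 1]) p := by
  have := h.coeff_eq_zero (d := mon ![0, 1]) (by simp [mon_apply])
  rwa [map_sub, sub_eq_zero] at this

theorem supp_axis_of_constantCoeff {F : MvPowerSeries (Fin 2) ℂ} (hF : constantCoeff F = 0) :
    Supp (fun d => d 0 = 0 → 1 ≤ d 1) F :=
  (supp_of_constantCoeff_eq_zero hF).mono fun d hd h0 => by omega

/-- Any layer of `F` and, for `δ = 1`, any real coefficient of `w^{k+1}` in `G(0, w)` can be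
prescribed. The final order estimate is for the convergence of infinitely many such changes. -/
theorem IsNormalCoordinates.exists_nearIdentity (hρ : IsFormalHypersurface ρ)
    (h : IsNormalCoordinates ρ H) (hC : IsComplexEquation ρ H Q) {k δ : ℕ} (hk : 1 ≤ k)
    (hδ : δ ≤ 1) {F : MvPowerSeries (Fin 2) ℂ}
    (hF : Supp (fun d => k ≤ d 1 ∧ k + δ ≤ d 0 + d 1) (F - X 0)) (r : ℝ) :
    ∃ G Q', IsFormalBihol ![F, G] ∧ IsNearIdentity k δ ![F, G] ∧
      IsNormalCoordinates ρ (comp H ![F, G]) ∧ IsComplexEquation ρ (comp H ![F, G]) Q' ∧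
      (δ = 1 → coeff (mon ![0, k + 1]) G = r) ∧ ∀ i, Ord k ((![F, G] : Fin 2 → _) i - X i) := by
  set p : MvPowerSeries (Fin 2) ℂ := X 1 + C (r : ℂ) * X 1 ^ (k + 1) with hp
  have hF0 : constantCoeff F = 0 := by
    have := hF.coeff_eq_zero (d := 0) (by simp; omega)
    simpa [coeff_zero_eq_constantCoeff_apply] using this
  have hF1 : coeff (mon ![1, 0]) F = 1 := by
    have := hF.coeff_eq_zero (d := mon ![1, 0]) (by simp [mon_apply]; omega)
    rw [map_sub, ← single_eq_mon₂_zero, coeff_index_single_self_X, sub_eq_zero] at this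
    rw [← single_eq_mon₂_zero, this]
  have hpv : subst (![0, X 1] : Fin 2 → MvPowerSeries (Fin 2) ℂ) p = p := by
    rw [hp, subst_add vanish_zero_X.hasSubst, subst_mul vanish_zero_X.hasSubst,
      subst_pow vanish_zero_X.hasSubst, subst_C, subst_X vanish_zero_X.hasSubst]
    simp
  have hpr : conj p = p := by
    rw [hp, conj_add, conj_mul, conj_C, conj_X, conj, map_pow, map_X, Complex.conj_ofReal]
  have hX1 : ∀ m, coeff (mon ![0, m]) ((X 1 : MvPowerSeries (Fin 2) ℂ) ^ (k + 1)) =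
      if m = k + 1 then 1 else 0 := by
    intro m
    have : mon ![0, m] = (Finsupp.single 1 m : Fin 2 →₀ ℕ) := by
      ext l; fin_cases l <;> simp [mon_apply]
    rw [coeff_X_pow, this]
    simp only [(Finsupp.single_injective (1 : Fin 2)).eq_iff]
  have hX1' : ∀ m, coeff (mon ![0, m]) (X 1 : MvPowerSeries (Fin 2) ℂ) =
      if m = 1 then 1 else 0 := by
    intro m
    have : mon ![0, m] = (Finsupp.single 1 m : Fin 2 →₀ ℕ) := by
      ext l; fin_cases l <;> simp [mon_apply]
    rw [coeff_X, this]
    simp only [(Finsupp.single_injective (1 : Fin 2)).eq_iff]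
  obtain ⟨G, Q', hT, hE, hN, hQ', hG⟩ := h.exists_change hρ hC hF0 (by rw [hF1]; exact one_ne_zero)
    (p := p) (by simp [hp]) hpv hpr (by
      rw [hp, map_add, coeff_C_mul, hX1, hX1', if_pos rfl, if_neg (by omega)]; simp)
  have hax : Supp (fun d => d 0 = 0 → k + δ ≤ d 1) F := by
    have e : F = (F - X 0) + X 0 := by ring
    rw [e]
    refine Supp.add (hF.mono (by intros; omega)) (Supp.X (by simp))
  -- The correction has order `2(k + δ)`: at least `k + 1`, and beyond `k + 1` when `δ = 1`.
  have hG1 := hG (k + δ) hax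
  have hpX : Supp (fun d => d 0 = 0 → k + 1 ≤ d 1) (p - X 1) := by
    rw [hp, add_sub_cancel_left, X_pow_eq]
    exact (Supp.monomial _ (by simp)).C_mul _
  have hsnd : Supp (fun d => d 0 = 0 → k + 1 ≤ d 1) (G - X 1) := by
    have e : G - X 1 = (G - p) + (p - X 1) := by ring
    rw [e]
    exact (hG1.mono (by intros; omega)).add hpX
  refine ⟨G, Q', hT, ⟨hk, hδ, hF, hsnd⟩, hN, hQ', fun hδ1 => ?_, fun i => ?_⟩
  · have h1 := hG1.coeff_eq_zero (d := mon ![0, k + 1]) (by simp [mon_apply]; omega)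
    rw [map_sub, sub_eq_zero, hp, map_add, coeff_C_mul, hX1, hX1', if_pos rfl, if_neg (by omega)]
      at h1
    simpa using h1
  · fin_cases i
    · refine hF.mono fun d hd => ?_
      rw [degree_eq_sum', Fin.sum_univ_two]
      omega
    · obtain ⟨φ, hφ⟩ := h
      have hv := PreservesNormal.vanish hT.1
      have hE' : G = subst (![0, X 1] : Fin 2 → MvPowerSeries (Fin 2) ℂ) (conj G) +
          subst ![F, subst (![0, X 1] : Fin 2 → MvPowerSeries (Fin 2) ℂ) (conj F),
            subst (![0, X 1] : Fin 2 → MvPowerSeries (Fin 2) ℂ) (conj G)] (Q - X 2) :=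
        hE.trans (subst_sub_X hv Q)
      -- Off the axis, `G - w` is a value of `Q - τ`, each monomial of which contains the factor
      -- `F̄(0, w)` of order `k + δ`.
      have e : G - X 1 = subst (![0, X 1] : Fin 2 → MvPowerSeries (Fin 2) ℂ) (conj (G - X 1)) +
          subst ![F, subst (![0, X 1] : Fin 2 → MvPowerSeries (Fin 2) ℂ) (conj F),
            subst (![0, X 1] : Fin 2 → MvPowerSeries (Fin 2) ℂ) (conj G)] (Q - X 2) := by
        conv_lhs => rw [hE']
        rw [conj_sub, conj_X, subst_sub vanish_zero_X.hasSubst, subst_X vanish_zero_X.hasSubst]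
        simp only [Matrix.cons_val]
        ring
      have hdeg : ∀ d : Fin 2 →₀ ℕ, k ≤ d 1 → k ≤ d.degree := fun d hd => by
        rw [degree_eq_sum', Fin.sum_univ_two]; omega
      change Ord k (G - X 1)
      rw [e]
      refine Supp.add ?_ ?_
      · exact (supp_axis hsnd.conj).mono fun d hd => hdeg d (by omega)
      · refine Supp.subst hv.hasSubst fun d hd => ?_
        obtain ⟨-, h1⟩ := hC.supp hφ hρ d hd
        rw [finsupp_prod_eq, Fin.prod_univ_three]
        simp only [Matrix.cons_val]
        refine Supp.mul_right (Supp.mul_left ?_ (ord_upward k) _) (ord_upward k) _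
        exact (supp_last_pow (supp_axis hax.conj) h1).mono fun d hd => hdeg d (by omega)

end Change

end
end FormalHypersurface


namespace FormalHypersurface
open MvPowerSeries

noncomputable section

/-! ### Making the leading coefficient a monomial -/

section Root

theorem coeff_single_mul {σ : Type*} (f g : MvPowerSeries σ ℂ) (j : σ) :
    coeff (Finsupp.single j 1) (f * g) = constantCoeff f * coeff (Finsupp.single j 1) g +
      coeff (Finsupp.single j 1) f * constantCoeff g := by
  have e : f * g = C (constantCoeff f) * g + C (constantCoeff g) * (f - C (constantCoeff f)) +
      (f - C (constantCoeff f)) * (g - C (constantCoeff g)) := by ring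
  have h : Ord 2 ((f - C (constantCoeff f)) * (g - C (constantCoeff g))) := by
    refine Supp.mul (ord_one_iff.2 (by simp)) (ord_one_iff.2 (by simp)) ?_
    intro d e h1 h2
    rw [map_add]; omega
  have hC : coeff (Finsupp.single j 1) (C (constantCoeff f) : MvPowerSeries σ ℂ) = 0 := by
    classical
    rw [coeff_C, if_neg (by simp)]
  conv_lhs => rw [e]
  rw [map_add, map_add, coeff_C_mul, coeff_C_mul, coeff_single_eq_zero_of_ord_two h, map_sub, hC]
  ring

theorem coeff_single_pow_one_add {σ : Type*} (f : MvPowerSeries σ ℂ) (hf : constantCoeff f = 1)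
    (j : σ) (n : ℕ) :
    coeff (Finsupp.single j 1) (f ^ n) = n * coeff (Finsupp.single j 1) f := by
  induction n with
  | zero =>
    classical
    rw [pow_zero, coeff_one, if_neg (by simp)]; simp
  | succ n ih =>
    rw [pow_succ, coeff_single_mul, ih, map_pow, hf, Nat.cast_add, Nat.cast_one]
    ring

/-- A power series of order `n` becomes a monomial after a change of the variable. -/
theorem exists_root {p : MvPowerSeries Unit ℂ} {n : ℕ} (hn : 1 ≤ n)
    (hp : ∀ j < n, coeff (Finsupp.single () j) p = 0) (hpn : coeff (Finsupp.single () n) p ≠ 0)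
    (a : ℂ) :
    ∃ F : MvPowerSeries (Fin 2) ℂ, constantCoeff F = 0 ∧ coeff (mon ![1, 0]) F = a ∧
      subst (fun _ : Unit => restr (conj F)) p =
        C (starRingEnd ℂ a ^ n * coeff (Finsupp.single () n) p) * X 1 ^ n := by
  set u := coeff (Finsupp.single () n) p with hu
  obtain ⟨v, rfl⟩ : X () ^ n ∣ p := by
    rw [X_pow_dvd_iff]
    intro m hm
    have : m = Finsupp.single () (m ()) := by ext; simp
    rw [this]
    exact hp _ hm
  have hv0 : constantCoeff v = u := by
    rw [hu, X_pow_eq, ← coeff_zero_eq_constantCoeff_apply]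
    have := coeff_add_monomial_mul (Finsupp.single () n) 0 v (1 : ℂ)
    rw [add_zero, one_mul] at this
    exact this.symm
  set b := starRingEnd ℂ a with hb
  -- With `p = χ^n v`, the series `F̄(χ, 0)` is sought as `b χ (1 + s)`, so that `(1 + s)^n v(b χ (1
  -- + s)) = v(0)` has to be solved for `s`. The derivative in `s` at the origin is `n v(0) ≠ 0`;
  -- the two middle variables are dummies.
  set A : MvPowerSeries (Fin 4) ℂ := C b * X 0 * (1 + X 3) with hA
  have hA0 : constantCoeff A = 0 := by simp [hA]
  set E : MvPowerSeries (Fin 4) ℂ := (1 + X 3) ^ n * subst (fun _ : Unit => A) v - C u with hE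
  have hvA := vanish_unit hA0
  have hE0 : constantCoeff E = 0 := by
    simp [hE, constantCoeff_subst_vanish hvA, hv0]
  have hE3 : coeff (Finsupp.single 3 1) E ≠ 0 := by
    have h1 : coeff (Finsupp.single 3 1) A = 0 := by
      rw [hA, coeff_single_mul, coeff_single_mul]
      simp [coeff_X, Finsupp.single_left_inj]
    have h2 : coeff (Finsupp.single (3 : Fin 4) 1) (1 + X 3 : MvPowerSeries (Fin 4) ℂ) = 1 := by
      rw [map_add, coeff_index_single_self_X, coeff_one, if_neg (by simp), zero_add]
    rw [hE, map_sub, coeff_single_mul, coeff_single_subst hvA, coeff_single_pow_one_add _ (by simp),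
      constantCoeff_subst_vanish hvA, hv0, coeff_C, if_neg (by simp), h1, h2]
    simp [hpn]
    omega
  obtain ⟨t, -, ht0, -, -, ht⟩ := exists_implicit hE0 hE3
  set s : MvPowerSeries (Fin 2) ℂ := subst ![X 0, 0, 0] t with hs
  have hv3 : Vanish (![X 0, 0, 0] : Fin 3 → MvPowerSeries (Fin 2) ℂ) := by simp
  have hs0 : constantCoeff s = 0 := by rw [hs, constantCoeff_subst_vanish hv3, ht0]
  have hv4 : Vanish (![X 0, X 1, X 2, t] : Fin 4 → MvPowerSeries (Fin 3) ℂ) := by simp [ht0]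
  set θ : MvPowerSeries (Fin 2) ℂ := C b * X 0 * (1 + s) with hθ
  have hθ0 : constantCoeff θ = 0 := by simp [hθ]
  have key : (1 + s) ^ n * subst (fun _ : Unit => θ) v = C u := by
    have h1 := congrArg (subst (![X 0, 0, 0] : Fin 3 → MvPowerSeries (Fin 2) ℂ)) ht
    rw [subst_vec₄ hv3 hv4] at h1
    have hw : Vanish (![X 0, 0, 0, s] : Fin 4 → MvPowerSeries (Fin 2) ℂ) := by simp [hs0]
    have e : (![subst (![X 0, 0, 0] : Fin 3 → MvPowerSeries (Fin 2) ℂ) (X 0 : MvPowerSeries (Fin 3) ℂ),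
        subst (![X 0, 0, 0] : Fin 3 → MvPowerSeries (Fin 2) ℂ) (X 1 : MvPowerSeries (Fin 3) ℂ),
        subst (![X 0, 0, 0] : Fin 3 → MvPowerSeries (Fin 2) ℂ) (X 2 : MvPowerSeries (Fin 3) ℂ),
        subst (![X 0, 0, 0] : Fin 3 → MvPowerSeries (Fin 2) ℂ) t] : Fin 4 → MvPowerSeries (Fin 2) ℂ) =
        ![X 0, 0, 0, s] := by
      rw [subst_X hv3.hasSubst, subst_X hv3.hasSubst, subst_X hv3.hasSubst, ← hs]
      rfl
    have h3 : subst (![X 0, 0, 0, s] : Fin 4 → MvPowerSeries (Fin 2) ℂ)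
        (1 + X 3 : MvPowerSeries (Fin 4) ℂ) = 1 + s := by
      rw [subst_add hw.hasSubst, subst_X hw.hasSubst, ← map_one C, subst_C]; rfl
    have h4 : subst (![X 0, 0, 0, s] : Fin 4 → MvPowerSeries (Fin 2) ℂ) A = θ := by
      rw [hA, subst_mul hw.hasSubst, subst_mul hw.hasSubst, h3, subst_C, subst_X hw.hasSubst]; rfl
    have h5 : subst (![X 0, 0, 0] : Fin 3 → MvPowerSeries (Fin 2) ℂ) (0 : MvPowerSeries (Fin 3) ℂ) = 0 := by
      rw [← coe_substAlgHom hv3.hasSubst, map_zero]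
    rw [e, hE, subst_sub hw.hasSubst, subst_mul hw.hasSubst, subst_pow hw.hasSubst, h3, subst_C,
      subst_subst hvA hw, h4, h5, sub_eq_zero] at h1
    exact h1
  refine ⟨conj θ, by simp [hθ0], ?_, ?_⟩
  · rw [coeff_conj, hθ, ← single_eq_mon₂_zero, coeff_single_mul, coeff_single_mul]
    simp [hs0, coeff_index_single_self_X, hb]
  · rw [conj_conj]
    have hr := vanish_unit (constantCoeff_restr hθ0)
    rw [subst_mul hr.hasSubst, subst_pow hr.hasSubst, subst_X hr.hasSubst]
    have h6 : restr ((1 + s) ^ n * subst (fun _ : Unit => θ) v) = C u := by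
      rw [key, restr, subst_C]
    have h7 : restr (1 + s) = 1 + restr s := by
      rw [restr, subst_add vanish_restr.hasSubst, ← map_one C, subst_C, map_one]
    rw [restr, subst_mul vanish_restr.hasSubst, subst_pow vanish_restr.hasSubst,
      subst_subst (vanish_unit hθ0) vanish_restr] at h6
    have h8 : restr θ = C b * X 1 * restr (1 + s) := by
      rw [hθ, restr, subst_mul vanish_restr.hasSubst, subst_mul vanish_restr.hasSubst, subst_C,
        subst_X vanish_restr.hasSubst]
      rfl
    change restr (1 + s) ^ n * subst (fun _ : Unit => restr θ) v = C u at h6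
    calc restr θ ^ n * subst (fun _ : Unit => restr θ) v
        = (C b * X 1) ^ n * (restr (1 + s) ^ n * subst (fun _ : Unit => restr θ) v) := by
          conv_lhs => enter [1]; rw [h8]
          rw [mul_pow, mul_assoc]
      _ = _ := by rw [h6, mul_pow, map_mul, map_pow]; ring

end Root

end
end FormalHypersurface


namespace FormalHypersurface
open MvPowerSeries

noncomputable section

/-! ### Attainable leading coefficients -/

section Attained

variable {ρ : MvPowerSeries (Fin 4) ℂ} {H : Fin 2 → MvPowerSeries (Fin 2) ℂ}
  {Q : MvPowerSeries (Fin 3) ℂ} {α n μ α₁ n₁ μ₁ : ℕ} {c : ℝ} {ε : ℂ}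

theorem coeff_sub_X (hα : 1 ≤ α) (j m : ℕ) :
    coeff (mon ![α, j, m]) (Q - X 2) = coeff (mon ![α, j, m]) Q := by
  rw [map_sub, coeff_X, if_neg, sub_zero]
  intro h
  have := DFunLike.congr_fun h 0
  simp [mon_apply] at this
  omega

theorem coeff_cf' (j m : ℕ) : PowerSeries.coeff j (cf Q α m) = coeff (mon ![α, j, m]) Q := by
  rw [cf, PowerSeries.coeff_mk]

theorem isPrelimNormalized_iff (hα : 1 ≤ α) (hα₁ : 1 ≤ α₁) :
    IsPrelimNormalized Q α n μ α₁ n₁ μ₁ c ε ↔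
      (∀ j, coeff (mon ![α, j, μ]) (Q - X 2) = if j = n then 2 * Complex.I else 0) ∧
      (∀ j < n₁, coeff (mon ![α₁, j, μ₁]) (Q - X 2) = 0) ∧
      coeff (mon ![α₁, n₁, μ₁]) (Q - X 2) = Complex.I * c * ε := by
  simp only [IsPrelimNormalized, coeff_cf', coeff_sub_X hα, coeff_sub_X hα₁]
  refine and_congr_left' ?_
  rw [PowerSeries.ext_iff]
  simp only [coeff_cf', PowerSeries.coeff_monomial]

/-- `a = F_z(0)` and `r = G_w(0)` for the change from `H` to the coordinates that attain `(c, ε)`;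
these two equations are the only constraint, by the converse `isAttained`. -/
theorem TwoPairs.relation (h : TwoPairs ρ α n μ α₁ n₁ μ₁) (hH : IsNormalCoordinates ρ H)
    (hC : IsComplexEquation ρ H Q) (hat : IsAttained ρ α n μ α₁ n₁ μ₁ c ε) :
    ∃ (a : ℂ) (r : ℝ), a ≠ 0 ∧ r ≠ 0 ∧
      a ^ α * starRingEnd ℂ a ^ n * (r : ℂ) ^ μ * coeff (mon ![α, n, μ]) (Q - X 2) =
        r * (2 * Complex.I) ∧
      a ^ α₁ * starRingEnd ℂ a ^ n₁ * (r : ℂ) ^ μ₁ * coeff (mon ![α₁, n₁, μ₁]) (Q - X 2) =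
        r * (Complex.I * c * ε) := by
  obtain ⟨H', Q', hH', hC', hp⟩ := hat
  rw [isPrelimNormalized_iff h.pos h.pos'] at hp
  obtain ⟨T, hT, rfl⟩ := exists_transition hH.bihol hH'.bihol
  have ht := hH.isTransform h.hypersurface hC hT hH' hC'
  obtain ⟨-, hr, ha, hr0⟩ := ht.linear
  obtain ⟨r, hr'⟩ := Complex.conj_eq_iff_real.1 hr
  have e1 := (ht.leading (h.leading _ _ hH hC) h.pos h.two_le).2
  have e2 := (ht.leading (h.leading' _ _ hH hC) h.pos' h.two_le').2
  rw [hp.1 n, if_pos rfl, hr'] at e1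
  rw [hp.2.2, hr'] at e2
  refine ⟨_, r, ha, ?_, e1, e2⟩
  rintro rfl
  exact hr0 (by rw [hr']; simp)

/-- Along `w = 0`, `F` is taken from `exists_root` with derivative `a`, and `p = r w`; the first
leading coefficient is then exactly a monomial. -/
theorem TwoPairs.isAttained (h : TwoPairs ρ α n μ α₁ n₁ μ₁) (hH : IsNormalCoordinates ρ H)
    (hC : IsComplexEquation ρ H Q) {a : ℂ} {r : ℝ} (ha : a ≠ 0) (hr : r ≠ 0)
    (e1 : a ^ α * starRingEnd ℂ a ^ n * (r : ℂ) ^ μ * coeff (mon ![α, n, μ]) (Q - X 2) =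
        r * (2 * Complex.I))
    (e2 : a ^ α₁ * starRingEnd ℂ a ^ n₁ * (r : ℂ) ^ μ₁ * coeff (mon ![α₁, n₁, μ₁]) (Q - X 2) =
        r * (Complex.I * c * ε)) : IsAttained ρ α n μ α₁ n₁ μ₁ c ε := by
  have hl := h.leading _ _ hH hC
  have hl' := h.leading' _ _ hH hC
  have hr' : (r : ℂ) ≠ 0 := by exact_mod_cast hr
  obtain ⟨F, hF0, hF1, hF⟩ := exists_root (p := cf (Q - X 2) α μ) (n := n) (by have := h.lt; omega)
    (fun j hj => by rw [coeff_cf]; exact hl.eq_zero j hj) (by rw [coeff_cf]; exact hl.ne_zero) a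
  have hX1 : coeff (mon ![0, 1]) (C (r : ℂ) * X 1 : MvPowerSeries (Fin 2) ℂ) = r := by
    rw [coeff_C_mul, ← single_eq_mon₂_one, coeff_index_single_self_X, mul_one]
  obtain ⟨G, Q', hT, -, hN, hQ', hG⟩ := hH.exists_change h.hypersurface hC hF0
    (by rw [hF1]; exact ha) (p := C (r : ℂ) * X 1) (by simp)
    (by rw [subst_mul vanish_zero_X.hasSubst, subst_C, subst_X vanish_zero_X.hasSubst]; rfl)
    (by rw [conj_mul, conj_C, conj_X, Complex.conj_ofReal]) (by rw [hX1]; exact hr')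
  have hGr : coeff (mon ![0, 1]) G = r := by
    rw [coeff_linear_of_axis (hG 1 (supp_axis_of_constantCoeff hF0)), hX1]
  have ht := hH.isTransform h.hypersurface hC hT hN hQ'
  refine ⟨_, Q', hN, hQ', (isPrelimNormalized_iff h.pos h.pos').2 ⟨fun j => ?_, ?_, ?_⟩⟩
  · have h1 := ht.coeff_lead_eq hl.above h.pos h.two_le j
    simp only [Matrix.cons_val] at h1
    rw [hGr, hF1, hF, coeff_C_mul, coeff_X_pow, coeff_cf] at h1
    apply mul_left_cancel₀ hr'
    rw [h1]
    have hm : (mon ![0, j, 0] : Fin 3 →₀ ℕ) = Finsupp.single 1 j := by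
      ext l; fin_cases l <;> simp [mon_apply]
    simp only [hm, (Finsupp.single_injective (1 : Fin 3)).eq_iff]
    split_ifs
    · linear_combination e1
    · ring
  · exact (ht.leading hl' h.pos' h.two_le').1.eq_zero
  · have h1 := (ht.leading hl' h.pos' h.two_le').2
    simp only [Matrix.cons_val] at h1
    rw [hGr, hF1, e2] at h1
    exact (mul_left_cancel₀ hr' h1).symm

end Attained

/-! ### Existence and uniqueness of `c` and `ε` -/

section Constants

variable {ρ : MvPowerSeries (Fin 4) ℂ} {α n μ α₁ n₁ μ₁ : ℕ}

/-- Dividing each relation by its conjugate removes moduli and `r`, and leaves `(ā/a)^{n-α}` and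
`(ā/a)^{n₁-α₁}`, the latter with a factor `ε²`. Raising each to the other exponent eliminates `ā/a`.
-/
theorem TwoPairs.phase (h : TwoPairs ρ α n μ α₁ n₁ μ₁) :
    ∃ κ κ' : ℂ, κ ≠ 0 ∧ ∀ (c : ℝ) (ε : ℂ), 0 < c → ε * starRingEnd ℂ ε = 1 →
      IsAttained ρ α n μ α₁ n₁ μ₁ c ε → κ * ε ^ (2 * (n - α)) = κ' := by
  obtain ⟨H, hH⟩ := h.exists_coordinates
  obtain ⟨φ, hφ⟩ := id hH
  obtain ⟨Q, hC⟩ := hφ.exists_complex h.hypersurface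
  set u := coeff (mon ![α, n, μ]) (Q - X 2) with hu
  set u₁ := coeff (mon ![α₁, n₁, μ₁]) (Q - X 2) with hu₁
  have hu0 : u ≠ 0 := (h.leading _ _ hH hC).ne_zero
  have hu₁0 : u₁ ≠ 0 := (h.leading' _ _ hH hC).ne_zero
  have hlt := h.lt
  have hle := h.le
  refine ⟨(-u / starRingEnd ℂ u) ^ (n₁ - α₁), (-u₁ / starRingEnd ℂ u₁) ^ (n - α), ?_, ?_⟩
  · exact pow_ne_zero _ (div_ne_zero (neg_ne_zero.2 hu0) (by simpa using hu0))
  intro c ε hc hε hat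
  obtain ⟨a, r, ha, hr, e1, e2⟩ := h.relation hH hC hat
  rw [← hu] at e1
  rw [← hu₁] at e2
  set b := starRingEnd ℂ a with hb
  have hb0 : b ≠ 0 := by simpa [hb] using ha
  have hr' : (r : ℂ) ≠ 0 := by exact_mod_cast hr
  have hc' : (c : ℂ) ≠ 0 := by exact_mod_cast hc.ne'
  have hv0 : starRingEnd ℂ u ≠ 0 := by simpa using hu0
  have hv₁0 : starRingEnd ℂ u₁ ≠ 0 := by simpa using hu₁0
  have e1' := congrArg (starRingEnd ℂ) e1
  have e2' := congrArg (starRingEnd ℂ) e2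
  simp only [map_mul, map_pow, Complex.conj_ofReal, Complex.conj_I, hb, Complex.conj_conj,
    map_ofNat] at e1' e2'
  rw [← hb] at e1' e2'
  have hε0 : ε ≠ 0 := left_ne_zero_of_mul (hε ▸ one_ne_zero)
  have f1 : (b / a) ^ (n - α) = -starRingEnd ℂ u / u := by
    obtain ⟨m, rfl⟩ : ∃ m, n = α + m := ⟨n - α, by omega⟩
    rw [add_tsub_cancel_left, div_pow, div_eq_div_iff (pow_ne_zero _ ha) hu0]
    have hne : a ^ α * b ^ α * (r : ℂ) ^ μ ≠ 0 := by positivity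
    apply mul_left_cancel₀ hne
    rw [pow_add] at e1 e1'
    linear_combination e1 + e1'
  have f2 : (b / a) ^ (n₁ - α₁) = -starRingEnd ℂ u₁ / u₁ * ε ^ 2 := by
    obtain ⟨m, rfl⟩ : ∃ m, n₁ = α₁ + m := ⟨n₁ - α₁, by omega⟩
    rw [add_tsub_cancel_left, div_pow, div_mul_eq_mul_div,
      div_eq_div_iff (pow_ne_zero _ ha) hu₁0]
    have hne : a ^ α₁ * b ^ α₁ * (r : ℂ) ^ μ₁ ≠ 0 := by positivity
    apply mul_left_cancel₀ hne
    rw [pow_add] at e2 e2'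
    linear_combination e2 + ε ^ 2 * e2' - r * Complex.I * c * ε * hε
  have f3 : ((b / a) ^ (n - α)) ^ (n₁ - α₁) = ((b / a) ^ (n₁ - α₁)) ^ (n - α) := by
    rw [← pow_mul, ← pow_mul, mul_comm]
  rw [f1, f2, mul_pow, ← pow_mul] at f3
  have g1 : (-starRingEnd ℂ u / u) = (-u / starRingEnd ℂ u)⁻¹ := by
    rw [inv_div, div_neg, neg_div]
  have g2 : (-starRingEnd ℂ u₁ / u₁) = (-u₁ / starRingEnd ℂ u₁)⁻¹ := by
    rw [inv_div, div_neg, neg_div]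
  have k1 : -u / starRingEnd ℂ u ≠ 0 := div_ne_zero (neg_ne_zero.2 hu0) hv0
  have k2 : -u₁ / starRingEnd ℂ u₁ ≠ 0 := div_ne_zero (neg_ne_zero.2 hu₁0) hv₁0
  rw [g1, g2, inv_pow, inv_pow, inv_eq_iff_eq_inv, mul_inv, inv_inv] at f3
  rw [f3, mul_assoc, inv_mul_cancel₀ (pow_ne_zero _ hε0), mul_one]

/-- Taking logarithms of moduli gives two linear relations in `log|a|` and `log|r|`. In Case A their
coefficient rows are dependent, so a combination determines `log c`. -/
theorem TwoPairs.modulus (h : TwoPairs ρ α n μ α₁ n₁ μ₁) (hA : CaseA α n μ α₁ n₁ μ₁) :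
    ∃ κ : ℝ, ∀ (c : ℝ) (ε : ℂ), 0 < c → ‖ε‖ = 1 → IsAttained ρ α n μ α₁ n₁ μ₁ c ε →
      ((α : ℝ) + n) * Real.log c = κ := by
  obtain ⟨H, hH⟩ := h.exists_coordinates
  obtain ⟨φ, hφ⟩ := id hH
  obtain ⟨Q, hC⟩ := hφ.exists_complex h.hypersurface
  set u := coeff (mon ![α, n, μ]) (Q - X 2) with hu
  set u₁ := coeff (mon ![α₁, n₁, μ₁]) (Q - X 2) with hu₁
  have hu0 : ‖u‖ ≠ 0 := norm_ne_zero_iff.2 (h.leading _ _ hH hC).ne_zero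
  have hu₁0 : ‖u₁‖ ≠ 0 := norm_ne_zero_iff.2 (h.leading' _ _ hH hC).ne_zero
  refine ⟨((α₁ : ℝ) + n₁) * (Real.log 2 - Real.log ‖u‖) + (α + n) * Real.log ‖u₁‖, ?_⟩
  intro c ε hc hε hat
  obtain ⟨a, r, ha, hr, e1, e2⟩ := h.relation hH hC hat
  rw [← hu] at e1
  rw [← hu₁] at e2
  have ha' : ‖a‖ ≠ 0 := norm_ne_zero_iff.2 ha
  have hr' : ‖r‖ ≠ 0 := norm_ne_zero_iff.2 hr
  have e1' := congrArg (fun z : ℂ => Real.log ‖z‖) e1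
  have e2' := congrArg (fun z : ℂ => Real.log ‖z‖) e2
  simp only [norm_mul, norm_pow, RCLike.norm_conj, Complex.norm_real, Complex.norm_I, hε,
    Complex.norm_ofNat, mul_one, one_mul] at e1' e2'
  rw [Real.norm_of_nonneg hc.le] at e2'
  rw [Real.log_mul (by positivity) hu0, Real.log_mul (by positivity) (by positivity),
    Real.log_mul (by positivity) (by positivity), Real.log_mul hr' (by norm_num),
    Real.log_pow, Real.log_pow, Real.log_pow] at e1'
  rw [Real.log_mul (by positivity) hu₁0, Real.log_mul (by positivity) (by positivity),
    Real.log_mul (by positivity) (by positivity), Real.log_mul hr' hc.ne',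
    Real.log_pow, Real.log_pow, Real.log_pow] at e2'
  have hA' : (μ₁ : ℝ) * (α + n) - μ * (α₁ + n₁) = ((α : ℝ) + n) - (α₁ + n₁) := by
    have := congrArg (Int.cast : ℤ → ℝ) hA
    push_cast at this
    exact this
  linear_combination (((α₁ : ℝ) + n₁)) * e1' - ((α : ℝ) + n) * e2' + Real.log ‖r‖ * hA'

theorem exists_log_solution (hβ : (α : ℝ) + n ≠ 0) (A A₁ : ℝ) :
    ∃ x y : ℝ, ((α : ℝ) + n) * x + (μ - 1) * y = A ∧
      (¬ CaseA α n μ α₁ n₁ μ₁ → ((α₁ : ℝ) + n₁) * x + (μ₁ - 1) * y = A₁) := by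
  by_cases hA : CaseA α n μ α₁ n₁ μ₁
  · refine ⟨A / (α + n), 0, by field_simp; ring, fun h => absurd hA h⟩
  · have hA' : (μ₁ : ℝ) * (α + n) - μ * (α₁ + n₁) - (((α : ℝ) + n) - (α₁ + n₁)) ≠ 0 := by
      rw [sub_ne_zero]
      intro h
      exact hA (by unfold CaseA; exact_mod_cast h)
    set Δ := (μ₁ : ℝ) * (α + n) - μ * (α₁ + n₁) - (((α : ℝ) + n) - (α₁ + n₁)) with hΔ
    refine ⟨(A * (μ₁ - 1) - A₁ * (μ - 1)) / Δ, ((α + n) * A₁ - (α₁ + n₁) * A) / Δ, ?_, fun _ => ?_⟩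
    · rw [mul_div_assoc', mul_div_assoc', ← add_div, div_eq_iff hA', hΔ]; ring
    · rw [mul_div_assoc', mul_div_assoc', ← add_div, div_eq_iff hA', hΔ]; ring

/-- The solution has the form `a = e^{x + iθ}` and `r = e^y > 0`. Moduli fix `x` and `y`, the first
phase equation fixes `θ` because `α ≠ n`, and the second relation then defines `c = e^l` and `ε =
e^{it}`. -/
theorem TwoPairs.exists_attained (h : TwoPairs ρ α n μ α₁ n₁ μ₁) :
    ∃ c t : ℝ, 0 < c ∧ (¬ CaseA α n μ α₁ n₁ μ₁ → c = 2) ∧ 0 ≤ t ∧ t < 2 * Real.pi ∧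
      IsAttained ρ α n μ α₁ n₁ μ₁ c (Complex.exp (t * Complex.I)) := by
  obtain ⟨H, hH⟩ := h.exists_coordinates
  obtain ⟨φ, hφ⟩ := id hH
  obtain ⟨Q, hC⟩ := hφ.exists_complex h.hypersurface
  set u := coeff (mon ![α, n, μ]) (Q - X 2) with hu
  set u₁ := coeff (mon ![α₁, n₁, μ₁]) (Q - X 2) with hu₁
  have hu0 : u ≠ 0 := (h.leading _ _ hH hC).ne_zero
  have hu₁0 : u₁ ≠ 0 := (h.leading' _ _ hH hC).ne_zero
  have hlt : (α : ℝ) < n := by exact_mod_cast h.lt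
  have hα : (0 : ℝ) ≤ α := Nat.cast_nonneg _
  obtain ⟨x, y, e1, e2⟩ := exists_log_solution (α := α) (n := n) (μ := μ) (α₁ := α₁) (n₁ := n₁)
    (μ₁ := μ₁) (by linarith) (Real.log 2 - Real.log ‖u‖) (Real.log 2 - Real.log ‖u₁‖)
  set θ : ℝ := (Real.pi / 2 - u.arg) / (α - n) with hθ
  have hθ' : (α - n) * θ = Real.pi / 2 - u.arg := by
    rw [hθ, mul_div_cancel₀]; linarith
  set l : ℝ := (α₁ + n₁) * x + (μ₁ - 1) * y + Real.log ‖u₁‖ with hl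
  set t₀ : ℝ := (α₁ - n₁) * θ + u₁.arg - Real.pi / 2 with ht₀
  have hmem := toIcoMod_mem_Ico Real.two_pi_pos 0 t₀
  have hsub := self_sub_toIcoDiv_zsmul Real.two_pi_pos 0 t₀
  set t := toIcoMod Real.two_pi_pos 0 t₀ with ht
  have hexp : Complex.exp (t * Complex.I) = Complex.exp (t₀ * Complex.I) := by
    rw [← hsub, Complex.exp_eq_exp_iff_exists_int]
    refine ⟨-toIcoDiv Real.two_pi_pos 0 t₀, ?_⟩
    push_cast [zsmul_eq_mul]
    ring
  have hlog2 : (2 : ℂ) = Complex.exp (Real.log 2) := by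
    rw [← Complex.ofReal_exp, Real.exp_log two_pos]; norm_num
  have hI : Complex.I = Complex.exp (Real.pi / 2 * Complex.I) := Complex.exp_pi_div_two_mul_I.symm
  have hlogu : Complex.exp (Real.log ‖u‖ + u.arg * Complex.I) = u := by
    rw [← Complex.log, Complex.exp_log hu0]
  have hlogu₁ : Complex.exp (Real.log ‖u₁‖ + u₁.arg * Complex.I) = u₁ := by
    rw [← Complex.log, Complex.exp_log hu₁0]
  have hconj : starRingEnd ℂ (Complex.exp (x + θ * Complex.I)) =
      Complex.exp (x - θ * Complex.I) := by
    rw [← Complex.exp_conj, map_add, map_mul, Complex.conj_ofReal, Complex.conj_ofReal,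
      Complex.conj_I]
    congr 1; ring
  have c1 : (((α : ℂ) + n) * x + (μ - 1) * y) = Real.log 2 - Real.log ‖u‖ := by exact_mod_cast e1
  have c2 : ((α : ℂ) - n) * θ = Real.pi / 2 - u.arg := by exact_mod_cast hθ'
  have c3 : (l : ℂ) = (α₁ + n₁) * x + (μ₁ - 1) * y + Real.log ‖u₁‖ := by rw [hl]; push_cast; ring
  have c4 : (t₀ : ℂ) = (α₁ - n₁) * θ + u₁.arg - Real.pi / 2 := by rw [ht₀]; push_cast; ring
  refine ⟨Real.exp l, t, Real.exp_pos _, fun hA => ?_, hmem.1, by simpa using hmem.2,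
    h.isAttained hH hC (a := Complex.exp (x + θ * Complex.I)) (r := Real.exp y)
      (Complex.exp_ne_zero _) (Real.exp_pos _).ne' ?_ ?_⟩
  · have : l = Real.log 2 := by rw [hl, e2 hA]; ring
    rw [this, Real.exp_log two_pos]
  · rw [hconj, ← hu]
    conv_lhs => rw [← hlogu]
    conv_rhs => rw [hlog2, hI]
    rw [Complex.ofReal_exp, ← Complex.exp_nat_mul, ← Complex.exp_nat_mul, ← Complex.exp_nat_mul,
      ← Complex.exp_add, ← Complex.exp_add, ← Complex.exp_add, ← Complex.exp_add,
      ← Complex.exp_add]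
    congr 1
    linear_combination c1 + Complex.I * c2
  · rw [hconj, ← hu₁, hexp]
    conv_lhs => rw [← hlogu₁]
    conv_rhs => rw [show Complex.I * (Real.exp l : ℂ) * Complex.exp (t₀ * Complex.I) =
      Complex.exp (Real.pi / 2 * Complex.I) * Complex.exp l * Complex.exp (t₀ * Complex.I) by
        rw [← hI, Complex.ofReal_exp]]
    rw [Complex.ofReal_exp, ← Complex.exp_nat_mul, ← Complex.exp_nat_mul, ← Complex.exp_nat_mul,
      ← Complex.exp_add, ← Complex.exp_add, ← Complex.exp_add, ← Complex.exp_add,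
      ← Complex.exp_add, ← Complex.exp_add]
    congr 1
    linear_combination -c3 - Complex.I * c4

theorem exp_injOn : Set.InjOn (fun t : ℝ => Complex.exp (t * Complex.I))
    {t | 0 ≤ t ∧ t < 2 * Real.pi} := by
  intro s hs t ht hst
  obtain ⟨m, hm⟩ := Complex.exp_eq_exp_iff_exists_int.1 hst
  have h1 : (s : ℂ) = t + m * (2 * Real.pi) := by
    apply mul_right_cancel₀ Complex.I_ne_zero
    rw [hm]; ring
  have h2 : s = t + m * (2 * Real.pi) := by exact_mod_cast h1
  have hm0 : m = 0 := by
    obtain ⟨hs1, hs2⟩ := hs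
    obtain ⟨ht1, ht2⟩ := ht
    have hpi := Real.pi_pos
    have h3 : (m : ℝ) < 1 := by nlinarith
    have h4 : (-1 : ℝ) < m := by nlinarith
    have h5 : m < 1 := by exact_mod_cast h3
    have h6 : -1 < m := by exact_mod_cast h4
    omega
  rw [h2, hm0]; simp

theorem TwoPairs.finite_phases (h : TwoPairs ρ α n μ α₁ n₁ μ₁) {c : ℝ} (hc : 0 < c) :
    {t : ℝ | 0 ≤ t ∧ t < 2 * Real.pi ∧
      IsAttained ρ α n μ α₁ n₁ μ₁ c (Complex.exp (t * Complex.I))}.Finite := by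
  obtain ⟨κ, κ', hκ, hph⟩ := h.phase
  have hlt := h.lt
  refine Set.Finite.of_finite_image (f := fun t : ℝ => Complex.exp (t * Complex.I)) ?_
    (Set.InjOn.mono ?_ exp_injOn)
  swap
  · rintro t ⟨h1, h2, -⟩
    exact ⟨h1, h2⟩
  -- By `phase`, `ε` is a root of order `2(n - α) > 0` of a fixed number, and `t` is recovered from
  -- `ε` in `[0, 2π)`.
  refine (Polynomial.nthRoots (2 * (n - α)) (κ' / κ)).toFinset.finite_toSet.subset ?_
  rintro _ ⟨t, ht, rfl⟩
  rw [Finset.mem_coe, Multiset.mem_toFinset, Polynomial.mem_nthRoots (by omega),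
    eq_div_iff hκ, mul_comm]
  refine hph c _ hc ?_ ht.2.2
  rw [← Complex.exp_conj, ← Complex.exp_add, map_mul, Complex.conj_ofReal, Complex.conj_I]
  simp

theorem TwoPairs.existsUnique_constants (h : TwoPairs ρ α n μ α₁ n₁ μ₁) :
    ∃! cε : ℝ × ℂ, IsPrelimConstants ρ α n μ α₁ n₁ μ₁ cε.1 cε.2 := by
  obtain ⟨c, t, hc, hcA, ht0, ht1, hat⟩ := h.exists_attained
  obtain ⟨θ, hθ, hmin⟩ := Set.exists_min_image _ id (h.finite_phases hc) ⟨t, ht0, ht1, hat⟩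
  have hleast : IsLeast {t : ℝ | 0 ≤ t ∧ t < 2 * Real.pi ∧
      IsAttained ρ α n μ α₁ n₁ μ₁ c (Complex.exp (t * Complex.I))} θ := ⟨hθ, fun s hs => hmin s hs⟩
  refine ⟨(c, Complex.exp (θ * Complex.I)), ⟨hc, hcA, θ, rfl, hleast⟩, ?_⟩
  rintro ⟨c', ε'⟩ ⟨hc', hcA', θ', hε', hθ'⟩
  simp only at hc' hcA' hε' hθ'
  have hcc : c' = c := by
    by_cases hA : CaseA α n μ α₁ n₁ μ₁
    · obtain ⟨κ, hκ⟩ := h.modulus hA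
      have h1 := hκ c' _ hc' (Complex.norm_exp_ofReal_mul_I θ') hθ'.1.2.2
      have h2 := hκ c _ hc (Complex.norm_exp_ofReal_mul_I θ) hleast.1.2.2
      have hlt : (α : ℝ) < n := by exact_mod_cast h.lt
      have hα : (0 : ℝ) ≤ α := Nat.cast_nonneg _
      have h3 : Real.log c' = Real.log c :=
        mul_left_cancel₀ (by linarith : (α : ℝ) + n ≠ 0) (h1.trans h2.symm)
      exact Real.log_injOn_pos hc' hc h3
    · rw [hcA' hA, hcA hA]
  subst hcc
  rw [hε', hθ'.unique hleast]

end Constants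

end
end FormalHypersurface


namespace FormalHypersurface
open MvPowerSeries

noncomputable section

/-! ### The real linear system of weight `k` -/

section LinearSystem

variable {α n μ α₁ n₁ μ₁ k : ℕ}

theorem notMem_K_iff (hk : 1 ≤ k) : k ∉ K α n μ α₁ n₁ μ₁ ↔
    ((α : ℝ) + n) * (μ₁ - (k + 1)) - (α₁ + n₁) * (μ - (k + 1)) ≠ 0 := by
  have e : D α n μ α₁ n₁ μ₁ k * (k + 1) =
      ((α : ℚ) + n) * (μ₁ - (k + 1)) - (α₁ + n₁) * (μ - (k + 1)) := by
    have hk0 : (k : ℚ) + 1 ≠ 0 := by positivity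
    rw [D, Matrix.det_fin_two_of]
    field_simp
  have hk0 : (k : ℚ) + 1 ≠ 0 := by positivity
  have e2 : D α n μ α₁ n₁ μ₁ k = 0 ↔
      ((α : ℝ) + n) * (μ₁ - (k + 1)) - (α₁ + n₁) * (μ - (k + 1)) = 0 := by
    rw [← mul_left_inj' hk0, e, zero_mul]
    exact_mod_cast Iff.rfl
  change ¬ (1 ≤ k ∧ D α n μ α₁ n₁ μ₁ k = 0) ↔ _
  rw [e2]
  tauto

/-- The determinant is a nonzero multiple of `D_k`. For resonant `k` only the first equation is
required, and `r = 0` is chosen. -/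
theorem exists_step_solution (hk : 1 ≤ k) (hβ : (α : ℝ) + n ≠ 0) (A A₁ : ℝ) :
    ∃ s r : ℝ, ((α : ℝ) + n) * s + (μ - (k + 1)) * r = A ∧
      (k ∉ K α n μ α₁ n₁ μ₁ → ((α₁ : ℝ) + n₁) * s + (μ₁ - (k + 1)) * r = A₁) := by
  by_cases hK : k ∈ K α n μ α₁ n₁ μ₁
  · exact ⟨A / (α + n), 0, by field_simp; ring, fun h => absurd hK h⟩
  · have hΔ := (notMem_K_iff hk).1 hK
    set Δ := ((α : ℝ) + n) * (μ₁ - (k + 1)) - (α₁ + n₁) * (μ - (k + 1)) with hd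
    refine ⟨(A * (μ₁ - (k + 1)) - A₁ * (μ - (k + 1))) / Δ,
      ((α + n) * A₁ - (α₁ + n₁) * A) / Δ, ?_, fun _ => ?_⟩
    · rw [mul_div_assoc', mul_div_assoc', ← add_div, div_eq_iff hΔ, hd]; ring
    · rw [mul_div_assoc', mul_div_assoc', ← add_div, div_eq_iff hΔ, hd]; ring

end LinearSystem

/-! ### Normal form conditions of a single weight -/

section NormalizationStep

/-- The preliminary normalization of `Q - τ`. -/
structure Prelim (P : MvPowerSeries (Fin 3) ℂ) (α n μ α₁ n₁ μ₁ : ℕ) (c : ℝ) (ε : ℂ) : Prop where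
  fst : ∀ j, coeff (mon ![α, j, μ]) P = if j = n then 2 * Complex.I else 0
  snd_lt : ∀ j < n₁, coeff (mon ![α₁, j, μ₁]) P = 0
  snd : coeff (mon ![α₁, n₁, μ₁]) P = Complex.I * c * ε

/-- The normal form conditions of weight `k` for `Q - τ`. -/
structure Cond (P : MvPowerSeries (Fin 3) ℂ) (α n μ α₁ n₁ μ₁ α' n' μ' : ℕ) (ε : ℂ) (k : ℕ) :
    Prop where
  degree : ∀ j, n ≤ j → coeff (mon ![α, j, μ + k]) P = 0
  shifted : coeff (mon ![α' - 1, n', μ' + k]) P = 0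
  imag : k ∉ K α n μ α₁ n₁ μ₁ → (ε⁻¹ * coeff (mon ![α₁, n₁, μ₁ + k]) P).im = 0

variable {ρ : MvPowerSeries (Fin 4) ℂ} {H T : Fin 2 → MvPowerSeries (Fin 2) ℂ}
  {Q : MvPowerSeries (Fin 3) ℂ} {α n μ α₁ n₁ μ₁ α' n' μ' k δ : ℕ} {c : ℝ} {ε : ℂ}
  {P P' : MvPowerSeries (Fin 3) ℂ}

theorem isNormalForm_iff (hα : 1 ≤ α) (hα₁ : 1 ≤ α₁) (hα' : 1 < α') :
    IsNormalForm Q α n μ α₁ n₁ μ₁ α' n' μ' c ε ↔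
      Prelim (Q - X 2) α n μ α₁ n₁ μ₁ c ε ∧
        ∀ k, 1 ≤ k → Cond (Q - X 2) α n μ α₁ n₁ μ₁ α' n' μ' ε k := by
  have e : IsPrelimNormalized Q α n μ α₁ n₁ μ₁ c ε ↔ Prelim (Q - X 2) α n μ α₁ n₁ μ₁ c ε := by
    rw [isPrelimNormalized_iff hα hα₁]
    exact ⟨fun h => ⟨h.1, h.2.1, h.2.2⟩, fun h => ⟨h.fst, h.snd_lt, h.snd⟩⟩
  constructor
  · intro h
    refine ⟨e.1 h.prelim, fun k hk => ⟨fun j hj => ?_, ?_, fun hK => ?_⟩⟩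
    · rw [coeff_sub_X hα, ← coeff_cf']; exact h.degree k hk j hj
    · rw [coeff_sub_X (by omega), ← coeff_cf']; exact h.shifted k hk
    · rw [coeff_sub_X hα₁, ← coeff_cf']; exact h.imag k hk hK
  · intro h
    refine ⟨e.2 h.1, fun k hk j hj => ?_, fun k hk => ?_, fun k hk hK => ?_⟩
    · have := (h.2 k hk).degree j hj
      rwa [coeff_sub_X hα, ← coeff_cf'] at this
    · have := (h.2 k hk).shifted
      rwa [coeff_sub_X (by omega), ← coeff_cf'] at this
    · have := (h.2 k hk).imag hK
      rwa [coeff_sub_X hα₁, ← coeff_cf'] at this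

theorem Leading.lead (hP : Leading α n μ P) : ∀ j, j ≤ n → j ≠ n → coeff (mon ![α, j, μ]) P = 0 :=
  fun j h1 h2 => hP.eq_zero j (by omega)

theorem Prelim.lead (hP : Prelim P α n μ α₁ n₁ μ₁ c ε) (B : ℕ) :
    ∀ j, j ≤ B → j ≠ n → coeff (mon ![α, j, μ]) P = 0 :=
  fun j _ h2 => by rw [hP.fst, if_neg h2]

/-- Near the identity the conditions of lower weight are preserved. -/
theorem IsTransform.preserves (h : IsTransform T P P') (hT : IsNearIdentity k δ T)
    (h1 : Leading α n μ P) (h2 : Leading α₁ n₁ μ₁ P) (h3 : Leading α' n' μ' P)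
    (hα : 1 ≤ α) (hαμ : 2 ≤ α + μ) (hα₁ : 1 ≤ α₁) (hαμ₁ : 2 ≤ α₁ + μ₁) (hα' : 1 < α')
    (hP : Prelim P α n μ α₁ n₁ μ₁ c ε) :
    Prelim P' α n μ α₁ n₁ μ₁ c ε ∧ ∀ j < k, Cond P α n μ α₁ n₁ μ₁ α' n' μ' ε j →
      Cond P' α n μ α₁ n₁ μ₁ α' n' μ' ε j := by
  have hk := hT.pos
  refine ⟨⟨fun j => ?_, fun j hj => ?_, ?_⟩, fun j hj hc => ⟨fun i hi => ?_, ?_, fun hK => ?_⟩⟩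
  · rw [h.coeff_low hT hα hαμ h1.above (hP.lead j) le_rfl (by omega)]; exact hP.fst j
  · rw [h.coeff_low hT hα₁ hαμ₁ h2.above h2.lead hj.le (by omega)]; exact hP.snd_lt j hj
  · rw [h.coeff_low hT hα₁ hαμ₁ h2.above h2.lead le_rfl (by omega)]; exact hP.snd
  · rw [h.coeff_low hT hα hαμ h1.above (hP.lead i) le_rfl (by omega)]; exact hc.degree i hi
  · rw [h.coeff_low hT (by omega) (by omega) h3.above h3.lead le_rfl (by omega)]; exact hc.shifted
  · rw [h.coeff_low hT hα₁ hαμ₁ h2.above h2.lead le_rfl (by omega)]; exact hc.imag hK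

/-- The series `w^k ∑ a_j z^j`. -/
def layer (k : ℕ) (a : ℕ → ℂ) : MvPowerSeries (Fin 2) ℂ :=
  fun d => if d 1 = k then a (d 0) else 0

theorem coeff_layer (k : ℕ) (a : ℕ → ℂ) (d : Fin 2 →₀ ℕ) :
    coeff d (layer k a) = if d 1 = k then a (d 0) else 0 := rfl

theorem supp_layer {a : ℕ → ℂ} (ha : δ = 0 ∨ a 0 = 0) (hδ : δ ≤ 1) :
    Supp (fun d => k ≤ d 1 ∧ k + δ ≤ d 0 + d 1) (X 0 + layer k a - X 0) := by
  intro d hd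
  rw [add_sub_cancel_left, coeff_layer] at hd
  have h1 : d 1 = k := by by_contra h; simp [h] at hd
  rw [if_pos h1] at hd
  refine ⟨h1.ge, ?_⟩
  rcases ha with rfl | ha
  · omega
  · have : d 0 ≠ 0 := fun h => hd (by rw [h, ha])
    omega

theorem coeff_add_layer (hk : 1 ≤ k) (a : ℕ → ℂ) (j : ℕ) : coeff (mon ![j, k]) (X 0 + layer k a) = a j := by
  have h : coeff (mon ![j, k]) (X 0 : MvPowerSeries (Fin 2) ℂ) = 0 := by
    rw [coeff_X, if_neg]
    intro h
    have := DFunLike.congr_fun h 1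
    simp [mon_apply] at this
    omega
  rw [map_add, h, zero_add, coeff_layer]
  simp [mon_apply]

end NormalizationStep

end
end FormalHypersurface


namespace FormalHypersurface
open MvPowerSeries

noncomputable section

variable {ρ : MvPowerSeries (Fin 4) ℂ} {H T : Fin 2 → MvPowerSeries (Fin 2) ℂ}
  {Q : MvPowerSeries (Fin 3) ℂ} {α n μ α₁ n₁ μ₁ α' n' μ' k δ : ℕ} {c : ℝ} {ε : ℂ}

/-! ### Achieving the conditions of weight `k` -/

section ExistenceStep

/-- Setting for the normal form: the two pairs, the choice of the primed triple, the constants. -/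
structure Setting (ρ : MvPowerSeries (Fin 4) ℂ) (α n μ α₁ n₁ μ₁ α' n' μ' : ℕ) (c : ℝ) (ε : ℂ) :
    Prop extends TwoPairs ρ α n μ α₁ n₁ μ₁ where
  choice : (α', n', μ') = (α, n, μ) ∨ (α', n', μ') = (α₁, n₁, μ₁)
  one_lt' : 1 < α'
  c_pos : 0 < c
  ε_ne : ε ≠ 0

theorem Setting.leading_choice (h : Setting ρ α n μ α₁ n₁ μ₁ α' n' μ' c ε)
    (hH : IsNormalCoordinates ρ H) (hC : IsComplexEquation ρ H Q) :
    Leading α' n' μ' (Q - X 2) := by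
  rcases h.choice with h1 | h1 <;> obtain ⟨rfl, rfl, rfl⟩ := by simpa using h1
  · exact h.leading _ _ hH hC
  · exact h.leading' _ _ hH hC

theorem Setting.preserves (h : Setting ρ α n μ α₁ n₁ μ₁ α' n' μ' c ε)
    (hH : IsNormalCoordinates ρ H) (hC : IsComplexEquation ρ H Q) {P' : MvPowerSeries (Fin 3) ℂ}
    (ht : IsTransform T (Q - X 2) P') (hT : IsNearIdentity k δ T)
    (hP : Prelim (Q - X 2) α n μ α₁ n₁ μ₁ c ε) :
    Prelim P' α n μ α₁ n₁ μ₁ c ε ∧ ∀ j < k, Cond (Q - X 2) α n μ α₁ n₁ μ₁ α' n' μ' ε j →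
      Cond P' α n μ α₁ n₁ μ₁ α' n' μ' ε j :=
  ht.preserves hT (h.leading _ _ hH hC) (h.leading' _ _ hH hC) (h.leading_choice hH hC)
    h.pos h.two_le h.pos' h.two_le' h.one_lt' hP

/-- A change `z ↦ z + f w^k` alters the shifted coefficient by `u α' f`, with `u α' ≠ 0`. -/
theorem Setting.exists_shift (h : Setting ρ α n μ α₁ n₁ μ₁ α' n' μ' c ε)
    (hH : IsNormalCoordinates ρ H) (hC : IsComplexEquation ρ H Q)
    (hP : Prelim (Q - X 2) α n μ α₁ n₁ μ₁ c ε) (hk : 1 ≤ k) :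
    ∃ S Q', IsFormalBihol S ∧ IsNormalCoordinates ρ (comp H S) ∧
      IsComplexEquation ρ (comp H S) Q' ∧ (∀ i, Ord k (S i - X i)) ∧
      Prelim (Q' - X 2) α n μ α₁ n₁ μ₁ c ε ∧
      (∀ j < k, Cond (Q - X 2) α n μ α₁ n₁ μ₁ α' n' μ' ε j →
        Cond (Q' - X 2) α n μ α₁ n₁ μ₁ α' n' μ' ε j) ∧
      coeff (mon ![α' - 1, n', μ' + k]) (Q' - X 2) = 0 := by
  have h3 := h.leading_choice hH hC
  have hα' := h.one_lt'
  set u := coeff (mon ![α', n', μ']) (Q - X 2) with hu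
  set f := -coeff (mon ![α' - 1, n', μ' + k]) (Q - X 2) / (u * α') with hf
  obtain ⟨G, Q', hT, hN, hH', hC', -, hO⟩ := hH.exists_nearIdentity h.hypersurface hC hk (δ := 0)
    (by omega) (F := X 0 + layer k fun j => if j = 0 then f else 0) (supp_layer (Or.inl rfl) (by omega)) 0
  have ht := hH.isTransform h.hypersurface hC hT hH' hC'
  obtain ⟨p1, p2⟩ := h.preserves hH hC ht hN hP
  refine ⟨_, Q', hT, hH', hC', hO, p1, p2, ?_⟩
  have h1 := ht.coeff_shifted hN (by omega) h3.above h3.lead le_rfl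
  rw [h1, if_pos rfl]
  simp only [Matrix.cons_val]
  rw [coeff_add_layer hk, if_pos rfl, ← hu, hf]
  have hα0 : (α' : ℂ) ≠ 0 := by exact_mod_cast (by omega : α' ≠ 0)
  have hu0 : u ≠ 0 := h3.ne_zero
  field_simp
  ring

/-- A layer without the term `z^0 w^k` leaves the shifted coefficient alone and solves the remaining
conditions of weight `k`. -/
theorem Setting.exists_shear (h : Setting ρ α n μ α₁ n₁ μ₁ α' n' μ' c ε)
    (hH : IsNormalCoordinates ρ H) (hC : IsComplexEquation ρ H Q)
    (hP : Prelim (Q - X 2) α n μ α₁ n₁ μ₁ c ε) (hk : 1 ≤ k)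
    (hs : coeff (mon ![α' - 1, n', μ' + k]) (Q - X 2) = 0) :
    ∃ S Q', IsFormalBihol S ∧ IsNormalCoordinates ρ (comp H S) ∧
      IsComplexEquation ρ (comp H S) Q' ∧ (∀ i, Ord k (S i - X i)) ∧
      Prelim (Q' - X 2) α n μ α₁ n₁ μ₁ c ε ∧
      (∀ j < k, Cond (Q - X 2) α n μ α₁ n₁ μ₁ α' n' μ' ε j →
        Cond (Q' - X 2) α n μ α₁ n₁ μ₁ α' n' μ' ε j) ∧
      Cond (Q' - X 2) α n μ α₁ n₁ μ₁ α' n' μ' ε k := by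
  have h1 := h.leading _ _ hH hC
  have h2 := h.leading' _ _ hH hC
  have h3 := h.leading_choice hH hC
  have hα' := h.one_lt'
  have hlt : (α : ℝ) < n := by exact_mod_cast h.lt
  have hα0 : (0 : ℝ) ≤ α := Nat.cast_nonneg _
  have hc0 : (c : ℂ) ≠ 0 := by exact_mod_cast h.c_pos.ne'
  have hε := h.ε_ne
  set p : ℕ → ℂ := fun j => -coeff (mon ![α, j, μ + k]) (Q - X 2) / (2 * Complex.I) with hp
  set q : ℂ := ε⁻¹ * coeff (mon ![α₁, n₁, μ₁ + k]) (Q - X 2) with hq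
  obtain ⟨s, r, e1, e2⟩ := exists_step_solution (α := α) (n := n) (μ := μ) (α₁ := α₁) (n₁ := n₁)
    (μ₁ := μ₁) hk (by linarith) (p n).re (-q.im / c)
  -- The term `b = n` requires `α a₁ + n ā₁ + (μ - k - 1) r = p n`. Its imaginary part is `(α - n)
  -- t`, solvable since `α ≠ n`; its real part and the second pair form the system for `s`, `r`.
  set t : ℝ := (p n).im / (α - n) with ht
  have ht' : ((α : ℝ) - n) * t = (p n).im := by
    rw [ht, mul_div_cancel₀]; linarith
  set a₁ : ℂ := ⟨s, t⟩ with ha₁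
  -- For `j ≥ 2` the equation `n conj(a j) = p (j + n - 1)` determines `a j`.
  set a : ℕ → ℂ := fun j => if j = 0 then 0 else if j = 1 then a₁ else
    starRingEnd ℂ (p (j + n - 1) / n) with ha
  obtain ⟨G, Q', hT, hN, hH', hC', hG, hO⟩ := hH.exists_nearIdentity h.hypersurface hC hk (δ := 1)
    le_rfl (F := X 0 + layer k a) (supp_layer (Or.inr (by simp [ha])) le_rfl) r
  have htr := hH.isTransform h.hypersurface hC hT hH' hC'
  obtain ⟨p1, p2⟩ := h.preserves hH hC htr hN hP
  refine ⟨_, Q', hT, hH', hC', hO, p1, p2, ⟨fun j hj => ?_, ?_, fun hK => ?_⟩⟩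
  · have hn0 : (n : ℂ) ≠ 0 := by exact_mod_cast (by have := h.lt; omega : n ≠ 0)
    have h4 := htr.coeff_top hN h.pos h.two_le h1.above (hP.lead j) (b := j) le_rfl
    rw [h4, if_pos hj, hP.fst, if_pos rfl]
    simp only [Matrix.cons_val]
    rw [coeff_add_layer hk, coeff_add_layer hk, hG rfl, Complex.conj_ofReal]
    have hpj : coeff (mon ![α, j, μ + k]) (Q - X 2) = -(p j) * (2 * Complex.I) := by
      rw [hp]; field_simp
    rw [hpj]
    by_cases hjn : j = n
    · subst hjn
      rw [if_pos rfl, add_tsub_cancel_left]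
      have ha1 : a 1 = a₁ := by simp [ha]
      rw [ha1]
      have hpn : p j = ((α : ℝ) + j) * s + (μ - (k + 1)) * r + (((α : ℝ) - j) * t) * Complex.I := by
        conv_lhs => rw [← Complex.re_add_im (p j), ← e1, ← ht']
        push_cast; ring
      have ha1' : a₁ = s + t * Complex.I := by rw [ha₁, Complex.mk_eq_add_mul_I]
      rw [hpn, ha1', map_add, map_mul, Complex.conj_ofReal, Complex.conj_ofReal, Complex.conj_I]
      push_cast
      ring
    · rw [if_neg hjn]
      have : a (j + 1 - n) = starRingEnd ℂ (p j / n) := by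
        rw [ha]
        simp only
        rw [if_neg (by omega), if_neg (by omega)]
        congr 3; omega
      rw [this, Complex.conj_conj]
      field_simp
      ring
  · rw [htr.coeff_low hN (by omega) (by omega) h3.above h3.lead le_rfl (by omega), hs]
  · have h4 := htr.coeff_top hN h.pos' h.two_le' h2.above h2.lead (b := n₁) le_rfl
    rw [h4, if_pos rfl, if_pos le_rfl, hP.snd, add_tsub_cancel_left]
    simp only [Matrix.cons_val]
    rw [coeff_add_layer hk, hG rfl, Complex.conj_ofReal]
    have ha1 : a 1 = a₁ := by simp [ha]
    rw [ha1, mul_add, ← hq]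
    have e3 : ε⁻¹ * (Complex.I * c * ε * ((α₁ : ℂ) * a₁ + μ₁ * r - (k + 1) * r +
        n₁ * starRingEnd ℂ a₁)) = Complex.I * (c * ((α₁ : ℂ) * a₁ + μ₁ * r - (k + 1) * r +
        n₁ * starRingEnd ℂ a₁)) := by field_simp
    rw [e3, Complex.add_im, Complex.I_mul_im]
    have e4 := e2 hK
    have e5 : ((c : ℂ) * ((α₁ : ℂ) * a₁ + μ₁ * r - (k + 1) * r + n₁ * starRingEnd ℂ a₁)).re =
        c * (((α₁ : ℝ) + n₁) * s + (μ₁ - (k + 1)) * r) := by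
      have ha1' : a₁ = s + t * Complex.I := by rw [ha₁, Complex.mk_eq_add_mul_I]
      have : (c : ℂ) * ((α₁ : ℂ) * a₁ + μ₁ * r - (k + 1) * r + n₁ * starRingEnd ℂ a₁) =
          ((c * (((α₁ : ℝ) + n₁) * s + (μ₁ - (k + 1)) * r) : ℝ) : ℂ) +
          ((c * (((α₁ : ℝ) - n₁) * t) : ℝ) : ℂ) * Complex.I := by
        rw [ha1', map_add, map_mul, Complex.conj_ofReal, Complex.conj_ofReal, Complex.conj_I]
        push_cast
        ring
      rw [this]; simp
    rw [e5, e4, mul_div_cancel₀ _ h.c_pos.ne']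
    ring

end ExistenceStep

end
end FormalHypersurface


namespace FormalHypersurface
open MvPowerSeries

noncomputable section

variable {ρ : MvPowerSeries (Fin 4) ℂ} {H T S L : Fin 2 → MvPowerSeries (Fin 2) ℂ}
  {Q P P' : MvPowerSeries (Fin 3) ℂ} {α n μ α₁ n₁ μ₁ α' n' μ' k δ N : ℕ} {c : ℝ} {ε : ℂ}

/-! ### Passage to the limit -/

section Limit

theorem conj_sub_X {m : ℕ} (f : MvPowerSeries (Fin m) ℂ) (i : Fin m) :
    FormalHypersurface.conj f - X i = FormalHypersurface.conj (f - X i) := by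
  rw [FormalHypersurface.conj, FormalHypersurface.conj, map_sub, map_X]

theorem Ord.subst_sub_coord {υ : Type*} {a : Fin 2 → MvPowerSeries υ ℂ} (ha : Vanish a)
    {f : MvPowerSeries (Fin 2) ℂ} {i : Fin 2} (hf : Ord N (f - X i)) :
    Ord N (MvPowerSeries.subst a f - a i) := by
  have h := hf.subst ha
  rwa [MvPowerSeries.subst_sub ha.hasSubst, subst_X ha.hasSubst] at h

/-- In the transformation identity, replacing `S` by the identity costs only terms of order `N`, and
what remains is `P' = P`. -/
theorem IsTransform.ord_sub (h : IsTransform S P P') (hS : ∀ i, Ord N (S i - X i)) :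
    Ord N (P' - P) := by
  have hv : Vanish (![X 0, X 2 + P'] : Fin 2 → MvPowerSeries (Fin 3) ℂ) := by
    simp [h.constantCoeff_P']
  have hw : Vanish (![X 1, X 2] : Fin 2 → MvPowerSeries (Fin 3) ℂ) := by simp
  have hS' : ∀ i, Ord N (FormalHypersurface.conj (S i) - X i) := fun i => by
    rw [conj_sub_X]; exact Supp.conj (hS i)
  have e1 := Ord.subst_sub_coord hv (hS 1)
  have e2 := Ord.subst_sub_coord hw (hS' 1)
  have e3 := Ord.subst_congr (N := N) (h.vanish hv hw)
    (b := (![X 0, X 1, X 2] : Fin 3 → MvPowerSeries (Fin 3) ℂ)) (by simp) (fun i => ?_) P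
  · rw [subst_X_vec₃] at e3
    simp only [Matrix.cons_val] at e1 e2
    rw [h.eqn] at e1
    have := (e2.add e3).sub e1
    convert this using 1
    ring
  · fin_cases i
    · simpa using Ord.subst_sub_coord hv (hS 0)
    · simpa using Ord.subst_sub_coord hw (hS' 0)
    · simpa using Ord.subst_sub_coord hw (hS' 1)

theorem jac_eq_of_ord (h : ∀ i, Ord 2 (T i - S i)) : jac T = jac S := by
  ext i j
  rw [jac, jac, Matrix.of_apply, Matrix.of_apply, ← sub_eq_zero, ← map_sub]
  exact coeff_single_eq_zero_of_ord_two (h i) j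

theorem isFormalBihol_of_ord (hS : IsFormalBihol S) (h : ∀ i, Ord 2 (T i - S i)) :
    IsFormalBihol T := by
  refine ⟨fun i => ?_, by rw [jac_eq_of_ord h]; exact hS.2⟩
  have := ord_one_iff.1 ((h i).mono fun d hd => by omega)
  rw [map_sub, hS.1 i, sub_zero] at this
  exact this

theorem preservesNormal_limit {t : ℕ → Fin 2 → MvPowerSeries (Fin 2) ℂ}
    (ht : ∀ m, IsFormalBihol (t m)) (hn : ∀ m, PreservesNormal Q (t m)) (hL : IsFormalBihol L)
    (h : ∀ m i, Ord m (L i - t m i)) : PreservesNormal Q L := by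
  refine eq_of_forall_supp fun m => ?_
  have e1 := h m 1
  rw [hn m] at e1
  refine Ord.trans e1 (Ord.subst_congr (PreservesNormal.vanish (ht m).1)
    (PreservesNormal.vanish hL.1) (fun i => ?_) Q)
  have e2 : ∀ i, Ord m (subst (![0, X 1] : Fin 2 → MvPowerSeries (Fin 2) ℂ)
      (FormalHypersurface.conj (t m i)) - subst ![0, X 1] (FormalHypersurface.conj (L i))) := by
    intro i
    rw [← MvPowerSeries.subst_sub vanish_zero_X.hasSubst]
    refine Ord.subst vanish_zero_X ?_
    rw [FormalHypersurface.conj, FormalHypersurface.conj, ← map_sub]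
    exact Supp.conj (h m i).symm
  fin_cases i
  · exact (h m 0).symm
  · exact e2 0
  · exact e2 1

/-- The limit differs from the stage `T` by an inner change `S` close to the identity; with
`ord_sub` this compares their equations. -/
theorem exists_comp_eq_of_ord (hT : IsFormalBihol T) (hL : IsFormalBihol L)
    (h : ∀ i, Ord N (L i - T i)) :
    ∃ S, IsFormalBihol S ∧ comp T S = L ∧ ∀ i, Ord N (S i - X i) := by
  obtain ⟨R, hR, h1, h2⟩ := exists_inverse hT
  refine ⟨comp R L, hR.comp hL, by rw [← comp_assoc hR.1 hL.1, h1, X_comp hL.1], fun i => ?_⟩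
  rw [← h2]
  exact Ord.subst_congr hL.1 hT.1 h (R i)

end Limit

/-! ### Existence of the normal form -/

section Existence

/-- `T` is a change of the normal coordinates `H` after which the normal form conditions hold up to
weight `m`. -/
structure NormalizedUpTo (ρ : MvPowerSeries (Fin 4) ℂ) (α n μ α₁ n₁ μ₁ α' n' μ' : ℕ) (c : ℝ)
    (ε : ℂ) (H : Fin 2 → MvPowerSeries (Fin 2) ℂ) (m : ℕ) (T : Fin 2 → MvPowerSeries (Fin 2) ℂ) :
    Prop where
  bihol : IsFormalBihol T
  normal : IsNormalCoordinates ρ (comp H T)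
  exists_eqn : ∃ Q, IsComplexEquation ρ (comp H T) Q ∧ Prelim (Q - X 2) α n μ α₁ n₁ μ₁ c ε ∧
    ∀ k, 1 ≤ k → k ≤ m → Cond (Q - X 2) α n μ α₁ n₁ μ₁ α' n' μ' ε k

/-- The shift precedes the shear: the shear preserves the shifted coefficient, but the shift may
disturb the others of the same weight. -/
theorem NormalizedUpTo.succ (h : Setting ρ α n μ α₁ n₁ μ₁ α' n' μ' c ε) {m : ℕ}
    (hT : NormalizedUpTo ρ α n μ α₁ n₁ μ₁ α' n' μ' c ε H m T) :
    ∃ T', NormalizedUpTo ρ α n μ α₁ n₁ μ₁ α' n' μ' c ε H (m + 1) T' ∧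
      ∀ i, Ord m (T' i - T i) := by
  obtain ⟨Q, hC, hP, hc⟩ := hT.exists_eqn
  obtain ⟨S, Q₁, hS, hN₁, hC₁, hO₁, hP₁, hc₁, hs⟩ :=
    h.exists_shift hT.normal hC hP (Nat.le_add_left 1 m)
  obtain ⟨S', Q₂, hS', hN₂, hC₂, hO₂, hP₂, hc₂, hm⟩ :=
    h.exists_shear hN₁ hC₁ hP₁ (Nat.le_add_left 1 m) hs
  have e : comp (comp (comp H T) S) S' = comp H (comp (comp T S) S') := by
    rw [comp_assoc hT.bihol.1 hS.1, comp_assoc (vanish_comp hT.bihol.1 hS.1) hS'.1]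
  rw [e] at hN₂ hC₂
  refine ⟨comp (comp T S) S', ⟨(hT.bihol.comp hS).comp hS', hN₂, Q₂, hC₂, hP₂, fun k hk hkm => ?_⟩,
    fun i => ?_⟩
  · rcases Nat.lt_or_ge k (m + 1) with hlt | hge
    · exact hc₂ k hlt (hc₁ k hlt (hc k hk (by omega)))
    · rw [show k = m + 1 by omega]; exact hm
  · have h1 : Ord (m + 1) (comp T S i - T i) := by
      have := Ord.subst_congr hS.1 vanish_X hO₁ (T i)
      rwa [subst_self] at this
    have h2 : Ord (m + 1) (comp (comp T S) S' i - comp T S i) := by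
      have := Ord.subst_congr hS'.1 vanish_X hO₂ (comp T S i)
      rwa [subst_self] at this
    exact (h2.trans h1).mono fun d hd => by omega

theorem Setting.exists_isNormalizing (h : Setting ρ α n μ α₁ n₁ μ₁ α' n' μ' c ε)
    (hA : IsAttained ρ α n μ α₁ n₁ μ₁ c ε) :
    ∃ H, IsNormalizing ρ α n μ α₁ n₁ μ₁ α' n' μ' c ε H := by
  obtain ⟨H, Q, hN, hC, hQ⟩ := hA
  rw [isPrelimNormalized_iff h.pos h.pos'] at hQ
  have h0 : NormalizedUpTo ρ α n μ α₁ n₁ μ₁ α' n' μ' c ε H 0 X :=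
    ⟨⟨vanish_X, by rw [jac_X]; simp⟩, by rwa [comp_X], Q, by rwa [comp_X],
      ⟨hQ.1, hQ.2.1, hQ.2.2⟩, fun k h1 h2 => by omega⟩
  -- The refinements are chosen coherently, so that consecutive stages agree to growing order and
  -- converge.
  choose next hnext hord using fun (m : ℕ)
    (T : {T // NormalizedUpTo ρ α n μ α₁ n₁ μ₁ α' n' μ' c ε H m T}) => T.2.succ h
  let t : (m : ℕ) → {T // NormalizedUpTo ρ α n μ α₁ n₁ μ₁ α' n' μ' c ε H m T} := fun m =>
    Nat.rec ⟨X, h0⟩ (fun m T => ⟨next m T, hnext m T⟩) m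
  obtain ⟨L, hL⟩ := exists_limit (fun m => (t m).1) fun m i => hord m (t m) i
  have hLb : IsFormalBihol L := isFormalBihol_of_ord (t 2).2.bihol (hL 2)
  obtain ⟨φ, hφ⟩ := hN
  have hLn : IsNormalCoordinates ρ (comp H L) :=
    isNormalCoordinates_of_preservesNormal h.hypersurface hφ hC hLb
      (preservesNormal_limit (t := fun m => (t m).1) (fun m => (t m).2.bihol) (fun m => by
        obtain ⟨ψ, hψ⟩ := (t m).2.normal
        exact preservesNormal_of_real h.hypersurface hφ.bihol hC (t m).2.bihol hψ) hLb hL)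
  obtain ⟨ψ, hψ⟩ := id hLn
  obtain ⟨Q', hC'⟩ := hψ.exists_complex h.hypersurface
  have key : ∀ m, ∃ P, Prelim P α n μ α₁ n₁ μ₁ c ε ∧
      (∀ k, 1 ≤ k → k ≤ m → Cond P α n μ α₁ n₁ μ₁ α' n' μ' ε k) ∧ Ord m (Q' - X 2 - P) := by
    intro m
    obtain ⟨Qm, hCm, hPm, hcm⟩ := (t m).2.exists_eqn
    obtain ⟨S, hS, hTS, hSo⟩ := exists_comp_eq_of_ord (t m).2.bihol hLb (hL m)
    have e : comp (comp H (t m).1) S = comp H L := by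
      rw [comp_assoc (t m).2.bihol.1 hS.1, hTS]
    have ht := (t m).2.normal.isTransform h.hypersurface hCm hS (by rwa [e]) (Q' := Q')
      (by rwa [e])
    exact ⟨_, hPm, hcm, ht.ord_sub hSo⟩
  -- Every normal form condition concerns single coefficients, and each of these agrees with that of
  -- a late enough stage.
  have hcoef : ∀ a b d k, ∃ P, Prelim P α n μ α₁ n₁ μ₁ c ε ∧
      (1 ≤ k → Cond P α n μ α₁ n₁ μ₁ α' n' μ' ε k) ∧
      coeff (mon ![a, b, d]) (Q' - X 2) = coeff (mon ![a, b, d]) P := by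
    intro a b d k
    obtain ⟨P, h1, h2, h3⟩ := key (a + b + d + k + 1)
    refine ⟨P, h1, fun hk => h2 k hk (by omega), ?_⟩
    rw [← sub_eq_zero, ← map_sub]
    refine h3.coeff_eq_zero ?_
    rw [degree_eq_sum', Fin.sum_univ_three]
    simp only [mon_apply, Matrix.cons_val]
    omega
  refine ⟨_, hLn, Q', hC', (isNormalForm_iff h.pos h.pos' h.one_lt').2
    ⟨⟨fun j => ?_, fun j hj => ?_, ?_⟩, fun k hk => ⟨fun j hj => ?_, ?_, fun hK => ?_⟩⟩⟩
  · obtain ⟨P, h1, -, h3⟩ := hcoef α j μ 0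
    rw [h3]; exact h1.fst j
  · obtain ⟨P, h1, -, h3⟩ := hcoef α₁ j μ₁ 0
    rw [h3]; exact h1.snd_lt j hj
  · obtain ⟨P, h1, -, h3⟩ := hcoef α₁ n₁ μ₁ 0
    rw [h3]; exact h1.snd
  · obtain ⟨P, -, h2, h3⟩ := hcoef α j (μ + k) k
    rw [h3]; exact (h2 hk).degree j hj
  · obtain ⟨P, -, h2, h3⟩ := hcoef (α' - 1) n' (μ' + k) k
    rw [h3]; exact (h2 hk).shifted
  · obtain ⟨P, -, h2, h3⟩ := hcoef α₁ n₁ (μ₁ + k) k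
    rw [h3]; exact (h2 hk).imag hK

end Existence

end
end FormalHypersurface


namespace FormalHypersurface
open MvPowerSeries

noncomputable section

/-! ### The resonance set `K` -/

section Resonance

variable {ρ : MvPowerSeries (Fin 4) ℂ} {α n μ α₁ n₁ μ₁ k : ℕ}

theorem mem_K_iff : k ∈ K α n μ α₁ n₁ μ₁ ↔
    1 ≤ k ∧ ((α : ℚ) + n) * (μ₁ - (k + 1)) = (α₁ + n₁) * (μ - (k + 1)) := by
  have hk0 : (k : ℚ) + 1 ≠ 0 := by positivity
  have e : D α n μ α₁ n₁ μ₁ k * (k + 1) =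
      ((α : ℚ) + n) * (μ₁ - (k + 1)) - (α₁ + n₁) * (μ - (k + 1)) := by
    rw [D, Matrix.det_fin_two_of]
    field_simp
  change 1 ≤ k ∧ D α n μ α₁ n₁ μ₁ k = 0 ↔ _
  rw [← mul_left_inj' hk0, e, zero_mul, sub_eq_zero]

/-- If the sums were equal, the resonance equation would force `μ = μ₁`, contrary to
incomparability. -/
theorem TwoPairs.order_sum_ne (h : TwoPairs ρ α n μ α₁ n₁ μ₁) (hk : k ∈ K α n μ α₁ n₁ μ₁) :
    (α : ℚ) + n ≠ α₁ + n₁ := by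
  intro he
  have h1 := (mem_K_iff.1 hk).2
  have hα : (0 : ℚ) < α := by exact_mod_cast h.pos
  have hn : (0 : ℚ) ≤ n := Nat.cast_nonneg _
  rw [← he] at h1
  have h2 := mul_left_cancel₀ (by linarith) h1
  have h3 : (μ₁ : ℚ) = μ := by linarith
  have h4 : μ₁ = μ := by exact_mod_cast h3
  have := h.indep
  omega

/-- `(k + 1) D_k` is affine in `k` with slope `(α₁ + n₁) - (α + n)`, nonzero as soon as there is a
resonance. -/
theorem TwoPairs.subsingleton_K (h : TwoPairs ρ α n μ α₁ n₁ μ₁) :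
    (K α n μ α₁ n₁ μ₁).Subsingleton := by
  intro k hk k' hk'
  have h0 := h.order_sum_ne hk
  have h1 := (mem_K_iff.1 hk).2
  have h2 := (mem_K_iff.1 hk').2
  have h3 : ((α : ℚ) + n - (α₁ + n₁)) * ((k : ℚ) - k') = 0 := by linear_combination h2 - h1
  have h4 := (mul_eq_zero.1 h3).resolve_left (sub_ne_zero.2 h0)
  exact_mod_cast sub_eq_zero.1 h4

theorem lam_eq_iff (h0 : (α : ℚ) + n ≠ α₁ + n₁) (m : ℕ) : lam α n μ α₁ n₁ μ₁ = m ↔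
    ((α : ℚ) + n) * (μ₁ - (m + 1)) = (α₁ + n₁) * (μ - (m + 1)) := by
  have h1 : (α₁ : ℚ) + n₁ - (α + n) ≠ 0 := sub_ne_zero.2 h0.symm
  rw [lam, sub_eq_iff_eq_add, div_eq_iff h1]
  constructor <;> intro h <;> linear_combination -h

theorem TwoPairs.K_eq_empty_iff (h : TwoPairs ρ α n μ α₁ n₁ μ₁) : K α n μ α₁ n₁ μ₁ = ∅ ↔
    α + n = α₁ + n₁ ∨ ¬ ∃ m : ℕ, 1 ≤ m ∧ lam α n μ α₁ n₁ μ₁ = m := by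
  rw [Set.eq_empty_iff_forall_notMem]
  constructor
  · intro hK
    by_cases h0 : α + n = α₁ + n₁
    · exact Or.inl h0
    · refine Or.inr ?_
      rintro ⟨m, hm, hl⟩
      exact hK m (mem_K_iff.2 ⟨hm, (lam_eq_iff (by exact_mod_cast h0) m).1 hl⟩)
  · rintro h1 k hk
    have h0 := h.order_sum_ne hk
    rcases h1 with h1 | h1
    · exact h0 (by exact_mod_cast h1)
    · exact h1 ⟨k, hk.1, (lam_eq_iff h0 k).2 (mem_K_iff.1 hk).2⟩

end Resonance

/-! ### The linear part of a map between normal forms -/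

section LinearPart

variable {T : Fin 2 → MvPowerSeries (Fin 2) ℂ} {P P' : MvPowerSeries (Fin 3) ℂ} {α n μ : ℕ}

theorem IsTransform.exists_mem_CSet (h : IsTransform T P P') :
    ∃ r : ℝ, coeff (mon ![0, 1]) (T 1) = (r : ℂ) ∧ ∀ α n μ : ℕ, 1 ≤ α → 2 ≤ α + μ →
      Leading α n μ P → coeff (mon ![α, n, μ]) P' = coeff (mon ![α, n, μ]) P →
      (coeff (mon ![1, 0]) (T 0), r) ∈ CSet α n μ := by
  obtain ⟨-, hr, ha, hg⟩ := h.linear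
  obtain ⟨r, hr⟩ := Complex.conj_eq_iff_real.1 hr
  refine ⟨r, hr, fun α n μ hα hαμ hP he => ⟨ha, fun h0 => hg (by rw [hr, show r = 0 from h0, Complex.ofReal_zero]),
    ?_⟩⟩
  have hl := (h.leading hP hα hαμ).2
  rw [he] at hl
  have h1 := mul_right_cancel₀ hP.ne_zero hl
  rw [hr] at hg h1
  rw [zpow_sub₀ hg, zpow_one, zpow_natCast, ← mul_div_assoc, h1, div_self hg]

end LinearPart

end
end FormalHypersurface


namespace FormalHypersurface
open MvPowerSeries

noncomputable section

/-! ### Maps tangent to the identity -/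

section Rigidity

variable {ρ : MvPowerSeries (Fin 4) ℂ} {H S T : Fin 2 → MvPowerSeries (Fin 2) ℂ}
  {Q Q' P P' : MvPowerSeries (Fin 3) ℂ} {α n μ α₁ n₁ μ₁ α' n' μ' k δ N : ℕ} {c : ℝ} {ε : ℂ}

theorem coeff_restr (F : MvPowerSeries (Fin 2) ℂ) (i : ℕ) :
    coeff (mon ![0, i, 0]) (restr F) = coeff (mon ![i, 0]) F := by
  have hv : Vanish (![X 1, 0] : Fin 2 → MvPowerSeries (Fin 3) ℂ) := by simp
  have hw : Vanish (![X 1, X 2] : Fin 2 → MvPowerSeries (Fin 3) ℂ) := by simp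
  rw [← coeff_subst_tail F i 0, ← sub_eq_zero, ← map_sub]
  refine Supp.coeff_eq_zero (S := fun d => 1 ≤ d 2) (Supp.subst_sub_of_ideal hv.hasSubst hw.hasSubst
    (by intro d e h; rw [Finsupp.add_apply]; omega) (fun i => ?_) F) (by simp [mon_apply])
  fin_cases i
  · simpa using Supp.zero (S := fun d : Fin 3 →₀ ℕ => 1 ≤ d 2)
  · simpa using (Supp.X (S := fun d : Fin 3 →₀ ℕ => 1 ≤ d 2) (i := 2) (by simp)).neg

/-- In `f^n - χ^n = (f - χ) ∑ f^i χ^{n-1-i}` the sum has coefficient `n ≠ 0` at `χ^{n-1}`, so it is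
not zero. -/
theorem eq_of_pow_eq_of_tangent {f : MvPowerSeries (Fin 3) ℂ} (hn : 1 ≤ n)
    (hf : Sup (fun _ b _ => 2 ≤ b) (f - X 1)) (h : f ^ n = X 1 ^ n) : f = X 1 := by
  have hX : Sup (fun _ b _ => 1 ≤ b) (X 1 : MvPowerSeries (Fin 3) ℂ) := sup_X_one le_rfl
  have hf1 : Sup (fun _ b _ => 1 ≤ b) f := by
    rw [← sub_add_cancel f (X 1)]
    exact (hf.imp (by intros; omega)).add hX
  have hXn : ∀ m : ℕ, coeff (mon ![0, m, 0]) ((X 1 : MvPowerSeries (Fin 3) ℂ) ^ m) = 1 := by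
    intro m
    rw [coeff_X_pow, if_pos]
    ext l; fin_cases l <;> simp [mon_apply]
  have hp : ∀ i, Sup (fun _ b _ => i + 1 ≤ b) (f ^ i - X 1 ^ i) := fun i =>
    Sup.pow_sub hf (S' := fun m _ b _ => m ≤ b)
      (fun i j => Sup.mul (hf1.pow_mid i) (hX.pow_mid j) (by intros; omega)) i (by intros; omega)
  have hs : ∑ i ∈ Finset.range n, f ^ i * X 1 ^ (n - 1 - i) ≠ 0 := by
    intro h0
    have h1 := congrArg (coeff (mon ![0, n - 1, 0])) h0
    rw [map_sum, map_zero, Finset.sum_congr rfl (g := fun _ => (1 : ℂ))] at h1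
    · simp at h1; omega
    · intro i hi
      rw [Finset.mem_range] at hi
      have h2 : Sup (fun _ b _ => n ≤ b) ((f ^ i - X 1 ^ i) * X 1 ^ (n - 1 - i)) :=
        Sup.mul (hp i) (hX.pow_mid (n - 1 - i)) (by intros; omega)
      have h3 := h2.coeff_eq_zero (a := 0) (b := n - 1) (c := 0) (by omega)
      rw [sub_mul, ← pow_add, show i + (n - 1 - i) = n - 1 by omega, map_sub, hXn] at h3
      exact sub_eq_zero.1 h3
  have h1 := (Commute.all f (X 1)).geom_sum₂_mul n
  rw [h, sub_self] at h1
  exact sub_eq_zero.1 ((mul_eq_zero.1 h1).resolve_left hs)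

/-- A change of coordinates tangent to the identity which preserves a monomial leading coefficient
is the identity along `w = 0` in its first component. -/
theorem IsTransform.isNearIdentity_one (h : IsTransform T P P') (hP : Above α μ P) (hα : 1 ≤ α)
    (hαμ : 2 ≤ α + μ) (hn : 1 ≤ n) {u : ℂ} (hu : u ≠ 0)
    (h1 : ∀ j, coeff (mon ![α, j, μ]) P = if j = n then u else 0)
    (h2 : ∀ j, coeff (mon ![α, j, μ]) P' = if j = n then u else 0)
    (hF : coeff (mon ![1, 0]) (T 0) = 1) (hG : coeff (mon ![0, 1]) (T 1) = 1) :
    IsNearIdentity 1 0 T := by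
  set f := restr (conj (T 0)) with hf
  have hf0 : constantCoeff (conj (T 0)) = 0 := by rw [constantCoeff_conj, h.bihol.1 0, map_zero]
  have hv := vanish_unit (constantCoeff_restr hf0)
  have hcf : cf P α μ = C u * (X () : MvPowerSeries Unit ℂ) ^ n := by
    refine MvPowerSeries.ext fun d => ?_
    have hds : d = Finsupp.single () (d ()) := by ext; simp
    rw [hds, coeff_cf, h1, coeff_C_mul, coeff_X_pow]
    simp
  -- Both leading coefficients are `u χ^n`; with unit linear coefficients the transformation rule
  -- becomes `u f^n = u χ^n`.
  have hpow : f ^ n = X 1 ^ n := by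
    have hsup : Sup (fun a _ c => a = 0 ∧ c = 0) f :=
      (sup_restr_of (R := fun _ _ => True) Supp.trivial).imp (by intros; omega)
    have hsn : Sup (fun a _ c => a = 0 ∧ c = 0) (f ^ n) :=
      hsup.pow (fun _ a _ c => a = 0 ∧ c = 0) (by simp) (by intros; omega) n
    ext d
    rw [eq_mon₃ d]
    by_cases hd : d 0 = 0 ∧ d 2 = 0
    · have hl := h.coeff_lead_eq hP hα hαμ (d 1)
      rw [hF, hG, h2, hcf, subst_mul hv.hasSubst, subst_C, subst_pow hv.hasSubst,
        subst_X hv.hasSubst, coeff_C_mul] at hl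
      rw [hd.1, hd.2]
      have : coeff (mon ![0, d 1, 0]) ((X 1 : MvPowerSeries (Fin 3) ℂ) ^ n) =
          if d 1 = n then 1 else 0 := by
        rw [coeff_X_pow]
        congr 1
        rw [eq_iff_iff]
        constructor
        · intro h; have := DFunLike.congr_fun h 1; simpa [mon_apply] using this
        · intro h; ext l; fin_cases l <;> simp [mon_apply, h]
      rw [this]
      refine mul_left_cancel₀ hu ?_
      simp only [one_pow, one_mul] at hl
      rw [← hl]
      split_ifs <;> simp
    · rw [hsn.coeff_eq_zero hd, Sup.coeff_eq_zero (S := fun a _ c => a = 0 ∧ c = 0)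
        (sup_X_one_pow n (by simp)) hd]
  have hfX : f = X 1 := by
    refine eq_of_pow_eq_of_tangent hn ?_ hpow
    have := sup_restr_sub_linear hf0
    rwa [coeff_conj, hF, map_one, map_one, one_mul] at this
  refine ⟨le_rfl, by omega, fun d hd => ?_, fun d hd h0 => ?_⟩
  · by_contra hlt
    have hd1 : d 1 = 0 := by omega
    apply hd
    rw [eq_mon₂ d, hd1, ← map_zero (starRingEnd ℂ), ← Complex.conj_conj (coeff _ _), ← coeff_conj,
      ← coeff_restr, conj_sub, conj_X, restr, subst_sub vanish_restr.hasSubst,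
      subst_X vanish_restr.hasSubst, ← restr, ← hf, hfX]
    simp
  · by_contra hlt
    apply hd
    rw [eq_mon₂ d, h0, map_sub]
    rcases Nat.eq_zero_or_pos (d 1) with h3 | h3
    · rw [h3, show mon ![0, 0] = (0 : Fin 2 →₀ ℕ) by ext i; fin_cases i <;> rfl,
        coeff_zero_eq_constantCoeff_apply, h.bihol.1 1]
      simp
    · rw [show d 1 = 1 by omega, hG, ← single_eq_mon₂_one, coeff_index_single_X, if_pos rfl,
        sub_self]

theorem IsNearIdentity.shear (hT : IsNearIdentity k 0 T) (h : coeff (mon ![0, k]) (T 0) = 0) :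
    IsNearIdentity k 1 T := by
  refine ⟨hT.pos, le_rfl, fun d hd => ⟨(hT.fst d hd).1, ?_⟩, hT.snd⟩
  have h1 := (hT.fst d hd).1
  by_contra hlt
  apply hd
  rw [eq_mon₂ d, show d 0 = 0 by omega, show d 1 = k by omega, coeff_fst_sub hT.pos, h]

theorem IsNearIdentity.succ (hT : IsNearIdentity k 1 T)
    (h : ∀ j, 1 ≤ j → coeff (mon ![j, k]) (T 0) = 0) (h' : coeff (mon ![0, k + 1]) (T 1) = 0) :
    IsNearIdentity (k + 1) 0 T := by
  have h1 : Supp (fun d => k + 1 ≤ d 1) (T 0 - X 0) := by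
    intro d hd
    have h1 := hT.fst d hd
    by_contra hlt
    apply hd
    rw [eq_mon₂ d, show d 1 = k by omega, coeff_fst_sub hT.pos, h _ (by omega)]
  refine ⟨by omega, by omega, fun d hd => ⟨h1 d hd, ?_⟩, fun d hd h0 => ?_⟩
  · have := h1 d hd; omega
  · have h1 := hT.snd d hd h0
    by_contra hlt
    apply hd
    rw [eq_mon₂ d, h0, show d 1 = k + 1 by omega, coeff_snd_sub hT.pos, h']

/-- For `z = χ = 0` the `P`-term contains both `F(0, τ)` and `F̄(0, τ)`, hence has order at least `k
+ 2`, so the coefficient of `τ^{k+1}` in `G(0, τ)` is real. -/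
theorem IsTransform.conj_coeff_axis (h : IsTransform T P P') (hT : IsNearIdentity k 1 T) :
    starRingEnd ℂ (coeff (mon ![0, k + 1]) (T 1)) = coeff (mon ![0, k + 1]) (T 1) := by
  have hk := hT.pos
  have hv : Vanish (![0, X 2] : Fin 2 → MvPowerSeries (Fin 3) ℂ) := by simp
  have h1 := congrArg (coeff (mon ![0, 0, k + 1])) h.eqn_axis
  rw [map_add, coeff_subst_axis, coeff_subst_axis, coeff_conj] at h1
  have h2 : Sup (fun _ _ c => k + 2 ≤ c)
      (subst ![subst ![0, X 2] (T 0), subst ![0, X 2] (conj (T 0)),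
        subst ![0, X 2] (conj (T 1))] P) := by
    refine Sup.subst₃ (S := fun a b _ => 1 ≤ a ∧ 1 ≤ b) (h.vanish hv hv) h.supp fun i j l hij => ?_
    exact Sup.mul₃ (hT.sup_axis_fst.pow_axis (by omega) i)
      (hT.conj.sup_axis_fst.pow_axis (by omega) j) (Sup.trivial _) (by intros; omega)
  rw [h2.coeff_eq_zero (by omega), add_zero] at h1
  exact h1.symm

/-- All layers of `F - z` vanish and `G(0, w) = w`. The case `χ = 0` then gives `G = w`, because `P`
is evaluated at `F̄(0, τ) = 0`. -/
theorem IsTransform.eq_X (h : IsTransform T P P') (hT : ∀ k, 1 ≤ k → IsNearIdentity k 0 T) :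
    T = X := by
  have h0 : T 0 = X 0 := by
    ext d
    rw [← sub_eq_zero, ← map_sub]
    refine (hT (d 1 + 1) (by omega)).fst.coeff_eq_zero (by omega)
  have h1 : Supp (fun d => d 0 ≠ 0) (T 1 - X 1) := by
    intro d hd hd0
    have := (hT (d 1 + 1) (by omega)).snd d hd hd0
    omega
  have hv : Vanish (![0, X 2] : Fin 2 → MvPowerSeries (Fin 3) ℂ) := by simp
  have h2 : subst (![0, X 2] : Fin 2 → MvPowerSeries (Fin 3) ℂ) (conj (T 1)) = X 2 := by
    have h3 : Sup (fun _ _ _ => False)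
        (subst (![0, X 2] : Fin 2 → MvPowerSeries (Fin 3) ℂ) (conj (T 1 - X 1))) :=
      Sup.subst_zero₂ (by simp) (R := fun a _ => a ≠ 0) h1.conj fun b hb => absurd rfl hb
    have h4 : subst (![0, X 2] : Fin 2 → MvPowerSeries (Fin 3) ℂ) (conj (T 1 - X 1)) = 0 := by
      ext d; exact Supp.coeff_eq_zero h3 (fun h => h)
    rw [conj_sub, conj_X, subst_sub hv.hasSubst, subst_X hv.hasSubst, sub_eq_zero] at h4
    exact h4
  have h3 := h.eqn_mid
  rw [h2, h0, conj_X, subst_X hv.hasSubst] at h3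
  have hw : Vanish (![X 0, X 2] : Fin 2 → MvPowerSeries (Fin 3) ℂ) := by simp
  rw [subst_X hw.hasSubst] at h3
  simp only [Matrix.cons_val] at h3
  rw [subst_eq_zero_of_supp_mid (h.supp.mono fun d hd => hd.2) (by simp), add_zero] at h3
  funext i
  fin_cases i
  · exact h0
  · ext d
    change coeff d (T 1) = coeff d (X 1)
    have h4 : subst (![X 0, X 2] : Fin 2 → MvPowerSeries (Fin 3) ℂ)
        (X 1 : MvPowerSeries (Fin 2) ℂ) = X 2 := by
      rw [subst_X hw.hasSubst]; rfl
    rw [eq_mon₂ d, ← coeff_subst_outer, ← coeff_subst_outer, h3, h4]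

/-- The coefficient of `w^{k+1}` in the second component of `T ∘ S` for `S` close to the
identity. -/
theorem coeff_axis_comp (hT : constantCoeff (T 1) = 0) (hz : coeff (mon ![1, 0]) (T 1) = 0)
    (hS : IsFormalBihol S) (hk : IsNearIdentity k 1 S) :
    coeff (mon ![0, k + 1]) (comp T S 1) = coeff (mon ![0, k + 1]) (T 1) +
      coeff (mon ![0, 1]) (T 1) * coeff (mon ![0, k + 1]) (S 1) := by
  set ax : Fin 2 → MvPowerSeries (Fin 2) ℂ := ![0, X 1] with hax
  have hv : Vanish ax := vanish_zero_X
  set s : Fin 2 → MvPowerSeries (Fin 2) ℂ := fun i => subst ax (S i) with hs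
  have hsv : Vanish s := fun i => by rw [hs, constantCoeff_subst_vanish hv, hS.1 i]
  set g := coeff (mon ![0, 1]) (T 1) with hg
  have hR : Ord 2 (T 1 - C g * X 1) := by
    rw [ord_two_iff]
    refine ⟨by simp [hT], fun i => ?_⟩
    rw [map_sub, coeff_C_mul, coeff_index_single_X]
    fin_cases i
    · simp [single_eq_mon₂_zero, hz]
    · simp [single_eq_mon₂_one, hg]
  have hsub : ∀ i, Ord (k + 1) (s i - ax i) := by
    intro i
    have hdeg : ∀ f : MvPowerSeries (Fin 2) ℂ, Supp (fun d => k + 1 ≤ d 1) f → Ord (k + 1) f :=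
      fun f hf => hf.mono fun d hd => by rw [degree_eq_sum', Fin.sum_univ_two]; omega
    fin_cases i
    · have := hdeg _ (supp_axis hk.fst_axis)
      simpa [hs, hax] using this
    · have := hdeg _ (supp_axis hk.snd)
      rwa [subst_sub hv.hasSubst, subst_X hv.hasSubst] at this
  -- The remainder of order two changes only by order `(k + 1) + 2 - 1 = k + 2`, so just the linear
  -- term of the outer map contributes.
  have h1 := (Ord.subst_sub hsv hv hsub hR).coeff_eq_zero (d := mon ![0, k + 1]) (by
    rw [degree_eq_sum', Fin.sum_univ_two]; simp [mon_apply])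
  have hcomp : subst s (T 1) = subst ax (comp T S 1) := (subst_subst hS.1 hv (T 1)).symm
  have h2 : subst s (T 1 - C g * X 1) = subst s (T 1) - C g * s 1 := by
    rw [subst_sub hsv.hasSubst, subst_mul hsv.hasSubst, subst_C, subst_X hsv.hasSubst]
  have h3 : subst ax (T 1 - C g * X 1) = subst ax (T 1) - C g * ax 1 := by
    rw [subst_sub hv.hasSubst, subst_mul hv.hasSubst, subst_C, subst_X hv.hasSubst]
  have h4 : coeff (mon ![0, k + 1]) (ax 1) = 0 := by
    have := coeff_snd_sub (T := X) hk.pos 0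
    rw [sub_self, map_zero] at this
    exact this.symm
  rw [h2, h3, hcomp, map_sub, map_sub, map_sub, coeff_C_mul, coeff_C_mul, coeff_axis, coeff_axis, h4,
    coeff_axis] at h1
  linear_combination h1

end Rigidity

end
end FormalHypersurface


namespace FormalHypersurface
open MvPowerSeries

noncomputable section

/-! ### Uniqueness of the normalizing map -/

section Uniqueness

variable {ρ : MvPowerSeries (Fin 4) ℂ} {H S T₁ T₂ : Fin 2 → MvPowerSeries (Fin 2) ℂ}
  {Q Q' : MvPowerSeries (Fin 3) ℂ} {α n μ α₁ n₁ μ₁ α' n' μ' k : ℕ} {c : ℝ} {ε : ℂ}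

theorem Setting.shift_eq_zero (h : Setting ρ α n μ α₁ n₁ μ₁ α' n' μ' c ε)
    (hH : IsNormalCoordinates ρ H) (hC : IsComplexEquation ρ H Q)
    {P' : MvPowerSeries (Fin 3) ℂ} (ht : IsTransform S (Q - X 2) P') (hS : IsNearIdentity k 0 S)
    (hk : Cond (Q - X 2) α n μ α₁ n₁ μ₁ α' n' μ' ε k)
    (hk' : Cond P' α n μ α₁ n₁ μ₁ α' n' μ' ε k) : coeff (mon ![0, k]) (S 0) = 0 := by
  have h3 := h.leading_choice hH hC
  have hα' := h.one_lt'
  have h1 := ht.coeff_shifted hS (by omega) h3.above h3.lead le_rfl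
  rw [if_pos rfl, hk.shifted, hk'.shifted, zero_add] at h1
  have hα0 : (α' : ℂ) ≠ 0 := by exact_mod_cast (by omega : α' ≠ 0)
  exact (mul_eq_zero.1 ((mul_eq_zero.1 h1.symm).resolve_left h3.ne_zero)).resolve_left hα0

/-- The equations of `exists_shear` with zero right-hand sides. At a resonance the second pair gives
no equation, and `hr` takes its place. -/
theorem Setting.shear_eq_zero (h : Setting ρ α n μ α₁ n₁ μ₁ α' n' μ' c ε)
    (hH : IsNormalCoordinates ρ H) (hC : IsComplexEquation ρ H Q)
    {P' : MvPowerSeries (Fin 3) ℂ} (ht : IsTransform S (Q - X 2) P') (hS : IsNearIdentity k 1 S)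
    (hP : Prelim (Q - X 2) α n μ α₁ n₁ μ₁ c ε)
    (hk : Cond (Q - X 2) α n μ α₁ n₁ μ₁ α' n' μ' ε k)
    (hk' : Cond P' α n μ α₁ n₁ μ₁ α' n' μ' ε k)
    (hr : k ∈ K α n μ α₁ n₁ μ₁ → (coeff (mon ![0, k + 1]) (S 1)).re = 0) :
    (∀ j, 1 ≤ j → coeff (mon ![j, k]) (S 0) = 0) ∧ coeff (mon ![0, k + 1]) (S 1) = 0 := by
  have h1 := h.leading _ _ hH hC
  have h2 := h.leading' _ _ hH hC
  have hlt : (α : ℝ) < n := by exact_mod_cast h.lt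
  have hα0 : (0 : ℝ) ≤ α := Nat.cast_nonneg _
  have hn0 : (n : ℂ) ≠ 0 := by exact_mod_cast (by have := h.lt; omega : n ≠ 0)
  have hε := h.ε_ne
  obtain ⟨r, hrr⟩ := Complex.conj_eq_iff_real.1 (ht.conj_coeff_axis hS)
  set a := coeff (mon ![1, k]) (S 0) with ha
  have hI : (2 * Complex.I : ℂ) ≠ 0 := by simp
  have key : ∀ b, n ≤ b → (if b = n then (α : ℂ) * a + μ * r - (k + 1) * r else 0) +
      n * starRingEnd ℂ (coeff (mon ![b + 1 - n, k]) (S 0)) = 0 := by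
    intro b hb
    have h4 := ht.coeff_top hS h.pos h.two_le h1.above (hP.lead b) (b := b) le_rfl
    rw [hk.degree b hb, hk'.degree b hb, zero_add, hP.fst, if_pos rfl, if_pos hb, hrr,
      Complex.conj_ofReal] at h4
    exact (mul_eq_zero.1 h4.symm).resolve_left hI
  have hj : ∀ j, 2 ≤ j → coeff (mon ![j, k]) (S 0) = 0 := by
    intro j hj
    have h4 := key (j + n - 1) (by omega)
    rw [if_neg (by omega), zero_add, show j + n - 1 + 1 - n = j by omega] at h4
    have h5 := (mul_eq_zero.1 h4).resolve_left hn0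
    simpa using h5
  have h4 := key n le_rfl
  rw [if_pos rfl, add_tsub_cancel_left, ← ha] at h4
  have him : a.im = 0 := by
    have h5 := congrArg Complex.im h4
    simp at h5
    have h6 : ((α : ℝ) - n) * a.im = 0 := by linear_combination h5
    exact (mul_eq_zero.1 h6).resolve_left (by linarith)
  have hre : ((α : ℝ) + n) * a.re + (μ - (k + 1)) * r = 0 := by
    have h5 := congrArg Complex.re h4
    simp at h5
    linear_combination h5
  have hr0 : r = 0 := by
    by_cases hK : k ∈ K α n μ α₁ n₁ μ₁
    · have := hr hK
      rwa [hrr, Complex.ofReal_re] at this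
    · have h5 := ht.coeff_top hS h.pos' h.two_le' h2.above h2.lead (b := n₁) le_rfl
      rw [if_pos rfl, if_pos le_rfl, hP.snd, add_tsub_cancel_left, hrr, Complex.conj_ofReal,
        ← ha] at h5
      have h6 : ε⁻¹ * coeff (mon ![α₁, n₁, μ₁ + k]) P' =
          ε⁻¹ * coeff (mon ![α₁, n₁, μ₁ + k]) (Q - X 2) +
          Complex.I * (c * ((α₁ : ℂ) * a + μ₁ * r - (k + 1) * r + n₁ * starRingEnd ℂ a)) := by
        rw [h5]; field_simp
      have h7 := congrArg Complex.im h6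
      rw [Complex.add_im, hk.imag hK, hk'.imag hK, Complex.I_mul_im, zero_add,
        Complex.re_ofReal_mul] at h7
      have h8 := (mul_eq_zero.1 h7.symm).resolve_left h.c_pos.ne'
      simp at h8
      have hΔ := (notMem_K_iff hS.pos).1 hK
      have h9 : (((α : ℝ) + n) * (μ₁ - (k + 1)) - (α₁ + n₁) * (μ - (k + 1))) * r = 0 := by
        linear_combination ((α : ℝ) + n) * h8 - (α₁ + n₁) * hre
      exact (mul_eq_zero.1 h9).resolve_left hΔ
  refine ⟨fun j hj1 => ?_, by rw [hrr, hr0, Complex.ofReal_zero]⟩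
  rcases Nat.lt_or_ge j 2 with hj2 | hj2
  · rw [show j = 1 by omega, ← ha]
    rw [hr0, mul_zero, add_zero] at hre
    exact Complex.ext ((mul_eq_zero.1 hre).resolve_left (by linarith)) him
  · exact hj j hj2

/-- Induction on `k`: leading terms give closeness of weight one, and at each weight first the pure
term in `w^k`, then the rest of the layer vanishes. -/
theorem Setting.eq_X (h : Setting ρ α n μ α₁ n₁ μ₁ α' n' μ' c ε)
    (hH : IsNormalCoordinates ρ H) (hC : IsComplexEquation ρ H Q)
    {P' : MvPowerSeries (Fin 3) ℂ} (ht : IsTransform S (Q - X 2) P')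
    (hP : Prelim (Q - X 2) α n μ α₁ n₁ μ₁ c ε) (hP' : Prelim P' α n μ α₁ n₁ μ₁ c ε)
    (hc : ∀ k, 1 ≤ k → Cond (Q - X 2) α n μ α₁ n₁ μ₁ α' n' μ' ε k)
    (hc' : ∀ k, 1 ≤ k → Cond P' α n μ α₁ n₁ μ₁ α' n' μ' ε k)
    (hF : coeff (mon ![1, 0]) (S 0) = 1) (hG : coeff (mon ![0, 1]) (S 1) = 1)
    (hr : ∀ k ∈ K α n μ α₁ n₁ μ₁, IsNearIdentity k 1 S →
      (coeff (mon ![0, k + 1]) (S 1)).re = 0) : S = X := by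
  have h0 : 1 ≤ n := by have := h.lt; omega
  refine ht.eq_X fun k hk => ?_
  induction k, hk using Nat.le_induction with
  | base =>
    exact ht.isNearIdentity_one (h.leading _ _ hH hC).above h.pos h.two_le h0
      (u := 2 * Complex.I) (by simp) hP.fst hP'.fst hF hG
  | succ k hk ih =>
    have h1 := ih.shear (h.shift_eq_zero hH hC ht ih (hc k hk) (hc' k hk))
    obtain ⟨h2, h3⟩ := h.shear_eq_zero hH hC ht h1 hP (hc k hk) (hc' k hk) fun hK => hr k hK h1
    exact h1.succ h2 h3

theorem Setting.eq_of_isNormalizing (h : Setting ρ α n μ α₁ n₁ μ₁ α' n' μ' c ε)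
    (hH : IsNormalCoordinates ρ H) (hT₁ : IsFormalBihol T₁) (hT₂ : IsFormalBihol T₂)
    (h₁ : IsNormalizing ρ α n μ α₁ n₁ μ₁ α' n' μ' c ε (comp H T₁))
    (h₂ : IsNormalizing ρ α n μ α₁ n₁ μ₁ α' n' μ' c ε (comp H T₂))
    (hF : coeff (mon ![1, 0]) (T₁ 0) = coeff (mon ![1, 0]) (T₂ 0))
    (hG : coeff (mon ![0, 1]) (T₁ 1) = coeff (mon ![0, 1]) (T₂ 1))
    (hr : ∀ k ∈ K α n μ α₁ n₁ μ₁,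
      (coeff (mon ![0, k + 1]) (T₁ 1)).re = (coeff (mon ![0, k + 1]) (T₂ 1)).re) : T₁ = T₂ := by
  obtain ⟨φ, hφ⟩ := id hH
  obtain ⟨Q, hC⟩ := hφ.exists_complex h.hypersurface
  obtain ⟨hN₁, Q₁, hC₁, hQ₁⟩ := h₁
  obtain ⟨hN₂, Q₂, hC₂, hQ₂⟩ := h₂
  rw [isNormalForm_iff h.pos h.pos' h.one_lt'] at hQ₁ hQ₂
  obtain ⟨hz₁, hg₁, hf₁, hg₁'⟩ := (hH.isTransform h.hypersurface hC hT₁ hN₁ hC₁).linear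
  obtain ⟨hz₂, -, -, -⟩ := (hH.isTransform h.hypersurface hC hT₂ hN₂ hC₂).linear
  -- `T₂ = T₁ ∘ S`; equal linear data make `S` tangent to the identity in `F_z` and `G_w`, and `S`
  -- relates two normal forms.
  obtain ⟨S, hS, rfl⟩ := exists_transition hT₁ hT₂
  rw [← comp_assoc hT₁.1 hS.1] at hN₂ hC₂
  have ht := hN₁.isTransform h.hypersurface hC₁ hS hN₂ hC₂
  have hlin : ∀ i j, coeff (Finsupp.single j 1) (comp T₁ S i) =
      coeff (mon ![1, 0]) (T₁ i) * coeff (Finsupp.single j 1) (S 0) +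
        coeff (mon ![0, 1]) (T₁ i) * coeff (Finsupp.single j 1) (S 1) := by
    intro i j
    rw [← single_eq_mon₂_zero, ← single_eq_mon₂_one, comp, coeff_single_subst hS.1,
      Fin.sum_univ_two]
  have hGS : coeff (mon ![0, 1]) (S 1) = 1 := by
    have h1 := hlin 1 1
    rw [single_eq_mon₂_one, hz₁, zero_mul, zero_add, ← hG] at h1
    exact (mul_eq_left₀ hg₁').1 h1.symm
  have hFS : coeff (mon ![1, 0]) (S 0) = 1 := by
    have h1 := hlin 0 0
    rw [single_eq_mon₂_zero, ht.linear.1, mul_zero, add_zero, ← hF] at h1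
    exact (mul_eq_left₀ hf₁).1 h1.symm
  have hSX := h.eq_X hN₁ hC₁ ht hQ₁.1 hQ₂.1 hQ₁.2 hQ₂.2 hFS hGS fun k hk hkS => ?_
  · rw [hSX, comp_X]
  -- At a resonant `k`, `coeff_axis_comp` shows that the coefficients of `w^{k+1}` differ by the
  -- real nonzero factor `g = G_w(0)` times that of `S`, so equal real parts give real part zero for
  -- `S`.
  · obtain ⟨g, hg⟩ := Complex.conj_eq_iff_real.1 hg₁
    have h1 := hr k hk
    rw [coeff_axis_comp (hT₁.1 1) hz₁ hS hkS, hg, Complex.add_re, Complex.re_ofReal_mul,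
      left_eq_add] at h1
    refine (mul_eq_zero.1 h1).resolve_left fun h0 => hg₁' ?_
    rw [hg, h0, Complex.ofReal_zero]

end Uniqueness

end
end FormalHypersurface


theorem theorem4 (ρ : MvPowerSeries (Fin 4) ℂ)
    (hρ : FormalHypersurface.IsFormalHypersurface ρ)
    (α n μ α₁ n₁ μ₁ : ℕ)
    (h : (α, n, μ) ∈ FormalHypersurface.Lam ρ)
    (h₁ : (α₁, n₁, μ₁) ∈ FormalHypersurface.Lam ρ)
    (hne : (α, μ) ≠ (α₁, μ₁)) (hαn : α ≠ n) :
    -- a choice of `(α', n', μ')` is possible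
    (1 < α ∨ 1 < α₁) ∧
    -- the constants `c`, `ε` of the normalization are well defined
    (∃! cε : ℝ × ℂ, FormalHypersurface.IsPrelimConstants ρ α n μ α₁ n₁ μ₁ cε.1 cε.2) ∧
    (∀ (c : ℝ) (ε : ℂ), FormalHypersurface.IsPrelimConstants ρ α n μ α₁ n₁ μ₁ c ε →
      ∀ α' n' μ' : ℕ, ((α', n', μ') = (α, n, μ) ∨ (α', n', μ') = (α₁, n₁, μ₁)) → 1 < α' →
      -- existence of normalizing coordinates
      (∃ H, FormalHypersurface.IsNormalizing ρ α n μ α₁ n₁ μ₁ α' n' μ' c ε H) ∧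
      -- two normalizing coordinate systems are related by a formal map `T = (F, G)`
      (∀ H H', FormalHypersurface.IsNormalizing ρ α n μ α₁ n₁ μ₁ α' n' μ' c ε H →
        FormalHypersurface.IsNormalizing ρ α n μ α₁ n₁ μ₁ α' n' μ' c ε H' →
        ∃ T, FormalHypersurface.IsFormalBihol T ∧ H' = FormalHypersurface.comp H T) ∧
      -- the pair `(F_z(0), G_w(0))` of such a map
      (∀ H T, FormalHypersurface.IsFormalBihol T →
        FormalHypersurface.IsNormalizing ρ α n μ α₁ n₁ μ₁ α' n' μ' c ε H →
        FormalHypersurface.IsNormalizing ρ α n μ α₁ n₁ μ₁ α' n' μ' c ε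
          (FormalHypersurface.comp H T) →
        ∃ r : ℝ, MvPowerSeries.coeff (FormalHypersurface.mon ![0, 1]) (T 1) = (r : ℂ) ∧
          (MvPowerSeries.coeff (FormalHypersurface.mon ![1, 0]) (T 0), r) ∈
            FormalHypersurface.CSet α n μ ∩ FormalHypersurface.CSet α₁ n₁ μ₁) ∧
      -- such a map is determined by `F_z(0)`, `G_w(0)` and `Re G_{w^{k+1}}(0)`, `k ∈ K`
      (∀ H T₁ T₂, FormalHypersurface.IsFormalBihol T₁ → FormalHypersurface.IsFormalBihol T₂ →
        FormalHypersurface.IsNormalizing ρ α n μ α₁ n₁ μ₁ α' n' μ' c ε H →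
        FormalHypersurface.IsNormalizing ρ α n μ α₁ n₁ μ₁ α' n' μ' c ε
          (FormalHypersurface.comp H T₁) →
        FormalHypersurface.IsNormalizing ρ α n μ α₁ n₁ μ₁ α' n' μ' c ε
          (FormalHypersurface.comp H T₂) →
        MvPowerSeries.coeff (FormalHypersurface.mon ![1, 0]) (T₁ 0) =
          MvPowerSeries.coeff (FormalHypersurface.mon ![1, 0]) (T₂ 0) →
        MvPowerSeries.coeff (FormalHypersurface.mon ![0, 1]) (T₁ 1) =
          MvPowerSeries.coeff (FormalHypersurface.mon ![0, 1]) (T₂ 1) →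
        (∀ k ∈ FormalHypersurface.K α n μ α₁ n₁ μ₁,
          (MvPowerSeries.coeff (FormalHypersurface.mon ![0, k + 1]) (T₁ 1)).re =
            (MvPowerSeries.coeff (FormalHypersurface.mon ![0, k + 1]) (T₂ 1)).re) →
        T₁ = T₂)) ∧
    -- the set `K`
    (FormalHypersurface.K α n μ α₁ n₁ μ₁).Subsingleton ∧
    (FormalHypersurface.K α n μ α₁ n₁ μ₁ = ∅ ↔
      α + n = α₁ + n₁ ∨
        ¬ ∃ m : ℕ, 1 ≤ m ∧ FormalHypersurface.lam α n μ α₁ n₁ μ₁ = m) := by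
  have ht := FormalHypersurface.twoPairs hρ h h₁ hne hαn
  refine ⟨ht.one_lt, ht.existsUnique_constants, fun c ε hcε α' n' μ' hch hα' => ?_,
    ht.subsingleton_K, ht.K_eq_empty_iff⟩
  obtain ⟨hc, -, θ, hε, hleast⟩ := hcε
  have hs : FormalHypersurface.Setting ρ α n μ α₁ n₁ μ₁ α' n' μ' c ε :=
    ⟨ht, hch, hα', hc, by rw [hε]; exact Complex.exp_ne_zero _⟩
  -- The least argument belongs to the set it minimises, so the constants are attained and the
  -- construction can start.
  refine ⟨hs.exists_isNormalizing (by rw [hε]; exact hleast.1.2.2),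
    fun H H' hH hH' => FormalHypersurface.exists_transition hH.1.bihol hH'.1.bihol,
    fun H T hT hH hHT => ?_,
    fun H T₁ T₂ hT₁ hT₂ hH hHT₁ hHT₂ => hs.eq_of_isNormalizing hH.1 hT₁ hT₂ hHT₁ hHT₂⟩
  obtain ⟨hN, Q, hC, hQ⟩ := hH
  obtain ⟨hN', Q', hC', hQ'⟩ := hHT
  rw [FormalHypersurface.isNormalForm_iff ht.pos ht.pos' hα'] at hQ hQ'
  obtain ⟨r, hr, hmem⟩ := (hN.isTransform hρ hC hT hN' hC').exists_mem_CSet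
  exact ⟨r, hr,
    hmem _ _ _ ht.pos ht.two_le (ht.leading _ _ hN hC) (by rw [hQ.1.fst, hQ'.1.fst]),
    hmem _ _ _ ht.pos' ht.two_le' (ht.leading' _ _ hN hC) (by rw [hQ.1.snd, hQ'.1.snd])⟩
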